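/- Let $n\ge 13$ be an integer, let $q\ge 5$ be a prime power, and let $G=\mathrm{PSL}_n(q)$. Let $\Omega$ be the set of all decompositions of $V=\mathbb{F}_q^n$ as a direct sum of $1$-dimensional subspaces (a decomposition being the unordered set of its summands), with the natural action of $G$. Then: (a) the action of $G$ on $\Omega$ is primitive; (b) the action is non-standard. Here a transitive action of $G$ is called standard if either (i) it is a subspace action, i.e. each point stabilizer $M$ is a proper subgroup of $G$ and every maximal subgroup of $G$ containing $M$ is the stabilizer in $G$ of some subspace $0\ne W\subsetneq V$; or (ii) for some $m \ge 5$ there is an isomorphism $G\cong A_m$ under which the action is equivalent to the action of $A_m$ on the $k$-element subsets of $\{1,\dots,m\}$ for some $k$, or on the partitions of $\{1,\dots,m\}$ into parts of a common size $b$, for some $b$; (c) the action is equivalent to the action of $G$ on the cosets of $N_G(T)$, where $T$ is the split torus of $G$, i.e. the image in $G$ of the group of diagonal matrices in $\mathrm{SL}_n(q)$; (d) $\mathrm{B}(G,\Omega)\ge n-1$, where $\mathrm{B}(G,\Omega)$ denotes the maximum size of a minimal base: a finite sequence of points of $\Omega$ is a base if its pointwise stabilizer in $G$ is trivial, and a base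 is minimal if no proper subsequence of it is a base. In particular, for all such $n$ and $q$ there is a non-standard primitive action $(\mathrm{PSL}_n(q),\Omega)$ with $\mathrm{B}(\mathrm{PSL}_n(q),\Omega)\ge n-1$. -/

import Mathlib

open scoped Pointwise MatrixGroups

noncomputable section

/-! ### Bases of group actions -/

section Actions

variable (G : Type*) [Group G] {Ω : Type*} [MulAction G Ω]

/-- A finite sequence of points is a base if its pointwise stabilizer is trivial. -/
def IsBase (Λ : List Ω) : Prop :=
  fixingSubgroup G {ω : Ω | ω ∈ Λ} = ⊥

/-- A base is minimal if no proper subsequence of it is a base. -/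
def IsMinimalBase (Λ : List Ω) : Prop :=
  IsBase G Λ ∧ ∀ Λ' : List Ω, Λ'.Sublist Λ → Λ' ≠ Λ → ¬ IsBase G Λ'

variable (Ω) in
/-- The maximum size of a minimal base. (A positive value is attained: in `ℕ` the supremum of an
empty or unbounded set is `0`.) -/
def maxMinimalBaseSize : ℕ :=
  sSup {l : ℕ | ∃ Λ : List Ω, IsMinimalBase G Λ ∧ Λ.length = l}

variable (Ω) in
/-- A primitive action: transitive on a set with at least two points, and preserving no
nontrivial block. -/
def IsPrimitiveAction : Prop :=
  Nontrivial Ω ∧ MulAction.IsPreprimitive G Ω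

variable (Ω) in
/-- The actions of `G` on `Ω` and of `H` on `X` are equivalent by means of the group
isomorphism `e`. -/
def ActionEquivalent {H : Type*} [Group H] (e : G ≃* H) (X : Type*) [MulAction H X] : Prop :=
  ∃ f : Ω ≃ X, ∀ (g : G) (ω : Ω), f (g • ω) = e g • f ω

end Actions

/-! ### Alternating groups acting on subsets and on uniform partitions -/

/-- The `k`-element subsets of `{1, …, m}`, acted on by the alternating group. -/
def altSubsets (m k : ℕ) : SubMulAction (alternatingGroup (Fin m)) (Set (Fin m)) where
  carrier := {s | s.ncard = k}
  smul_mem' g s hs := by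
    simpa [Set.ncard_smul_set] using hs

/-- The partitions of `{1, …, m}` all of whose parts have size `b`, acted on by the alternating
group. -/
def altUniformPartitions (m b : ℕ) :
    SubMulAction (alternatingGroup (Fin m)) (Set (Set (Fin m))) where
  carrier := {P | Setoid.IsPartition P ∧ ∀ B ∈ P, B.ncard = b}
  smul_mem' g P hP := by
    obtain ⟨⟨h0, h1⟩, h2⟩ := hP
    refine ⟨⟨?_, fun a => ?_⟩, ?_⟩
    · rintro ⟨B, hB, hB0⟩
      have : B = ∅ := by simpa using hB0
      exact h0 (this ▸ hB)
    · obtain ⟨B, ⟨hB, haB⟩, huniq⟩ := h1 (g⁻¹ • a)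
      refine ⟨g • B, ⟨Set.smul_mem_smul_set hB, Set.mem_smul_set_iff_inv_smul_mem.2 haB⟩, ?_⟩
      rintro _ ⟨⟨C, hC, rfl⟩, haC⟩
      have := huniq C ⟨hC, Set.mem_smul_set_iff_inv_smul_mem.1 haC⟩
      simp [this]
    · rintro _ ⟨B, hB, rfl⟩
      simpa [Set.ncard_smul_set] using h2 B hB

/-! ### `PSL(n, F)` acting on the subspaces of `F ^ n` -/

section PSL

variable {n : ℕ} {F : Type*} [Field F]

/-- The action of `SL(n, F)` on the subspaces of its natural module, as a homomorphism. -/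
def slSubspacePerm (n : ℕ) (F : Type*) [Field F] :
    SL(n, F) →* Equiv.Perm (Submodule F (Fin n → F)) :=
  (MulAction.toPermHom ((Fin n → F) ≃ₗ[F] (Fin n → F)) (Submodule F (Fin n → F))).comp
    Matrix.SpecialLinearGroup.toLin'

theorem slSubspacePerm_apply (g : SL(n, F)) (W : Submodule F (Fin n → F)) :
    slSubspacePerm n F g W = W.map (Matrix.toLin' (g : Matrix (Fin n) (Fin n) F)) := rfl

theorem center_le_ker_slSubspacePerm :
    Subgroup.center SL(n, F) ≤ (slSubspacePerm n F).ker := by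
  intro g hg
  obtain ⟨r, hr1, hr⟩ := Matrix.SpecialLinearGroup.mem_center_iff.1 hg
  rw [MonoidHom.mem_ker]
  ext1 W
  rw [slSubspacePerm_apply, ← hr, Equiv.Perm.one_apply]
  rcases Nat.eq_zero_or_pos n with rfl | hn
  · exact Subsingleton.elim _ _
  have hr0 : r ≠ 0 := by
    rintro rfl
    rw [Fintype.card_fin, zero_pow hn.ne'] at hr1
    exact zero_ne_one hr1
  have key : Matrix.toLin' (Matrix.scalar (Fin n) r) = r • LinearMap.id := by
    refine LinearMap.ext fun v => ?_
    simp [Matrix.toLin'_apply]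
  rw [key, Submodule.map_smul _ _ _ hr0, Submodule.map_id]

/-- `PSL(n, F)` acts on the subspaces of `F ^ n`: the class of `g` sends `W` to `g W`. -/
instance pslSubspaceAction : MulAction PSL(n, F) (Submodule F (Fin n → F)) :=
  MulAction.compHom _ (QuotientGroup.lift _ (slSubspacePerm n F) center_le_ker_slSubspacePerm)

theorem psl_mk_smul (g : SL(n, F)) (W : Submodule F (Fin n → F)) :
    (QuotientGroup.mk g : PSL(n, F)) • W
      = W.map (Matrix.toLin' (g : Matrix (Fin n) (Fin n) F)) := rfl

/-- A set of subspaces is a direct sum decomposition of `F ^ n` into `1`-spaces. -/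
def IsLineDecomposition (D : Set (Submodule F (Fin n → F))) : Prop :=
  (∀ W ∈ D, Module.finrank F W = 1) ∧ sSupIndep D ∧ sSup D = ⊤

theorem IsLineDecomposition.smul {D : Set (Submodule F (Fin n → F))}
    (hD : IsLineDecomposition D) (g : PSL(n, F)) : IsLineDecomposition (g • D) := by
  obtain ⟨g, rfl⟩ := QuotientGroup.mk_surjective g
  let e := Matrix.SpecialLinearGroup.toLin' g
  let o : Submodule F (Fin n → F) ≃o Submodule F (Fin n → F) := Submodule.orderIsoMapComap e
  have himg : (QuotientGroup.mk g : PSL(n, F)) • D = o '' D := rfl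
  obtain ⟨h1, h2, h3⟩ := hD
  rw [himg]
  refine ⟨?_, ?_, ?_⟩
  · rintro _ ⟨W, hW, rfl⟩
    rw [← h1 W hW]
    exact LinearEquiv.finrank_map_eq e W
  · rintro _ ⟨W, hW, rfl⟩
    have hd : o '' D \ {o W} = o '' (D \ {W}) := by
      rw [Set.image_sdiff o.injective, Set.image_singleton]
    rw [hd, sSup_image, ← o.map_sSup]
    exact (h2 hW).map_orderIso o
  · rw [sSup_image, ← o.map_sSup, h3, o.map_top]

/-- The set of direct sum decompositions of `F ^ n` into `1`-spaces, with the action of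
`PSL(n, F)`. -/
def LineDecompositions (n : ℕ) (F : Type*) [Field F] :
    SubMulAction PSL(n, F) (Set (Submodule F (Fin n → F))) where
  carrier := {D | IsLineDecomposition D}
  smul_mem' g _ hD := IsLineDecomposition.smul hD g

/-- The split torus of `PSL(n, F)`: the image of the group of diagonal matrices of
determinant `1`. -/
def splitTorus (n : ℕ) (F : Type*) [Field F] : Subgroup PSL(n, F) :=
  (Subgroup.comap Matrix.SpecialLinearGroup.toGL
    (Units.map (Matrix.diagonalRingHom (Fin n) F).toMonoidHom).range).map
      (QuotientGroup.mk' (Subgroup.center SL(n, F)))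

/-! ### Standard actions of `PSL(n, F)` -/

/-- A subspace subgroup of `PSL(n, F)`: a proper subgroup such that every maximal subgroup
containing it is the stabilizer of a proper nonzero subspace of the natural module. -/
def IsSubspaceSubgroup (M : Subgroup PSL(n, F)) : Prop :=
  M ≠ ⊤ ∧ ∀ M₀ : Subgroup PSL(n, F), IsCoatom M₀ → M ≤ M₀ →
    ∃ W : Submodule F (Fin n → F), W ≠ ⊥ ∧ W ≠ ⊤ ∧ M₀ = MulAction.stabilizer PSL(n, F) W

/-- A standard action of `PSL(n, F)`: a transitive action which is either a subspace action
(the point stabilizers are subspace subgroups), or, if the group happens to be isomorphic to an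
alternating group `A_m`, is equivalent to the action of `A_m` on the `k`-subsets or on the
partitions into parts of size `b` of an `m`-set. -/
def IsStandardAction (n : ℕ) (F : Type*) [Field F] (Ω : Type*) [MulAction PSL(n, F) Ω] : Prop :=
  Nonempty Ω ∧ MulAction.IsPretransitive PSL(n, F) Ω ∧
    ((∀ ω : Ω, IsSubspaceSubgroup (MulAction.stabilizer PSL(n, F) ω)) ∨
      ∃ (m : ℕ) (e : PSL(n, F) ≃* alternatingGroup (Fin m)), 5 ≤ m ∧
        ((∃ k : ℕ, ActionEquivalent PSL(n, F) Ω e (altSubsets m k)) ∨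
          ∃ b : ℕ, ActionEquivalent PSL(n, F) Ω e (altUniformPartitions m b)))

end PSL

end

/-! Let `N` be the group of monomial matrices of determinant 1. Its image in `PSL(n, F)` is the
stabilizer of the coordinate decomposition and the action is transitive, so primitivity amounts to
maximality of `N` in the special linear group. Maximality also gives (c), since the stabilizer lies
in the normalizer of the torus, which is proper, and half of (b), since the stabilizer leaves no
proper nonzero subspace invariant.

Maximality (`mem_of_not_isMonomial`): let `H` contain `N`. One elementary transvection in `H` yields
all of them by conjugation, hence everything. Suppose there is none. The tool is the conjugate `h⁻¹
t h` with `t` diagonal and mostly trivial: it stays in `H`, differs from 1 by a matrix of small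
rank, and can be given prescribed zeros. An element fixing a coordinate line acts on the quotient by
that line inside a group that contains all monomial matrices and still no transvection; induction on
the support (`isMonomial_of_supportedOn`) makes that action monomial, and then the element itself
(`isMonomial_of_col_diag`). For arbitrary `h` in `H`, two zeros in one column force monomiality
(`isMonomial_of_two_zeros`), then a single zero does (`isMonomial_of_zero`), and if `h` has no zero,
some conjugate has one (`isMonomial_of_mem`). The last two steps use `exists_eigen_col`, which needs
`n ≥ 13`.

`PSL(n, F)` is not alternating by order: if `2 |PSL(n, F)| = m!`, the power of the characteristic
dividing the order forces `m` to be so large that `m!` exceeds `2 q ^ (n ^ 2)`.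

For (d), take `k + 1` vectors with sum zero in a space of dimension `k` (2 or 3) and the remaining
`r = n - k` coordinate vectors. A facet frame omits one simplex vector; a cone frame translates the
whole simplex by one tail vector. Together these frames form a base. Dropping a cone frees a torus
element, and dropping two or three facets frees a transposition or a 3-cycle of the simplex.
Choosing the cones according to whether all scalar matrices have determinant 1, every base inside
the family has at least `n - 1` members, hence so has a minimal one. -/

/-! ### Monomial matrices -/

section Monomial

set_option linter.unusedSectionVars false

variable {ι F : Type*} [Fintype ι] [DecidableEq ι] [Field F]

/-- A matrix is monomial if each of its columns has at most one nonzero entry. -/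
def Matrix.IsMonomial (M : Matrix ι ι F) : Prop :=
  ∀ j, ∃ i, ∀ k, k ≠ i → M k j = 0

theorem Matrix.IsMonomial.eq_of_ne_zero {M : Matrix ι ι F} (hM : M.IsMonomial) {i k j : ι}
    (hi : M i j ≠ 0) (hk : M k j ≠ 0) : i = k := by
  obtain ⟨l, hl⟩ := hM j
  rw [show i = l from by_contra fun h => hi (hl i h), show k = l from by_contra fun h => hk (hl k h)]

theorem Matrix.IsMonomial.mul {M N : Matrix ι ι F} (hM : M.IsMonomial) (hN : N.IsMonomial) :
    (M * N).IsMonomial := by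
  intro j
  obtain ⟨i, hi⟩ := hN j
  obtain ⟨l, hl⟩ := hM i
  refine ⟨l, fun k hk => ?_⟩
  rw [Matrix.mul_apply]
  refine Finset.sum_eq_zero fun m _ => ?_
  rcases eq_or_ne m i with rfl | h
  · rw [hl k hk, zero_mul]
  · rw [hi m h, mul_zero]

namespace Matrix.GeneralLinearGroup

theorem mul_entry (g h : GL ι F) (i j : ι) : (g * h).1 i j = ∑ k, g.1 i k * h.1 k j := rfl

theorem sum_inv_mul (g : GL ι F) (i j : ι) :
    ∑ k, g⁻¹.1 i k * g.1 k j = if i = j then 1 else 0 := by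
  rw [← mul_entry, inv_mul_cancel]; exact Matrix.one_apply

theorem sum_mul_inv (g : GL ι F) (i j : ι) :
    ∑ k, g.1 i k * g⁻¹.1 k j = if i = j then 1 else 0 := by
  rw [← mul_entry, mul_inv_cancel]; exact Matrix.one_apply

theorem one_entry (i j : ι) : (1 : GL ι F).1 i j = if i = j then 1 else 0 := Matrix.one_apply

theorem exists_col_ne_zero (g : GL ι F) (j : ι) : ∃ i, g.1 i j ≠ 0 := by
  by_contra! h
  have := sum_inv_mul g j j
  simp [h] at this

theorem exists_row_ne_zero (g : GL ι F) (i : ι) : ∃ j, g.1 i j ≠ 0 := by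
  by_contra! h
  have := sum_mul_inv g i i
  simp [h] at this

/-- Two columns of an invertible matrix supported on the same row coincide. -/
theorem col_injective (g : GL ι F) {i j k : ι} (hj : ∀ l, l ≠ i → g.1 l j = 0)
    (hk : ∀ l, l ≠ i → g.1 l k = 0) : j = k := by
  by_contra hjk
  have e : ∀ m r, (∀ l, l ≠ i → g.1 l m = 0) → g⁻¹.1 r i * g.1 i m = if r = m then 1 else 0 := by
    intro m r hm
    rw [← sum_inv_mul g r m, Finset.sum_eq_single i (fun b _ hb => by rw [hm b hb, mul_zero])
      (by simp)]
  have h1 := e j j hj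
  have h2 := e k j hk
  have h3 := e k k hk
  rw [if_pos rfl] at h1 h3
  rw [if_neg hjk] at h2
  rcases mul_eq_zero.1 h2 with h | h
  · rw [h, zero_mul] at h1; exact zero_ne_one h1
  · rw [h, mul_zero] at h3; exact zero_ne_one h3

/-- An invertible monomial matrix is a permutation matrix with scaled columns. -/
theorem exists_perm_of_isMonomial {g : GL ι F} (hg : g.1.IsMonomial) :
    ∃ σ : Equiv.Perm ι, (∀ j, g.1 (σ j) j ≠ 0) ∧ ∀ i j, i ≠ σ j → g.1 i j = 0 := by
  choose f hf using hg
  have hinj : Function.Injective f := fun j k hjk =>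
    col_injective g (i := f j) (hf j) (by rw [hjk]; exact hf k)
  refine ⟨Equiv.ofBijective f hinj.bijective_of_finite, fun j => ?_, fun i j hij => hf j i hij⟩
  obtain ⟨i, hi⟩ := exists_col_ne_zero g j
  have : i = f j := by_contra fun h => hi (hf j i h)
  rwa [this] at hi

theorem isMonomial_inv {g : GL ι F} (hg : g.1.IsMonomial) : g⁻¹.1.IsMonomial := by
  obtain ⟨σ, h1, h2⟩ := exists_perm_of_isMonomial hg
  intro i
  refine ⟨σ.symm i, fun k hk => ?_⟩
  have := sum_inv_mul g k (σ.symm i)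
  rw [if_neg hk, Finset.sum_eq_single i
    (fun b _ hb => by rw [h2 b _ (by simpa using hb), mul_zero]) (by simp)] at this
  rcases mul_eq_zero.1 this with h | h
  · exact h
  · exact absurd h (by simpa using h1 (σ.symm i))

variable (ι F) in
/-- The group of invertible monomial matrices. -/
def monomialGroup : Subgroup (GL ι F) where
  carrier := {g | g.1.IsMonomial}
  mul_mem' := Matrix.IsMonomial.mul
  one_mem' j := ⟨j, fun k hk => by rw [one_entry, if_neg hk]⟩
  inv_mem' := isMonomial_inv

theorem isMonomial_mul_left_iff {g h : GL ι F} (hg : g.1.IsMonomial) :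
    (g * h).1.IsMonomial ↔ h.1.IsMonomial :=
  Subgroup.mul_mem_cancel_left (monomialGroup ι F) hg

/-- The invertible diagonal matrix with given entries. -/
def diag (t : ι → Fˣ) : GL ι F where
  val := Matrix.diagonal fun i => (t i : F)
  inv := Matrix.diagonal fun i => ((t i)⁻¹ : Fˣ)
  val_inv := by simp
  inv_val := by simp

theorem diag_apply (t : ι → Fˣ) (i j : ι) :
    (diag t).1 i j = if i = j then (t i : F) else 0 := Matrix.diagonal_apply _ _ _

theorem diag_inv (t : ι → Fˣ) : (diag t)⁻¹ = diag t⁻¹ := by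
  apply inv_eq_of_mul_eq_one_left
  apply Units.ext
  exact (diag t).inv_val

theorem det_diag (t : ι → Fˣ) : (diag t).1.det = ∏ i, (t i : F) := Matrix.det_diagonal

theorem isMonomial_diag (t : ι → Fˣ) : (diag t).1.IsMonomial := fun j =>
  ⟨j, fun k hk => by rw [diag_apply, if_neg hk]⟩

theorem diag_mul_apply (t : ι → Fˣ) (g : GL ι F) (i j : ι) :
    (diag t * g).1 i j = t i * g.1 i j := Matrix.diagonal_mul _ _ _ _

theorem mul_diag_apply (t : ι → Fˣ) (g : GL ι F) (i j : ι) :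
    (g * diag t).1 i j = g.1 i j * t j := Matrix.mul_diagonal _ _ _ _

/-- Only the `k` with `t k ≠ 1` contribute to the sum, so the conjugate is the identity plus a
matrix of small rank whose entries can be steered through `t`. -/
theorem conj_diag_apply (t : ι → Fˣ) (g : GL ι F) (i j : ι) :
    (g⁻¹ * diag t * g).1 i j = (if i = j then 1 else 0)
      + ∑ k, g⁻¹.1 i k * ((t k : F) - 1) * g.1 k j := by
  rw [mul_entry, ← sum_inv_mul g i j, ← Finset.sum_add_distrib]
  refine Finset.sum_congr rfl fun k _ => ?_
  rw [mul_diag_apply]; ring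

/-- The permutation matrix sending `e_j` to `e_{σ j}`. -/
def permGL (F : Type*) [Field F] (σ : Equiv.Perm ι) : GL ι F where
  val := Matrix.of fun i j => if i = σ j then 1 else 0
  inv := Matrix.of fun i j => if σ i = j then 1 else 0
  val_inv := by
    ext i j
    simp [Matrix.mul_apply, Matrix.one_apply, Finset.sum_ite, ← Equiv.symm_apply_eq]
  inv_val := by
    ext i j
    simp [Matrix.mul_apply, Matrix.one_apply]

theorem permGL_apply (σ : Equiv.Perm ι) (i j : ι) :
    (permGL F σ).1 i j = if i = σ j then 1 else 0 := rfl

theorem permGL_inv_apply (σ : Equiv.Perm ι) (i j : ι) :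
    (permGL F σ)⁻¹.1 i j = if σ i = j then 1 else 0 := rfl

theorem isMonomial_permGL (σ : Equiv.Perm ι) : (permGL F σ).1.IsMonomial := fun j =>
  ⟨σ j, fun k hk => by rw [permGL_apply, if_neg hk]⟩

theorem permGL_mul_apply (σ : Equiv.Perm ι) (g : GL ι F) (i j : ι) :
    (permGL F σ * g).1 i j = g.1 (σ.symm i) j := by
  rw [mul_entry, Finset.sum_eq_single (σ.symm i)]
  · simp [permGL_apply]
  · intro b _ hb
    rw [permGL_apply, if_neg (fun h => hb (by simp [h])), zero_mul]
  · simp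

theorem conj_permGL_apply (σ : Equiv.Perm ι) (g : GL ι F) (i j : ι) :
    (permGL F σ * g * (permGL F σ)⁻¹).1 i j = g.1 (σ.symm i) (σ.symm j) := by
  rw [mul_entry, Finset.sum_eq_single (σ.symm j)]
  · simp [permGL_inv_apply, permGL_mul_apply]
  · intro b _ hb
    rw [permGL_inv_apply, if_neg (fun h => hb (by simp [← h])), mul_zero]
  · simp

theorem rowMatrix_mul_self (j : ι) (w : ι → F) :
    (Matrix.of fun a b => if a = j ∧ b ≠ j then w b else 0)
      * (Matrix.of fun a b => if a = j ∧ b ≠ j then w b else 0) = (0 : Matrix ι ι F) := by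
  ext a b
  rw [Matrix.mul_apply]
  refine Finset.sum_eq_zero fun k _ => ?_
  simp only [Matrix.of_apply]
  by_cases hk : k = j <;> simp [hk]

/-- The matrix which is the identity except for the row `j`, to which `w` is added off the
diagonal. -/
def rowGL (j : ι) (w : ι → F) : GL ι F where
  val := 1 + Matrix.of fun a b => if a = j ∧ b ≠ j then w b else 0
  inv := 1 - Matrix.of fun a b => if a = j ∧ b ≠ j then w b else 0
  val_inv := by rw [add_mul, mul_sub, mul_sub, rowMatrix_mul_self]; simp
  inv_val := by rw [sub_mul, mul_add, mul_add, rowMatrix_mul_self]; simp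

theorem rowGL_apply (j : ι) (w : ι → F) (a b : ι) :
    (rowGL j w).1 a b = (if a = b then 1 else 0) + if a = j ∧ b ≠ j then w b else 0 := by
  rw [← Matrix.one_apply]; rfl

theorem mul_rowGL_apply (g : GL ι F) (j : ι) (w : ι → F) (a b : ι) :
    (g * rowGL j w).1 a b = g.1 a b + if b = j then 0 else g.1 a j * w b := by
  rw [mul_entry]
  simp only [rowGL_apply, mul_add, Finset.sum_add_distrib]
  congr 1
  · simp
  · by_cases hb : b = j
    · simp [hb]
    · simp [hb]

theorem rowGL_mul (j : ι) (v w : ι → F) : rowGL j v * rowGL j w = rowGL j (v + w) := by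
  refine ext fun a b => ?_
  rw [mul_rowGL_apply]
  simp only [rowGL_apply, Pi.add_apply]
  by_cases hb : b = j <;> by_cases ha : a = j <;> simp [hb, ha]
  ring

theorem rowGL_zero (j : ι) : rowGL j (0 : ι → F) = 1 := by
  refine ext fun a b => ?_
  simp [rowGL_apply, Matrix.one_apply]

theorem rowGL_inv (j : ι) (w : ι → F) : (rowGL j w)⁻¹ = rowGL j (-w) := by
  apply inv_eq_of_mul_eq_one_left
  rw [rowGL_mul, neg_add_cancel, rowGL_zero]

theorem conj_rowGL (t : ι → Fˣ) (j : ι) (w : ι → F) :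
    diag t * rowGL j w * (diag t)⁻¹ = rowGL j (fun k => t j * w k * (t k)⁻¹) := by
  refine ext fun a b => ?_
  rw [diag_inv, mul_diag_apply, diag_mul_apply]
  simp only [rowGL_apply, Pi.inv_apply, Units.val_inv_eq_inv_val]
  by_cases hab : a = b
  · subst hab; by_cases ha : a = j <;> simp [ha]
  · by_cases ha : a = j
    · subst ha; simp [hab, Ne.symm hab]
    · simp [ha, hab]

theorem rowGL_congr {j : ι} {v w : ι → F} (h : ∀ k, k ≠ j → v k = w k) :
    rowGL j v = rowGL j w := by
  refine ext fun a b => ?_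
  simp only [rowGL_apply]
  by_cases hb : b = j
  · simp [hb]
  · simp [hb, h b hb]

theorem det_rowGL (j : ι) (w : ι → F) : (rowGL j w).1.det = 1 := by
  have h : (rowGL j w).1 = 1 + Matrix.replicateCol Unit (Pi.single j (1 : F))
      * Matrix.replicateRow Unit (fun b => if b = j then 0 else w b) := by
    ext a b
    simp only [rowGL_apply, Matrix.add_apply, Matrix.one_apply, Matrix.mul_apply,
      Matrix.replicateCol_apply, Matrix.replicateRow_apply, Finset.univ_unique,
      Finset.sum_singleton, Pi.single_apply]
    by_cases ha : a = j <;> by_cases hb : b = j <;> simp [ha, hb]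
  rw [h, Matrix.det_one_add_replicateCol_mul_replicateRow]
  simp [dotProduct, Pi.single_apply]

/-- If `g` fixes the line of the `j`-th coordinate vector, then its commutator with a diagonal
matrix acting as a scalar off `j` differs from the identity in the row `j` only. -/
theorem inv_mul_conj_eq_rowGL {g : GL ι F} {j : ι} (hg : ∀ k, k ≠ j → g.1 k j = 0)
    {t : ι → Fˣ} (ht : ∀ k l, k ≠ j → g.1 k l ≠ 0 → t k = t l) :
    g⁻¹ * (diag t * g * (diag t)⁻¹) =
      rowGL j fun k => (g.1 j j)⁻¹ * ((t j : F) * (t k : F)⁻¹ - 1) * g.1 j k := by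
  have hjj : g.1 j j ≠ 0 := by
    obtain ⟨i, hi⟩ := exists_col_ne_zero g j
    rwa [show i = j from by_contra fun h => hi (hg i h)] at hi
  rw [inv_mul_eq_iff_eq_mul]
  refine ext fun a b => ?_
  rw [diag_inv, mul_diag_apply, diag_mul_apply, mul_rowGL_apply]
  simp only [Pi.inv_apply, Units.val_inv_eq_inv_val]
  by_cases ha : a = j
  · subst ha
    by_cases hb : b = a
    · subst hb; simp; field_simp
    · simp only [hb, if_false]; field_simp; ring
  · rw [hg a ha]
    by_cases hab : g.1 a b = 0
    · simp [hab]
    · rw [ht a b ha hab]; simp; field_simp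

end Matrix.GeneralLinearGroup

end Monomial

/-! ### Overgroups of the monomial group in the general linear group -/

section Relative

set_option linter.unusedSectionVars false

variable {ι F : Type*} [Fintype ι] [DecidableEq ι] [Field F]

/-- In a field with at least five elements, four given elements can be avoided. -/
theorem exists_notMem_of_card_lt {F : Type*} [Fintype F] (hq : 5 ≤ Fintype.card F)
    (s : Finset F) (hs : s.card ≤ 4) : ∃ a, a ∉ s := by
  by_contra! h
  have : s = Finset.univ := Finset.eq_univ_iff_forall.2 h
  rw [this, Finset.card_univ] at hs
  omega

theorem exists_unit_ne [Fintype F] [DecidableEq F] (hq : 5 ≤ Fintype.card F) (s : Finset F)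
    (hs : s.card ≤ 3) : ∃ a : Fˣ, (a : F) ∉ s := by
  obtain ⟨a, ha⟩ := exists_notMem_of_card_lt hq (insert 0 s)
    ((Finset.card_insert_le _ _).trans (by omega))
  rw [Finset.mem_insert, not_or] at ha
  exact ⟨Units.mk0 a ha.1, ha.2⟩

namespace Matrix.GeneralLinearGroup

/-- The invertible matrices that differ from the identity in the `J × J` block only. -/
def supportedOn (F : Type*) [Field F] (J : Finset ι) : Subgroup (GL ι F) where
  carrier := {g | ∀ i j, (i ∉ J ∨ j ∉ J) → g.1 i j = if i = j then 1 else 0}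
  mul_mem' := by
    intro g h hg hh i j hij
    rw [mul_entry]
    rcases hij with hi | hj
    · simp [hg i _ (Or.inl hi), hh i j (Or.inl hi)]
    · simp [hg i j (Or.inr hj), hh _ j (Or.inr hj)]
  one_mem' i j _ := one_entry i j
  inv_mem' := by
    intro g hg i j hij
    rcases hij with hi | hj
    · simpa [hg i _ (Or.inl hi)] using sum_mul_inv g i j
    · simpa [hg _ j (Or.inr hj)] using sum_inv_mul g i j

theorem supportedOn_mono {J J' : Finset ι} (h : J ⊆ J') : supportedOn F J ≤ supportedOn F J' :=
  fun _ hg i j hij => hg i j (hij.imp (fun hi hi' => hi (h hi')) (fun hi hi' => hi (h hi')))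

theorem diag_mem_supportedOn {J : Finset ι} {t : ι → Fˣ} (ht : ∀ i, i ∉ J → t i = 1) :
    diag t ∈ supportedOn F J := by
  intro i j hij
  rw [diag_apply]
  by_cases h : i = j
  · subst h; simp [ht i (by simpa using hij)]
  · simp [h]

theorem diag_mulSingle_mem {J : Finset ι} {k : ι} (hk : k ∈ J) (a : Fˣ) :
    diag (Pi.mulSingle k a) ∈ supportedOn F J :=
  diag_mem_supportedOn fun i hi => Pi.mulSingle_eq_of_ne (M := fun _ => Fˣ) (by rintro rfl; exact hi hk) a

theorem permGL_swap_mem {J : Finset ι} {k l : ι} (hk : k ∈ J) (hl : l ∈ J) :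
    permGL F (Equiv.swap k l) ∈ supportedOn F J := by
  intro i j hij
  rw [permGL_apply]
  congr 1
  rw [eq_iff_iff]
  rcases hij with hi | hj
  · have h1 : i ≠ k := fun h => hi (h ▸ hk)
    have h2 : i ≠ l := fun h => hi (h ▸ hl)
    rw [← Equiv.symm_apply_eq, Equiv.symm_swap, Equiv.swap_apply_of_ne_of_ne h1 h2]
  · rw [Equiv.swap_apply_of_ne_of_ne (by rintro rfl; exact hj hk) (by rintro rfl; exact hj hl)]

theorem conj_mulSingle_apply (k : ι) (a : Fˣ) (g : GL ι F) (i j : ι) :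
    (g⁻¹ * diag (Pi.mulSingle k a) * g).1 i j = (if i = j then 1 else 0)
      + ((a : F) - 1) * (g⁻¹.1 i k * g.1 k j) := by
  rw [conj_diag_apply, Finset.sum_eq_single k]
  · simp; ring
  · intro b _ hb; simp [Pi.mulSingle_eq_of_ne hb]
  · simp

variable {K : Subgroup (GL ι F)} {J J₀ : Finset ι}

theorem conj_mulSingle_mem (hK : supportedOn F J₀ ⊓ monomialGroup ι F ≤ K) (hJ : J ⊆ J₀) {k : ι}
    (hk : k ∈ J) (a : Fˣ) {g : GL ι F} (hg : g ∈ K ⊓ supportedOn F J) :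
    g⁻¹ * diag (Pi.mulSingle k a) * g ∈ K ⊓ supportedOn F J := by
  have h1 := diag_mulSingle_mem (F := F) hk a
  have h2 : diag (Pi.mulSingle k a) ∈ K ⊓ supportedOn F J :=
    ⟨hK ⟨supportedOn_mono hJ h1, isMonomial_diag _⟩, h1⟩
  exact mul_mem (mul_mem (inv_mem hg) h2) hg

variable [Fintype F]

/-- The commutator with a diagonal matrix that is nontrivial only at `k` erases every coordinate of
`w` except the one at `k`, which is multiplied by a nonzero scalar. What remains is a transvection.
-/
theorem apply_eq_zero_of_rowGL_mem (hq : 5 ≤ Fintype.card F)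
    (hK : supportedOn F J₀ ⊓ monomialGroup ι F ≤ K)
    (hT : ∀ j ∈ J₀, ∀ k ∈ J₀, j ≠ k → ∀ a, rowGL j (Pi.single k a) ∈ K → a = 0)
    {j k : ι} (hj : j ∈ J₀) (hk : k ∈ J₀) (hjk : j ≠ k) {w : ι → F} (hw : rowGL j w ∈ K) :
    w k = 0 := by
  classical
  obtain ⟨b, hb⟩ := exists_unit_ne hq {1} (by simp)
  rw [Finset.mem_singleton] at hb
  have hd : diag (Pi.mulSingle k b) ∈ K := hK ⟨diag_mulSingle_mem hk b, isMonomial_diag _⟩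
  have h1 := mul_mem hw (inv_mem (mul_mem (mul_mem hd hw) (inv_mem hd)))
  rw [conj_rowGL, rowGL_inv, rowGL_mul] at h1
  have h2 : rowGL j (Pi.single k ((1 - (b : F)⁻¹) * w k)) ∈ K := by
    convert h1 using 1
    refine rowGL_congr fun m hm => ?_
    by_cases hmk : m = k
    · subst hmk
      simp [Pi.mulSingle_eq_of_ne hjk]
      ring
    · simp [hmk, Pi.mulSingle_eq_of_ne hjk]
  have h3 := hT j hj k hk hjk _ h2
  refine (mul_eq_zero.1 h3).resolve_left (sub_ne_zero.2 fun h => hb ?_)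
  rw [eq_comm, inv_eq_one] at h
  exact h

/-- If no transvection is contained in `K`, an element of `K` that fixes the line of a coordinate
vector fixes the complementary coordinate hyperplane. -/
theorem row_eq_zero_of_col_eq_zero (hq : 5 ≤ Fintype.card F)
    (hK : supportedOn F J₀ ⊓ monomialGroup ι F ≤ K)
    (hT : ∀ j ∈ J₀, ∀ k ∈ J₀, j ≠ k → ∀ a, rowGL j (Pi.single k a) ∈ K → a = 0)
    {g : GL ι F} (hg : g ∈ K ⊓ supportedOn F J₀) {j : ι} (hj : j ∈ J₀)
    (hcol : ∀ k, k ≠ j → g.1 k j = 0) (k : ι) (hk : k ≠ j) : g.1 j k = 0 := by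
  classical
  by_cases hkJ : k ∈ J₀
  swap
  · rw [hg.2 j k (Or.inr hkJ), if_neg hk.symm]
  obtain ⟨b, hb⟩ := exists_unit_ne hq {1} (by simp)
  rw [Finset.mem_singleton] at hb
  have hd : diag (Pi.mulSingle j b) ∈ K := hK ⟨diag_mulSingle_mem hj b, isMonomial_diag _⟩
  -- This commutator is a row matrix whose entries are nonzero multiples of the off-diagonal entries
  -- of row `j` of `g`.
  have h1 := K.mul_mem (K.inv_mem hg.1) (K.mul_mem (K.mul_mem hd hg.1) (K.inv_mem hd))
  rw [inv_mul_conj_eq_rowGL hcol] at h1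
  · have h2 := apply_eq_zero_of_rowGL_mem hq hK hT hj hkJ hk.symm h1
    simp only [Pi.mulSingle_eq_same, Pi.mulSingle_eq_of_ne hk, Units.val_one, inv_one, mul_one] at h2
    have hjj : g.1 j j ≠ 0 := by
      obtain ⟨i, hi⟩ := exists_col_ne_zero g j
      rwa [show i = j from by_contra fun h => hi (hcol i h)] at hi
    simpa [hjj, sub_eq_zero, hb] using h2
  · intro m l hm hml
    by_cases hl : l = j
    · subst hl; exact absurd (hcol m hm) hml
    · rw [Pi.mulSingle_eq_of_ne hm, Pi.mulSingle_eq_of_ne hl]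

/-- The induction step: fixing a coordinate line forces monomiality, if this is known for
smaller supports. -/
theorem isMonomial_of_col (hq : 5 ≤ Fintype.card F)
    (hK : supportedOn F J₀ ⊓ monomialGroup ι F ≤ K)
    (hT : ∀ j ∈ J₀, ∀ k ∈ J₀, j ≠ k → ∀ a, rowGL j (Pi.single k a) ∈ K → a = 0)
    (hJ : J ⊆ J₀) (ih : ∀ j ∈ J, ∀ g ∈ K ⊓ supportedOn F (J.erase j), g.1.IsMonomial)
    {g : GL ι F} (hg : g ∈ K ⊓ supportedOn F J) {j : ι} (hj : j ∈ J) {l : ι}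
    (hcol : ∀ k, k ≠ l → g.1 k j = 0) : g.1.IsMonomial := by
  classical
  have key : ∀ {g : GL ι F}, g ∈ K ⊓ supportedOn F J → (∀ k, k ≠ j → g.1 k j = 0) →
      g.1.IsMonomial := by
    intro g hg hcol
    have hrow := row_eq_zero_of_col_eq_zero hq hK hT ⟨hg.1, supportedOn_mono hJ hg.2⟩ (hJ hj) hcol
    have hjj : g.1 j j ≠ 0 := by
      obtain ⟨i, hi⟩ := exists_col_ne_zero g j
      rwa [show i = j from by_contra fun h => hi (hcol i h)] at hi
    -- Row and column `j` now vanish off the diagonal; scaling the entry at `(j, j)` to 1 moves the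
    -- element into the smaller support.
    set t : ι → Fˣ := Pi.mulSingle j (Units.mk0 _ hjj)⁻¹ with ht
    have hd : diag t ∈ supportedOn F J := diag_mulSingle_mem hj _
    have hdK : diag t ∈ K := hK ⟨supportedOn_mono hJ hd, isMonomial_diag _⟩
    rw [← isMonomial_mul_left_iff (isMonomial_diag t)]
    refine ih j hj _ ⟨mul_mem hdK hg.1, fun a b hab => ?_⟩
    by_cases haj : a = j
    · subst haj
      rw [diag_mul_apply]
      by_cases hb : b = a
      · subst hb; simp [ht, hjj]
      · simp [hrow b hb, Ne.symm hb]
    · rw [diag_mul_apply, ht, Pi.mulSingle_eq_of_ne haj, Units.val_one, one_mul]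
      by_cases hb : b = j
      · subst hb; simp [hcol a haj, haj]
      · exact hg.2 a b (hab.imp (fun h h' => h (Finset.mem_erase.2 ⟨haj, h'⟩))
          (fun h h' => h (Finset.mem_erase.2 ⟨hb, h'⟩)))
  have hlJ : l ∈ J := by
    by_contra hl
    have h0 : ∀ k, g.1 k j = 0 := by
      intro k
      by_cases hk : k = l
      · subst hk
        rw [hg.2 k j (Or.inl hl), if_neg]
        rintro rfl; exact hl hj
      · exact hcol k hk
    obtain ⟨i, hi⟩ := exists_col_ne_zero g j
    exact hi (h0 i)
  have hp := permGL_swap_mem (F := F) hj hlJ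
  have hpK : permGL F (Equiv.swap j l) ∈ K := hK ⟨supportedOn_mono hJ hp, isMonomial_permGL _⟩
  rw [← isMonomial_mul_left_iff (isMonomial_permGL (Equiv.swap j l))]
  refine key ⟨mul_mem hpK hg.1, mul_mem hp hg.2⟩ fun k hk => ?_
  rw [permGL_mul_apply, Equiv.symm_swap]
  refine hcol _ fun h => hk ?_
  rw [Equiv.swap_apply_eq_iff, Equiv.swap_apply_right] at h
  exact h

end Matrix.GeneralLinearGroup

end Relative

/-! ### Non-monomial elements supported on at least three coordinates -/

section SupportedOn

set_option linter.unusedSectionVars false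

variable {ι F : Type*} [Fintype ι] [DecidableEq ι] [Field F] [Fintype F]

namespace Matrix.GeneralLinearGroup

variable {K : Subgroup (GL ι F)} {J J₀ : Finset ι}

/-- Suppose `h k i = 0`. The conjugate of the diagonal matrix with entry `a` at `k` is `1 + (a - 1)
u v`, with `u` column `k` of `h⁻¹` and `v` row `k` of `h`. It fixes the `i`-th coordinate vector, so
it is monomial for every `a`. Where `v j ≠ 0`, an entry of `u` off `j` would force `1 + (a - 1) u j
v j = 0` for two values of `a`. Hence `u` is supported at `j`, column `j` of `h` is supported at
`k`, and `hcol` applies. -/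
theorem apply_ne_zero_of_not_isMonomial (hq : 5 ≤ Fintype.card F)
    (hK : supportedOn F J₀ ⊓ monomialGroup ι F ≤ K) (hJ : J ⊆ J₀)
    (hcol : ∀ g ∈ K ⊓ supportedOn F J, ∀ j ∈ J, ∀ l, (∀ k, k ≠ l → g.1 k j = 0) →
      g.1.IsMonomial)
    {h : GL ι F} (hh : h ∈ K ⊓ supportedOn F J) (hm : ¬ h.1.IsMonomial) {k i : ι}
    (hk : k ∈ J) (hi : i ∈ J) : h.1 k i ≠ 0 := by
  classical
  intro hki
  apply hm
  have hy : ∀ a : Fˣ, (h⁻¹ * diag (Pi.mulSingle k a) * h).1.IsMonomial := fun a =>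
    hcol _ (conj_mulSingle_mem hK hJ hk a hh) i hi i fun l hl => by
      rw [conj_mulSingle_apply, hki, if_neg hl]; simp
  obtain ⟨j, hj⟩ := exists_row_ne_zero h k
  have hjJ : j ∈ J := by
    by_contra hjJ
    rw [hh.2 k j (Or.inr hjJ)] at hj
    have hkj : k = j := by_contra fun h => hj (if_neg h)
    exact hjJ (hkj ▸ hk)
  obtain ⟨a, ha⟩ := exists_unit_ne hq {1} (by simp)
  obtain ⟨b, hb⟩ := exists_unit_ne hq {1, (a : F)} ((Finset.card_insert_le _ _).trans (by simp))
  simp only [Finset.mem_insert, Finset.mem_singleton, not_or] at ha hb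
  have hu : ∀ r, r ≠ j → h⁻¹.1 r k = 0 := by
    intro r hr
    by_contra hne
    have hz : ∀ c : Fˣ, (c : F) ≠ 1 → 1 + ((c : F) - 1) * (h⁻¹.1 j k * h.1 k j) = 0 := by
      intro c hc
      by_contra hc0
      refine hr ((hy c).eq_of_ne_zero (i := r) (k := j) (j := j) ?_ ?_)
      · rw [conj_mulSingle_apply, if_neg hr, zero_add]
        exact mul_ne_zero (sub_ne_zero.2 hc) (mul_ne_zero hne hj)
      · rwa [conj_mulSingle_apply, if_pos rfl]
    have h1 := hz a ha
    have h2 := hz b hb.1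
    have h3 : ((b : F) - a) * (h⁻¹.1 j k * h.1 k j) = 0 := by linear_combination h2 - h1
    rw [(mul_eq_zero.1 h3).resolve_left (sub_ne_zero.2 hb.2), mul_zero, add_zero] at h1
    exact one_ne_zero h1
  have hmul : ∀ l, h.1 l j * h⁻¹.1 j k = if l = k then 1 else 0 := by
    intro l
    rw [← sum_mul_inv h l k, Finset.sum_eq_single j
      (fun r _ hr => by rw [hu r hr, mul_zero]) (by simp)]
  have hne : h⁻¹.1 j k ≠ 0 := by
    intro h0
    have := hmul k
    rw [h0, mul_zero, if_pos rfl] at this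
    exact zero_ne_one this
  refine hcol h hh j hjJ k fun l hl => ?_
  have := hmul l
  rw [if_neg hl] at this
  exact (mul_eq_zero.1 this).resolve_right hne

/-- If `h` is not monomial, all its entries on `J × J` are nonzero, and its nontrivial rank-one
conjugates `y` are again not monomial: a column of `y` has two nonzero off-diagonal entries, as `J`
has three elements. That the diagonal of `y` never vanishes forces `h⁻¹ r l * h l r = 1` throughout.
The same identity for `y` itself then gives `c ^ 2 - c + 1 = 0` for every scalar `c` other than 0
and 1, which fails in a field with five elements or more. -/
theorem isMonomial_of_three_le_card (hq : 5 ≤ Fintype.card F)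
    (hK : supportedOn F J₀ ⊓ monomialGroup ι F ≤ K) (hJ : J ⊆ J₀) (h3 : 3 ≤ J.card)
    (hcol : ∀ g ∈ K ⊓ supportedOn F J, ∀ j ∈ J, ∀ l, (∀ k, k ≠ l → g.1 k j = 0) →
      g.1.IsMonomial)
    {h : GL ι F} (hh : h ∈ K ⊓ supportedOn F J) : h.1.IsMonomial := by
  classical
  by_contra hm
  have hne : ∀ {g : GL ι F}, g ∈ K ⊓ supportedOn F J → ¬ g.1.IsMonomial → ∀ {k i : ι},
      k ∈ J → i ∈ J → g.1 k i ≠ 0 :=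
    fun hg hgm _ _ hk hi => apply_ne_zero_of_not_isMonomial hq hK hJ hcol hg hgm hk hi
  have hinv : ∀ {g : GL ι F}, ¬ g.1.IsMonomial → ¬ g⁻¹.1.IsMonomial := fun hg hg' =>
    hg (by simpa using isMonomial_inv hg')
  have hthird : ∀ r s, ∃ m ∈ J, m ≠ r ∧ m ≠ s := by
    intro r s
    by_contra! hcon
    have : J ⊆ {r, s} := fun m hm => by
      by_cases hmr : m = r
      · simp [hmr]
      · simp [hcon m hm hmr]
    have := (Finset.card_le_card this).trans (Finset.card_insert_le _ _)
    simp at this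
    omega
  have hy : ∀ {g : GL ι F}, g ∈ K ⊓ supportedOn F J → ¬ g.1.IsMonomial → ∀ {l : ι}, l ∈ J →
      ∀ {a : Fˣ}, (a : F) ≠ 1 → ¬ (g⁻¹ * diag (Pi.mulSingle l a) * g).1.IsMonomial := by
    intro g hg hgm l hl a ha hmon
    obtain ⟨s, hs, hsl, -⟩ := hthird l l
    obtain ⟨r, hr, hrl, hrs⟩ := hthird l s
    have hz : ∀ {m : ι}, m ∈ J → m ≠ l → (g⁻¹ * diag (Pi.mulSingle l a) * g).1 m l ≠ 0 := by
      intro m hm hml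
      rw [conj_mulSingle_apply, if_neg hml, zero_add]
      exact mul_ne_zero (sub_ne_zero.2 ha)
        (mul_ne_zero (hne (inv_mem hg) (hinv hgm) hm hl) (hne hg hgm hl hl))
    exact hrs (hmon.eq_of_ne_zero (hz hr hrl) (hz hs hsl))
  have hB : ∀ {g : GL ι F}, g ∈ K ⊓ supportedOn F J → ¬ g.1.IsMonomial → ∀ {r l : ι}, r ∈ J →
      l ∈ J → g⁻¹.1 r l * g.1 l r = 1 := by
    intro g hg hgm r l hr hl
    by_contra hp
    have hp0 : g⁻¹.1 r l * g.1 l r ≠ 0 :=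
      mul_ne_zero (hne (inv_mem hg) (hinv hgm) hr hl) (hne hg hgm hl hr)
    set p := g⁻¹.1 r l * g.1 l r with hpdef
    -- The scalar `a = 1 - p⁻¹` solves `1 + (a - 1) p = 0`, so it would put a zero on the diagonal
    -- of the conjugate. It is a unit because `p ≠ 1`.
    have ha0 : 1 - p⁻¹ ≠ 0 := fun h0 => hp (by rwa [sub_eq_zero, eq_comm, inv_eq_one] at h0)
    have hmem := conj_mulSingle_mem hK hJ hl (Units.mk0 _ ha0) hg
    refine hne hmem (hy hg hgm hl (a := Units.mk0 _ ha0) ?_) hr hr ?_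
    · simp [hp0]
    · rw [conj_mulSingle_apply, ← hpdef, if_pos rfl, Units.val_mk0]
      field_simp
      ring
  obtain ⟨l, hl⟩ := Finset.card_pos.1 (by omega : 0 < J.card)
  obtain ⟨s, hs, hsl, -⟩ := hthird l l
  -- At most three values are avoided besides 0: the element 1 and the two possible roots of the
  -- quadratic.
  obtain ⟨c, hc⟩ := exists_unit_ne hq
    (insert 1 (Polynomial.X ^ 2 - Polynomial.X + 1 : Polynomial F).roots.toFinset) (by
      refine (Finset.card_insert_le _ _).trans (Nat.succ_le_succ ?_)
      refine (Multiset.toFinset_card_le _).trans ((Polynomial.card_roots' _).trans ?_)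
      compute_degree)
  rw [Finset.mem_insert, not_or, Multiset.mem_toFinset, Polynomial.mem_roots'] at hc
  obtain ⟨hc1, hc2⟩ := hc
  apply hc2
  refine ⟨?_, ?_⟩
  · intro h0
    have := congrArg (Polynomial.eval 0) h0
    simp at this
  have hmem := conj_mulSingle_mem hK hJ hl c hh
  have h1 := hB hmem (hy hh hm hl hc1) hs hl
  have hin : (h⁻¹ * diag (Pi.mulSingle l c) * h)⁻¹ = h⁻¹ * diag (Pi.mulSingle l c⁻¹) * h := by
    rw [_root_.mul_inv_rev, _root_.mul_inv_rev, inv_inv, diag_inv, ← Pi.mulSingle_inv, mul_assoc]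
  rw [hin, conj_mulSingle_apply, conj_mulSingle_apply, if_neg hsl, if_neg hsl.symm, zero_add,
    zero_add] at h1
  have h2 := hB hh hm hs hl
  have h4 := hB hh hm hl hl
  have h5 : ((c⁻¹ : Fˣ) : F) * c = 1 := by simp
  simp only [Polynomial.IsRoot.def, Polynomial.eval_add, Polynomial.eval_sub,
    Polynomial.eval_pow, Polynomial.eval_X, Polynomial.eval_one]
  have h6 : (((c⁻¹ : Fˣ) : F) - 1) * ((c : F) - 1) = 1 := by
    linear_combination h1 - (((c⁻¹ : Fˣ) : F) - 1) * ((c : F) - 1) * h2 * h⁻¹.1 l l * h.1 l l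
      - (((c⁻¹ : Fˣ) : F) - 1) * ((c : F) - 1) * h4
  linear_combination (-(c : F)) * h6 + ((c : F) - 1) * h5

end Matrix.GeneralLinearGroup

end SupportedOn

/-! ### Supports of size two, and the induction on the support -/

section RelativeMonomial

set_option linter.unusedSectionVars false

variable {ι F : Type*} [Fintype ι] [DecidableEq ι] [Field F] [Fintype F]

namespace Matrix.GeneralLinearGroup

variable {K : Subgroup (GL ι F)} {J J₀ : Finset ι}

/-- Here a third coordinate `r` of `J₀` is borrowed. Let `h` have first column `(a, c)`, and let
`h3`, `h2` be its copies on `{p, r}` and `{q, r}`. On the coordinates `p, q, r` the products `h *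
h3` and `h2 * h` have `p`-th columns `(a², ac, c)` and `(a, ac, c²)`, which a diagonal matrix
matches. The resulting quotient `g` fixes the `p`-th coordinate vector, hence by absence of
transvections also the complementary hyperplane. Comparing entries at `(p, p)` gives `h⁻¹ p p * h p
p = 1`, so a product of two nonzero entries vanishes. -/
theorem isMonomial_of_pair (hq : 5 ≤ Fintype.card F)
    (hK : supportedOn F J₀ ⊓ monomialGroup ι F ≤ K)
    (hT : ∀ j ∈ J₀, ∀ k ∈ J₀, j ≠ k → ∀ a, rowGL j (Pi.single k a) ∈ K → a = 0)
    {p q r : ι} (hp : p ∈ J₀) (hq₀ : q ∈ J₀) (hr : r ∈ J₀) (hpq : p ≠ q) (hpr : p ≠ r)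
    (hqr : q ≠ r)
    (hcol : ∀ g ∈ K ⊓ supportedOn F {p, q}, ∀ j ∈ ({p, q} : Finset ι), ∀ l,
      (∀ k, k ≠ l → g.1 k j = 0) → g.1.IsMonomial)
    {h : GL ι F} (hh : h ∈ K ⊓ supportedOn F {p, q}) : h.1.IsMonomial := by
  by_contra hm
  have hJ : ({p, q} : Finset ι) ⊆ J₀ := by
    intro x hx; simp only [Finset.mem_insert, Finset.mem_singleton] at hx
    rcases hx with rfl | rfl <;> assumption
  have hne : ∀ {g : GL ι F}, g ∈ K ⊓ supportedOn F {p, q} → ¬ g.1.IsMonomial → ∀ {k i : ι},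
      k ∈ ({p, q} : Finset ι) → i ∈ ({p, q} : Finset ι) → g.1 k i ≠ 0 :=
    fun hg hgm _ _ hk hi => apply_ne_zero_of_not_isMonomial hq hK hJ hcol hg hgm hk hi
  have hm' : ¬ h⁻¹.1.IsMonomial := fun h' => hm (by simpa using isMonomial_inv h')
  have off : ∀ {g : GL ι F}, g ∈ supportedOn F {p, q} → ∀ i j, ((i ≠ p ∧ i ≠ q) ∨ (j ≠ p ∧ j ≠ q)) →
      g.1 i j = if i = j then 1 else 0 := fun hg i j hij => hg i j (by simpa using hij)
  have ho := off hh.2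
  have ho' := off (inv_mem hh.2)
  have ha := hne hh hm (k := p) (i := p) (by simp) (by simp)
  have hc := hne hh hm (k := q) (i := p) (by simp) (by simp)
  have hb := hne hh hm (k := p) (i := q) (by simp) (by simp)
  have ha' := hne (inv_mem hh) hm' (k := p) (i := p) (by simp) (by simp)
  have hc' := hne (inv_mem hh) hm' (k := q) (i := p) (by simp) (by simp)
  set P := permGL F (Equiv.swap q r) with hP
  set Q := permGL F (Equiv.swap p q) with hQ
  have hPs : P ∈ supportedOn F J₀ := permGL_swap_mem hq₀ hr
  have hQs : Q ∈ supportedOn F J₀ := permGL_swap_mem hp hq₀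
  have hPK : P ∈ K ⊓ supportedOn F J₀ := ⟨hK ⟨hPs, isMonomial_permGL _⟩, hPs⟩
  have hQK : Q ∈ K ⊓ supportedOn F J₀ := ⟨hK ⟨hQs, isMonomial_permGL _⟩, hQs⟩
  have hhK : h ∈ K ⊓ supportedOn F J₀ := ⟨hh.1, supportedOn_mono hJ hh.2⟩
  set h3 := P * h * P⁻¹ with h3def
  set h2 := Q * h3 * Q⁻¹ with h2def
  have hh3 : h3 ∈ K ⊓ supportedOn F J₀ := mul_mem (mul_mem hPK hhK) (inv_mem hPK)
  have hh2 : h2 ∈ K ⊓ supportedOn F J₀ := mul_mem (mul_mem hQK hh3) (inv_mem hQK)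
  have e3 : ∀ i j, h3.1 i j = h.1 (Equiv.swap q r i) (Equiv.swap q r j) := fun i j => by
    rw [h3def, hP, conj_permGL_apply, Equiv.symm_swap]
  have e2 : ∀ i j, h2.1 i j = h.1 (Equiv.swap q r (Equiv.swap p q i))
      (Equiv.swap q r (Equiv.swap p q j)) := fun i j => by
    rw [h2def, hQ, conj_permGL_apply, Equiv.symm_swap, e3]
  have h3i : h3⁻¹ = P * h⁻¹ * P⁻¹ := by rw [h3def]; group
  have h2i : h2⁻¹ = Q * h3⁻¹ * Q⁻¹ := by rw [h2def]; group
  have e3' : ∀ i j, h3⁻¹.1 i j = h⁻¹.1 (Equiv.swap q r i) (Equiv.swap q r j) := fun i j => by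
    rw [h3i, hP, conj_permGL_apply, Equiv.symm_swap]
  have e2' : ∀ i j, h2⁻¹.1 i j = h⁻¹.1 (Equiv.swap q r (Equiv.swap p q i))
      (Equiv.swap q r (Equiv.swap p q j)) := fun i j => by
    rw [h2i, hQ, conj_permGL_apply, Equiv.symm_swap, e3']
  have sp : Equiv.swap q r p = p := Equiv.swap_apply_of_ne_of_ne hpq hpr
  have tr : Equiv.swap p q r = r := Equiv.swap_apply_of_ne_of_ne hpr.symm hqr.symm
  -- The entries `a` at `p` and `c⁻¹` at `r` turn `(a, ac, c²)` into `(a², ac, c)`.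
  set t : ι → Fˣ := Pi.mulSingle p (Units.mk0 _ ha) * Pi.mulSingle r (Units.mk0 _ hc)⁻¹ with htdef
  have htp : (t p : F) = h.1 p p := by simp [htdef, Pi.mulSingle_eq_of_ne hpr]
  have htr : (t r : F) = (h.1 q p)⁻¹ := by simp [htdef, Pi.mulSingle_eq_of_ne hpr.symm]
  have hto : ∀ i, i ≠ p → i ≠ r → (t i : F) = 1 := fun i h1 h2 => by
    simp [htdef, Pi.mulSingle_eq_of_ne h1, Pi.mulSingle_eq_of_ne h2]
  have hts : diag t ∈ supportedOn F J₀ := diag_mem_supportedOn fun i hi =>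
    Units.ext (hto i (by rintro rfl; exact hi hp) (by rintro rfl; exact hi hr))
  have htK : diag t ∈ K ⊓ supportedOn F J₀ := ⟨hK ⟨hts, isMonomial_diag _⟩, hts⟩
  have hBcol : ∀ i, (h2 * h).1 i p = h2.1 i p * h.1 p p + h2.1 i q * h.1 q p := fun i => by
    rw [mul_entry, Finset.sum_eq_add_of_mem p q (Finset.mem_univ _) (Finset.mem_univ _) hpq]
    intro c _ hcc
    rw [ho c p (Or.inl hcc), if_neg hcc.1, mul_zero]
  have hAcol : ∀ i, (h * h3).1 i p = h.1 i p * h.1 p p + h.1 i r * h.1 q p := fun i => by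
    rw [mul_entry, Finset.sum_eq_add_of_mem p r (Finset.mem_univ _) (Finset.mem_univ _) hpr,
      e3, e3, sp, Equiv.swap_apply_right]
    intro c _ hcc
    rw [e3, sp, ho _ p (Or.inl ⟨fun h => hcc.1 ?_, fun h => hcc.2 ?_⟩), if_neg, mul_zero]
    · intro h; exact hcc.1 (by rwa [Equiv.swap_apply_eq_iff, sp] at h)
    · rwa [Equiv.swap_apply_eq_iff, sp] at h
    · rwa [Equiv.swap_apply_eq_iff, Equiv.swap_apply_left] at h
  have hcols : ∀ i, (diag t * (h2 * h)).1 i p = (h * h3).1 i p := by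
    intro i
    rw [diag_mul_apply, hBcol, hAcol, e2, e2, Equiv.swap_apply_left, Equiv.swap_apply_left,
      Equiv.swap_apply_right, sp]
    by_cases hip : i = p
    · subst hip
      rw [htp, Equiv.swap_apply_left, Equiv.swap_apply_left,
        ho r r (Or.inl ⟨hpr.symm, hqr.symm⟩), ho r i (Or.inl ⟨hpr.symm, hqr.symm⟩),
        ho i r (Or.inr ⟨hpr.symm, hqr.symm⟩), if_pos rfl, if_neg hpr.symm, if_neg hpr]
      ring
    by_cases hiq : i = q
    · subst hiq
      rw [hto i hip hqr, Equiv.swap_apply_right, sp,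
        ho p r (Or.inr ⟨hpr.symm, hqr.symm⟩), ho i r (Or.inr ⟨hpr.symm, hqr.symm⟩),
        if_neg hpr, if_neg hqr]
      ring
    by_cases hir : i = r
    · subst hir
      rw [htr, tr, Equiv.swap_apply_right, ho q i (Or.inr ⟨hip, hiq⟩),
        ho i p (Or.inl ⟨hip, hiq⟩), ho i i (Or.inr ⟨hip, hiq⟩), if_neg hqr, if_neg hip, if_pos rfl]
      field_simp
      ring
    · rw [Equiv.swap_apply_of_ne_of_ne hip hiq, Equiv.swap_apply_of_ne_of_ne hiq hir,
        ho i r (Or.inl ⟨hip, hiq⟩), ho i p (Or.inl ⟨hip, hiq⟩), if_neg hir, if_neg hip]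
      ring
  set g := (h * h3)⁻¹ * (diag t * (h2 * h)) with hg
  have hgK : g ∈ K ⊓ supportedOn F J₀ :=
    mul_mem (inv_mem (mul_mem hhK hh3)) (mul_mem htK (mul_mem hh2 hhK))
  have hgcol : ∀ i, g.1 i p = if i = p then 1 else 0 := fun i => by
    rw [hg, mul_entry, ← sum_inv_mul (h * h3) i p]
    exact Finset.sum_congr rfl fun k _ => by rw [hcols]
  have hgrow := row_eq_zero_of_col_eq_zero hq hK hT hgK hp fun k hk => by rw [hgcol, if_neg hk]
  have heq : (h * h3)⁻¹ * diag t = g * (h2 * h)⁻¹ := by rw [hg]; group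
  have h1 : ((h * h3)⁻¹ * diag t).1 p p = (g * (h2 * h)⁻¹).1 p p := by rw [heq]
  rw [mul_diag_apply, htp, mul_entry g, Finset.sum_eq_single p
    (fun k _ hk => by rw [hgrow k hk, zero_mul]) (by simp), hgcol, if_pos rfl, one_mul,
    _root_.mul_inv_rev h h3, _root_.mul_inv_rev h2 h, mul_entry, mul_entry] at h1
  rw [Finset.sum_eq_single p, Finset.sum_eq_single p, e3', e2', sp, Equiv.swap_apply_left,
    Equiv.swap_apply_left, ho' r r (Or.inl ⟨hpr.symm, hqr.symm⟩), if_pos rfl] at h1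
  · have h2 := sum_mul_inv h p p
    rw [Finset.sum_eq_add_of_mem p q (Finset.mem_univ _) (Finset.mem_univ _) hpq, if_pos rfl] at h2
    · have h4 : h⁻¹.1 p p * h.1 p p = 1 := mul_left_cancel₀ ha' (by linear_combination h1)
      exact mul_ne_zero hb hc' (by linear_combination h2 - h4)
    · intro c _ hcc
      rw [ho' c p (Or.inl hcc), if_neg hcc.1, mul_zero]
  · intro k _ hk
    rw [e2', Equiv.swap_apply_left, Equiv.swap_apply_left, ho' _ r (Or.inr ⟨hpr.symm, hqr.symm⟩),
      if_neg, mul_zero]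
    intro h
    rw [Equiv.swap_apply_eq_iff, Equiv.swap_apply_right, Equiv.swap_apply_eq_iff,
      Equiv.swap_apply_right] at h
    exact hk h
  · simp
  · intro k _ hk
    by_cases hkq : k = q
    · subst hkq
      rw [e3', sp, Equiv.swap_apply_left, ho' p r (Or.inr ⟨hpr.symm, hqr.symm⟩), if_neg hpr,
        zero_mul]
    · rw [ho' k p (Or.inl ⟨hk, hkq⟩), if_neg hk, mul_zero]
  · simp

/-- A subgroup of the general linear group which contains the monomial matrices supported on a
set `J₀` of at least three coordinates, but no transvection supported on `J₀`, contains no other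
matrix supported on `J₀`. -/
theorem isMonomial_of_supportedOn (hq : 5 ≤ Fintype.card F)
    (hK : supportedOn F J₀ ⊓ monomialGroup ι F ≤ K)
    (hT : ∀ j ∈ J₀, ∀ k ∈ J₀, j ≠ k → ∀ a, rowGL j (Pi.single k a) ∈ K → a = 0)
    (h₀ : 3 ≤ J₀.card) {h : GL ι F} (hh : h ∈ K ⊓ supportedOn F J₀) : h.1.IsMonomial := by
  -- The support `J` shrinks while `J₀` stays fixed, so that a third coordinate is still available
  -- when `J` has two elements.
  suffices ∀ (m : ℕ) (J : Finset ι), J.card = m → J ⊆ J₀ → ∀ h ∈ K ⊓ supportedOn F J,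
      h.1.IsMonomial from this _ J₀ rfl subset_rfl h hh
  intro m
  induction m with
  | zero =>
    intro J hJ0 _ h hh j
    rw [Finset.card_eq_zero] at hJ0
    refine ⟨j, fun k hk => ?_⟩
    rw [hh.2 k j (Or.inl (by simp [hJ0])), if_neg hk]
  | succ m ih =>
    intro J hJm hJ h hh
    have hcol : ∀ g ∈ K ⊓ supportedOn F J, ∀ j ∈ J, ∀ l, (∀ k, k ≠ l → g.1 k j = 0) →
        g.1.IsMonomial := fun g hg j hj l hl =>
      isMonomial_of_col hq hK hT hJ (fun i hi g hg => ih _ (by rw [Finset.card_erase_of_mem hi, hJm]; rfl)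
        ((Finset.erase_subset _ _).trans hJ) g hg) hg hj hl
    by_cases h3 : 3 ≤ J.card
    · exact isMonomial_of_three_le_card hq hK hJ h3 hcol hh
    by_cases h2 : J.card = 2
    · obtain ⟨p, q, hpq, rfl⟩ := Finset.card_eq_two.1 h2
      obtain ⟨r, hr, hrn⟩ : ∃ r ∈ J₀, r ∉ ({p, q} : Finset ι) := by
        by_contra! hcon
        have := Finset.card_le_card hcon
        omega
      simp only [Finset.mem_insert, Finset.mem_singleton, not_or] at hrn
      exact isMonomial_of_pair hq hK hT (hJ (by simp)) (hJ (by simp)) hr hpq (Ne.symm hrn.1)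
        (Ne.symm hrn.2) hcol hh
    · obtain ⟨p, rfl⟩ := Finset.card_eq_one.1 (by omega : J.card = 1)
      intro j
      refine ⟨j, fun k hk => ?_⟩
      rw [hh.2 k j, if_neg hk]
      by_contra! hcon
      simp only [Finset.mem_singleton] at hcon
      exact hk (hcon.1.trans hcon.2.symm)

end Matrix.GeneralLinearGroup

end RelativeMonomial

/-! ### Overgroups containing matrices that fix a coordinate line -/

section Parabolic

set_option linter.unusedSectionVars false

variable {ι F : Type*} [Fintype ι] [DecidableEq ι] [Field F]

namespace Matrix.GeneralLinearGroup

/-- The diagonal entries `b` at `k` and `b⁻¹` at `l`. -/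
def pairTorus (k l : ι) (b : Fˣ) : ι → Fˣ := Pi.mulSingle k b * Pi.mulSingle l b⁻¹

theorem pairTorus_left {k l : ι} (hkl : k ≠ l) (b : Fˣ) : pairTorus k l b k = b := by
  simp [pairTorus, Pi.mulSingle_eq_of_ne hkl]

theorem pairTorus_right {k l : ι} (hkl : k ≠ l) (b : Fˣ) : pairTorus k l b l = b⁻¹ := by
  simp [pairTorus, Pi.mulSingle_eq_of_ne hkl.symm]

theorem pairTorus_of_ne {k l m : ι} (hk : m ≠ k) (hl : m ≠ l) (b : Fˣ) :
    pairTorus k l b m = 1 := by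
  simp [pairTorus, Pi.mulSingle_eq_of_ne hk, Pi.mulSingle_eq_of_ne hl]

theorem prod_pairTorus (k l : ι) (b : Fˣ) : ∏ i, pairTorus k l b i = 1 := by
  simp [pairTorus, Finset.prod_mul_distrib]

theorem det_diag_eq_one {t : ι → Fˣ} (ht : ∏ i, t i = 1) : (diag t).1.det = 1 := by
  rw [det_diag, ← Units.coe_prod, ht, Units.val_one]

theorem exists_ne_of_card_lt (s : Finset ι) (hs : s.card < Fintype.card ι) : ∃ m, m ∉ s := by
  by_contra! h
  rw [Finset.eq_univ_iff_forall.2 h, Finset.card_univ] at hs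
  exact lt_irrefl _ hs

theorem col_diag_ne_zero {g : GL ι F} {j l : ι} (hg : ∀ k, k ≠ l → g.1 k j = 0) : g.1 l j ≠ 0 := by
  obtain ⟨i, hi⟩ := exists_col_ne_zero g j
  rwa [show i = l from by_contra fun h => hi (hg i h)] at hi

variable [Fintype F] {H : Subgroup (GL ι F)}

theorem diag_mem (hN : ∀ g : GL ι F, g.1.det = 1 → g.1.IsMonomial → g ∈ H) {t : ι → Fˣ}
    (ht : ∏ i, t i = 1) : diag t ∈ H := hN _ (det_diag_eq_one ht) (isMonomial_diag t)

/-- Determinant 1 forces the torus element to move a second coordinate besides `k`. One commutator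
therefore retains the coordinates `k` and `l`, and a second one, with `m` in place of `l`, retains
`k` alone. -/
theorem eq_zero_of_rowGL_mem (hq : 5 ≤ Fintype.card F) (hι : 5 ≤ Fintype.card ι)
    (hN : ∀ g : GL ι F, g.1.det = 1 → g.1.IsMonomial → g ∈ H)
    (hT : ∀ j k, j ≠ k → ∀ a, rowGL j (Pi.single k a) ∈ H → a = 0)
    {j k : ι} (hjk : j ≠ k) {w : ι → F} (hw : rowGL j w ∈ H) : w k = 0 := by
  classical
  obtain ⟨b, hb⟩ := exists_unit_ne hq {1} (by simp)
  rw [Finset.mem_singleton] at hb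
  obtain ⟨l, hl⟩ := exists_ne_of_card_lt {j, k} (Finset.card_le_two.trans_lt (by omega))
  obtain ⟨m, hm⟩ := exists_ne_of_card_lt {j, k, l} (Finset.card_le_three.trans_lt (by omega))
  simp only [Finset.mem_insert, Finset.mem_singleton, not_or] at hl hm
  have step : ∀ (m : ι), m ≠ j → ∀ w, rowGL j w ∈ H →
      rowGL j (fun i => w i - w i * ((pairTorus k m b i)⁻¹ : Fˣ)) ∈ H := by
    intro m hmj w hw
    have hd := diag_mem hN (prod_pairTorus k m b)
    have h1 := mul_mem hw (inv_mem (mul_mem (mul_mem hd hw) (inv_mem hd)))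
    rw [conj_rowGL, rowGL_inv, rowGL_mul] at h1
    convert h1 using 1
    refine rowGL_congr fun i _ => ?_
    simp [pairTorus_of_ne hjk hmj.symm]
    ring
  have h2 := step m hm.1 _ (step l hl.1 w hw)
  have h3 : rowGL j (Pi.single k ((1 - (b : F)⁻¹) * ((1 - (b : F)⁻¹) * w k))) ∈ H := by
    convert h2 using 1
    refine rowGL_congr fun i hi => ?_
    by_cases hik : i = k
    · subst hik
      simp [pairTorus_left (Ne.symm hm.2.1), pairTorus_left (Ne.symm hl.2)]
      ring
    by_cases him : i = m
    · subst him
      simp [hik, pairTorus_of_ne hik hm.2.2]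
    · simp [hik, pairTorus_of_ne hik him]
  have hb' : 1 - (b : F)⁻¹ ≠ 0 := sub_ne_zero.2 fun h => hb (by rwa [eq_comm, inv_eq_one] at h)
  simpa [hb'] using hT j k hjk _ h3

/-- The action on the quotient by the `j`-th coordinate line of the elements of `H` that fix this
line, extended by the identity to a group of matrices of the same size. -/
def lineQuotient (H : Subgroup (GL ι F)) (j : ι) : Subgroup (GL ι F) where
  carrier := {k | k ∈ supportedOn F {j}ᶜ ∧ ∃ h ∈ H, (∀ i, i ≠ j → h.1 i j = 0) ∧
    ∀ i l, i ≠ j → h.1 i l = k.1 i l}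
  mul_mem' := by
    rintro k k' ⟨hk, h, hh, hc, he⟩ ⟨hk', h', hh', hc', he'⟩
    have key : ∀ i l, i ≠ j → (h * h').1 i l = (k * k').1 i l := by
      intro i l hi
      rw [mul_entry, mul_entry]
      refine Finset.sum_congr rfl fun m _ => ?_
      by_cases hm : m = j
      · subst hm; rw [← he i m hi, hc i hi, zero_mul, zero_mul]
      · rw [he i m hi, he' m l hm]
    refine ⟨mul_mem hk hk', h * h', mul_mem hh hh', fun i hi => ?_, key⟩
    rw [key i j hi, (mul_mem hk hk' : k * k' ∈ supportedOn F {j}ᶜ) i j (Or.inr (by simp)), if_neg hi]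
  one_mem' := ⟨one_mem _, 1, one_mem _, fun i hi => by rw [one_entry, if_neg hi],
    fun i l _ => rfl⟩
  inv_mem' := by
    rintro k ⟨hk, h, hh, hc, he⟩
    have hc' : ∀ i, i ≠ j → h⁻¹.1 i j = 0 := by
      intro i hi
      have := sum_inv_mul h i j
      rw [if_neg hi, Finset.sum_eq_single j (fun m _ hm => by rw [hc m hm, mul_zero]) (by simp)]
        at this
      exact (mul_eq_zero.1 this).resolve_right (col_diag_ne_zero hc)
    have hone : ∀ i l, i ≠ j → (h⁻¹ * k).1 i l = if i = l then 1 else 0 := by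
      intro i l hi
      rw [← sum_inv_mul h i l, mul_entry]
      refine Finset.sum_congr rfl fun m _ => ?_
      by_cases hm : m = j
      · subst hm; rw [hc' i hi, zero_mul, zero_mul]
      · rw [he m l hm]
    refine ⟨inv_mem hk, h⁻¹, inv_mem hh, hc', fun i l hi => ?_⟩
    have : h⁻¹ = h⁻¹ * k * k⁻¹ := by group
    rw [this, mul_entry, Finset.sum_eq_single i
      (fun m _ hm => by rw [hone i m hi, if_neg (Ne.symm hm), zero_mul]) (by simp),
      hone i i hi, if_pos rfl, one_mul]

/-- Let `h` in `H` induce the transvection on the quotient. Torus elements that are nontrivial at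
`j` but trivial at `i` and `l` show that row `j` of `h` vanishes off the diagonal. So `h` is a
transvection times a diagonal matrix, and a commutator with a torus element nontrivial at `i`
removes the diagonal factor. -/
theorem rowGL_notMem_lineQuotient (hq : 5 ≤ Fintype.card F) (hι : 5 ≤ Fintype.card ι)
    (hN : ∀ g : GL ι F, g.1.det = 1 → g.1.IsMonomial → g ∈ H)
    (hT : ∀ j k, j ≠ k → ∀ a, rowGL j (Pi.single k a) ∈ H → a = 0)
    {j i l : ι} (hi : i ≠ j) (hl : l ≠ j) (hil : i ≠ l) {a : F}
    (ha : rowGL i (Pi.single l a) ∈ lineQuotient H j) : a = 0 := by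
  classical
  obtain ⟨-, h, hh, hc, he⟩ := ha
  obtain ⟨b, hb⟩ := exists_unit_ne hq {1} (by simp)
  rw [Finset.mem_singleton] at hb
  have hjj := col_diag_ne_zero hc
  have hrow : ∀ k, k ≠ j → h.1 j k = 0 := by
    intro k hk
    obtain ⟨m, hm⟩ := exists_ne_of_card_lt {j, k, i, l} (Finset.card_le_four.trans_lt (by omega))
    simp only [Finset.mem_insert, Finset.mem_singleton, not_or] at hm
    have hd := diag_mem hN (prod_pairTorus j m b)
    have h1 := mul_mem (inv_mem hh) (mul_mem (mul_mem hd hh) (inv_mem hd))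
    rw [inv_mul_conj_eq_rowGL hc] at h1
    · have h2 := eq_zero_of_rowGL_mem hq hι hN hT hk.symm h1
      rw [pairTorus_left (Ne.symm hm.1), pairTorus_of_ne hk (Ne.symm hm.2.1), Units.val_one, inv_one,
        mul_one] at h2
      exact (mul_eq_zero.1 h2).resolve_left (mul_ne_zero (inv_ne_zero hjj) (sub_ne_zero.2 hb))
    · intro r s hr hrs
      rw [he r s hr, rowGL_apply] at hrs
      by_cases hrs' : r = s
      · rw [hrs']
      · rw [if_neg hrs', zero_add, ite_ne_right_iff] at hrs
        obtain ⟨⟨rfl, -⟩, hs⟩ := hrs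
        have hsl : s = l := by by_contra hsl; simp [hsl] at hs
        subst hsl
        rw [pairTorus_of_ne hi (Ne.symm hm.2.2.1), pairTorus_of_ne hl (Ne.symm hm.2.2.2)]
  have hfac : h = diag (Pi.mulSingle j (Units.mk0 _ hjj)) * rowGL i (Pi.single l a) := by
    refine ext fun r s => ?_
    rw [diag_mul_apply]
    by_cases hr : r = j
    · subst hr
      by_cases hs : s = r
      · subst hs; simp [rowGL_apply, Ne.symm hi]
      · simp [rowGL_apply, Ne.symm hi, Ne.symm hs, hrow s hs]
    · rw [he r s hr]; simp [Pi.mulSingle_eq_of_ne hr]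
  obtain ⟨m, hm⟩ := exists_ne_of_card_lt {j, i, l} (Finset.card_le_three.trans_lt (by omega))
  simp only [Finset.mem_insert, Finset.mem_singleton, not_or] at hm
  have hd := diag_mem hN (prod_pairTorus i m b)
  have h1 := mul_mem (inv_mem hh) (mul_mem (mul_mem hd hh) (inv_mem hd))
  have h2 : h⁻¹ * (diag (pairTorus i m b) * h * (diag (pairTorus i m b))⁻¹) =
      rowGL i (Pi.single l (((b : F) - 1) * a)) := by
    have hcomm : diag (pairTorus i m b) * diag (Pi.mulSingle j (Units.mk0 _ hjj))
        = diag (Pi.mulSingle j (Units.mk0 _ hjj)) * diag (pairTorus i m b) := by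
      refine ext fun r s => ?_
      rw [mul_diag_apply, diag_apply, diag_mul_apply, diag_apply]
      by_cases hrs : r = s
      · subst hrs; simp [mul_comm]
      · simp [hrs]
    have e : h⁻¹ * (diag (pairTorus i m b) * h * (diag (pairTorus i m b))⁻¹) =
        (rowGL i (Pi.single l a))⁻¹ * (diag (pairTorus i m b) * rowGL i (Pi.single l a)
          * (diag (pairTorus i m b))⁻¹) := by
      rw [hfac, ← mul_assoc (diag (pairTorus i m b)), hcomm]; group
    rw [e, conj_rowGL, rowGL_inv, rowGL_mul]
    refine rowGL_congr fun s _ => ?_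
    by_cases hs : s = l
    · subst hs
      simp [pairTorus_left (Ne.symm hm.2.1), pairTorus_of_ne hil.symm (Ne.symm hm.2.2)]
      ring
    · simp [hs]
  rw [h2] at h1
  have h3 := hT i l hil _ h1
  exact (mul_eq_zero.1 h3).resolve_left (sub_ne_zero.2 hb)

/-- If `H` contains the monomial matrices of determinant `1` but no transvection, then its
elements that fix a coordinate line are monomial. -/
theorem isMonomial_of_col_diag (hq : 5 ≤ Fintype.card F) (hι : 5 ≤ Fintype.card ι)
    (hN : ∀ g : GL ι F, g.1.det = 1 → g.1.IsMonomial → g ∈ H)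
    (hdet : ∀ g ∈ H, g.1.det = 1)
    (hT : ∀ j k, j ≠ k → ∀ a, rowGL j (Pi.single k a) ∈ H → a = 0)
    {h : GL ι F} (hh : h ∈ H) {j : ι} (hc : ∀ k, k ≠ j → h.1 k j = 0) : h.1.IsMonomial := by
  classical
  have hjj := col_diag_ne_zero hc
  -- Right multiplication by `rowGL j v` clears row `j` off the diagonal, and `d` then scales the
  -- entry at `(j, j)` to 1; the other rows are unchanged.
  set v : ι → F := fun k => -(h.1 j j)⁻¹ * h.1 j k with hv
  set d : GL ι F := diag (Pi.mulSingle j (Units.mk0 _ hjj)⁻¹) with hd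
  have hk1 : ∀ i l, i ≠ j → (d * (h * rowGL j v)).1 i l = h.1 i l := by
    intro i l hi
    rw [hd, diag_mul_apply, mul_rowGL_apply, hc i hi]
    simp [Pi.mulSingle_eq_of_ne hi]
  have hk2 : ∀ l, (d * (h * rowGL j v)).1 j l = if j = l then 1 else 0 := by
    intro l
    rw [hd, diag_mul_apply, mul_rowGL_apply]
    by_cases hl : l = j
    · subst hl; simp [hjj]
    · simp [hl, Ne.symm hl, hv]; right; field_simp; ring
  have hks : d * (h * rowGL j v) ∈ supportedOn F {j}ᶜ := by
    intro i l hil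
    by_cases hi : i = j
    · subst hi; exact hk2 l
    · have hl : l = j := by simpa [hi] using hil
      subst hl
      rw [hk1 i l hi, hc i hi, if_neg hi]
  have hkmon : (d * (h * rowGL j v)).1.IsMonomial := by
    refine isMonomial_of_supportedOn (K := lineQuotient H j) (J₀ := {j}ᶜ) hq ?_ ?_ ?_
      ⟨⟨hks, h, hh, hc, fun i l hi => (hk1 i l hi).symm⟩, hks⟩
    · rintro g ⟨hgs, hgm⟩
      have hdg : g.1.det ≠ 0 := det_ne_zero g
      -- The free entry at `j` absorbs the determinant, which is why the quotient group contains all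
      -- monomial matrices and not only those of determinant 1.
      refine ⟨hgs, diag (Pi.mulSingle j (Units.mk0 _ hdg)⁻¹) * g, hN _ ?_ ?_, fun i hi => ?_,
        fun i l hi => ?_⟩
      · rw [coe_mul, Matrix.det_mul, det_diag, ← Units.coe_prod]
        simp [hdg]
      · exact (isMonomial_diag _).mul hgm
      · rw [diag_mul_apply, hgs i j (Or.inr (by simp)), if_neg hi, mul_zero]
      · rw [diag_mul_apply, Pi.mulSingle_eq_of_ne hi, Units.val_one, one_mul]
    · intro i hi l hl hil a ha
      rw [Finset.mem_compl, Finset.mem_singleton] at hi hl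
      exact rowGL_notMem_lineQuotient hq hι hN hT hi hl hil ha
    · rw [Finset.card_compl, Finset.card_singleton]; omega
  rw [isMonomial_mul_left_iff (isMonomial_diag _)] at hkmon
  -- This product is monomial of determinant 1, so it lies in `H`; hence so does `rowGL j v`, which
  -- must then be trivial.
  have hmem : h * rowGL j v ∈ H := hN _ (by
    rw [coe_mul, Matrix.det_mul, det_rowGL, hdet h hh, one_mul]) hkmon
  have hrow : rowGL j v ∈ H := (Subgroup.mul_mem_cancel_left H hh).1 hmem
  have hv0 : rowGL j v = 1 := by
    rw [← rowGL_zero j]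
    exact rowGL_congr fun k hk => eq_zero_of_rowGL_mem hq hι hN hT hk.symm hrow
  rwa [hv0, mul_one] at hkmon

end Matrix.GeneralLinearGroup

end Parabolic

/-! ### Overgroups of the monomial group without transvections -/

section MonomialMaximal

set_option linter.unusedSectionVars false

variable {ι F : Type*} [Fintype ι] [DecidableEq ι] [Field F]

theorem quadratic_coeff_eq_zero {α β γ a b c : F} (hab : a ≠ b) (hac : a ≠ c) (hbc : b ≠ c)
    (ha : α * a ^ 2 + β * a + γ = 0) (hb : α * b ^ 2 + β * b + γ = 0)
    (hc : α * c ^ 2 + β * c + γ = 0) : α = 0 ∧ β = 0 ∧ γ = 0 := by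
  have h1 : α * (a + b) + β = 0 :=
    (mul_eq_zero.1 (by linear_combination ha - hb : (a - b) * (α * (a + b) + β) = 0)).resolve_left
      (sub_ne_zero.2 hab)
  have h2 : α * (a + c) + β = 0 :=
    (mul_eq_zero.1 (by linear_combination ha - hc : (a - c) * (α * (a + c) + β) = 0)).resolve_left
      (sub_ne_zero.2 hac)
  have h3 : α = 0 :=
    (mul_eq_zero.1 (by linear_combination h1 - h2 : (b - c) * α = 0)).resolve_left
      (sub_ne_zero.2 hbc)
  subst h3
  simp only [zero_mul, zero_add] at h1
  subst h1
  simp at ha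
  exact ⟨rfl, rfl, ha⟩

namespace Matrix.GeneralLinearGroup

variable {H : Subgroup (GL ι F)}

theorem conj_pairTorus_apply {k l : ι} (hkl : k ≠ l) (a : Fˣ) (g : GL ι F) (i j : ι) :
    (g⁻¹ * diag (pairTorus k l a) * g).1 i j = (if i = j then 1 else 0)
      + (((a : F) - 1) * (g⁻¹.1 i k * g.1 k j)
        + ((a⁻¹ : Fˣ) - 1 : F) * (g⁻¹.1 i l * g.1 l j)) := by
  rw [conj_diag_apply, Finset.sum_eq_add_of_mem k l (Finset.mem_univ _) (Finset.mem_univ _) hkl]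
  · rw [pairTorus_left hkl, pairTorus_right hkl]; ring
  · intro c _ hc
    rw [pairTorus_of_ne hc.1 hc.2, Units.val_one, sub_self, mul_zero, zero_mul]

theorem isMonomial_of_col_line (hN : ∀ g : GL ι F, g.1.det = 1 → g.1.IsMonomial → g ∈ H)
    (hcol : ∀ h ∈ H, ∀ j, (∀ k, k ≠ j → h.1 k j = 0) → h.1.IsMonomial)
    {h : GL ι F} (hh : h ∈ H) {j l : ι} (hc : ∀ k, k ≠ l → h.1 k j = 0) : h.1.IsMonomial := by
  set P := permGL F (Equiv.swap j l) with hP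
  have hdP : P.1.det ≠ 0 := det_ne_zero P
  set d : GL ι F := diag (Pi.mulSingle j (Units.mk0 _ hdP)⁻¹) with hd
  have hdm : (d * P).1.IsMonomial := (isMonomial_diag _).mul (isMonomial_permGL _)
  have hmem : d * P ∈ H := hN _ (by
    rw [coe_mul, Matrix.det_mul, hd, det_diag, ← Units.coe_prod]; simp [hdP]) hdm
  rw [← isMonomial_mul_left_iff hdm]
  refine hcol _ (mul_mem hmem hh) j fun k hk => ?_
  have hPh : (P * h).1 k j = h.1 (Equiv.swap j l k) j := by
    rw [hP, permGL_mul_apply, Equiv.symm_swap]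
  rw [mul_assoc, hd, diag_mul_apply, hPh, hc, mul_zero]
  intro hk'
  rw [Equiv.swap_apply_eq_iff, Equiv.swap_apply_right] at hk'
  exact hk hk'

variable [Fintype F]

/-- The two zeros make every conjugate of a torus element on `{k, l}` fix the `i`-th coordinate
line, hence monomial. If such a conjugate had a nonzero entry at `(j, j)`, column `j` of `h` would
be an eigenvector of the torus element, with eigenvalue 1 because of row `m` and `b` because of row
`k`. So the entry vanishes for all `b ≠ 1`; multiplied by `b` it is a quadratic in `b` with three
roots, yet its coefficients sum to 1. -/
theorem apply_eq_zero_of_two_zeros (hq : 5 ≤ Fintype.card F)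
    (hN : ∀ g : GL ι F, g.1.det = 1 → g.1.IsMonomial → g ∈ H)
    (hcol : ∀ h ∈ H, ∀ j, (∀ k, k ≠ j → h.1 k j = 0) → h.1.IsMonomial)
    {h : GL ι F} (hh : h ∈ H) {i j k l m : ι} (hkl : k ≠ l) (hk : h.1 k i = 0)
    (hl : h.1 l i = 0) (hmk : m ≠ k) (hml : m ≠ l) (hm : h.1 m j ≠ 0) : h.1 k j = 0 := by
  classical
  by_contra hkj
  have hmon : ∀ b : Fˣ, (h⁻¹ * diag (pairTorus k l b) * h).1.IsMonomial := fun b =>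
    hcol _ (mul_mem (mul_mem (inv_mem hh) (diag_mem hN (prod_pairTorus k l b))) hh) i
      fun r hr => by
        rw [conj_pairTorus_apply hkl, hk, hl, if_neg hr]; ring
  have hz : ∀ b : Fˣ, (b : F) ≠ 1 → (h⁻¹ * diag (pairTorus k l b) * h).1 j j = 0 := by
    intro b hb
    by_contra hne
    set y := h⁻¹ * diag (pairTorus k l b) * h with hy
    have hyo : ∀ r, r ≠ j → y.1 r j = 0 := fun r hr => by
      by_contra hr0; exact hr ((hmon b).eq_of_ne_zero hr0 hne)
    have heq : ∀ r, (pairTorus k l b r : F) * h.1 r j = h.1 r j * y.1 j j := by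
      intro r
      have : diag (pairTorus k l b) * h = h * y := by rw [hy]; group
      rw [← diag_mul_apply, this, mul_entry, Finset.sum_eq_single j
        (fun s _ hs => by rw [hyo s hs, mul_zero]) (by simp)]
    have h1 := heq m
    rw [pairTorus_of_ne hmk hml, Units.val_one, one_mul] at h1
    have hy1 : y.1 j j = 1 := mul_left_cancel₀ hm (by rw [← h1, mul_one])
    have h2 := heq k
    rw [pairTorus_left hkl, hy1, mul_one] at h2
    exact hb (mul_right_cancel₀ hkj (by rw [h2, one_mul]))
  have hquad : ∀ b : Fˣ, (b : F) ≠ 1 → (h⁻¹.1 j k * h.1 k j) * (b : F) ^ 2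
      + (1 - h⁻¹.1 j k * h.1 k j - h⁻¹.1 j l * h.1 l j) * b + h⁻¹.1 j l * h.1 l j = 0 := by
    intro b hb
    have h1 := hz b hb
    rw [conj_pairTorus_apply hkl, if_pos rfl] at h1
    have h2 : ((b⁻¹ : Fˣ) : F) * b = 1 := by simp
    linear_combination (b : F) * h1 - (h⁻¹.1 j l * h.1 l j) * h2
  obtain ⟨a, ha⟩ := exists_unit_ne hq {1} (by simp)
  obtain ⟨b, hb⟩ := exists_unit_ne hq {1, (a : F)} (Finset.card_le_two.trans (by omega))
  obtain ⟨c, hc⟩ := exists_unit_ne hq {1, (a : F), (b : F)} Finset.card_le_three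
  simp only [Finset.mem_insert, Finset.mem_singleton, not_or] at ha hb hc
  obtain ⟨h1, h2, h3⟩ := quadratic_coeff_eq_zero (Ne.symm hb.2) (Ne.symm hc.2.1)
    (Ne.symm hc.2.2) (hquad a ha) (hquad b hb.1) (hquad c hc.1)
  rw [h1, h3] at h2
  simp at h2

/-- For any row `r ≠ k`, one of the pairs `{k, l}` and `{k, m}` avoids `r`. Hence a column with a
nonzero entry in row `k` has no other nonzero entry. -/
theorem isMonomial_of_three_zeros (hq : 5 ≤ Fintype.card F)
    (hN : ∀ g : GL ι F, g.1.det = 1 → g.1.IsMonomial → g ∈ H)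
    (hcol : ∀ h ∈ H, ∀ j, (∀ k, k ≠ j → h.1 k j = 0) → h.1.IsMonomial)
    {h : GL ι F} (hh : h ∈ H) {i k l m : ι} (hkl : k ≠ l) (hkm : k ≠ m) (hlm : l ≠ m)
    (hk : h.1 k i = 0) (hl : h.1 l i = 0) (hm : h.1 m i = 0) : h.1.IsMonomial := by
  obtain ⟨j, hj⟩ := exists_row_ne_zero h k
  refine isMonomial_of_col_line hN hcol hh (j := j) (l := k) fun r hr => ?_
  by_contra hrj
  by_cases hrl : r = l
  · exact hj (apply_eq_zero_of_two_zeros hq hN hcol hh hkm hk hm hr (hrl ▸ hlm) hrj)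
  · exact hj (apply_eq_zero_of_two_zeros hq hN hcol hh hkl hk hl hr hrl hrj)

/-- A column that is nonzero in row `k` must vanish in every row outside `{k, l}`, and five
coordinates leave three such rows. -/
theorem isMonomial_of_two_zeros (hq : 5 ≤ Fintype.card F) (hι : 5 ≤ Fintype.card ι)
    (hN : ∀ g : GL ι F, g.1.det = 1 → g.1.IsMonomial → g ∈ H)
    (hcol : ∀ h ∈ H, ∀ j, (∀ k, k ≠ j → h.1 k j = 0) → h.1.IsMonomial)
    {h : GL ι F} (hh : h ∈ H) {i k l : ι} (hkl : k ≠ l)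
    (hk : h.1 k i = 0) (hl : h.1 l i = 0) : h.1.IsMonomial := by
  obtain ⟨j, hj⟩ := exists_row_ne_zero h k
  have hz : ∀ m, m ≠ k → m ≠ l → h.1 m j = 0 := by
    intro m hmk hml
    by_contra hm
    exact hj (apply_eq_zero_of_two_zeros hq hN hcol hh hkl hk hl hmk hml hm)
  obtain ⟨a, ha⟩ := exists_ne_of_card_lt {k, l} (Finset.card_le_two.trans_lt (by omega))
  obtain ⟨b, hb⟩ := exists_ne_of_card_lt {k, l, a} (Finset.card_le_three.trans_lt (by omega))
  obtain ⟨c, hc⟩ := exists_ne_of_card_lt {k, l, a, b} (Finset.card_le_four.trans_lt (by omega))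
  simp only [Finset.mem_insert, Finset.mem_singleton, not_or] at ha hb hc
  exact isMonomial_of_three_zeros hq hN hcol hh (Ne.symm hb.2.2) (Ne.symm hc.2.2.1)
    (Ne.symm hc.2.2.2) (hz a ha.1 ha.2) (hz b hb.1 hb.2.1) (hz c hc.1 hc.2.1)

/-- A fixed point free permutation of at least `3k - 2` points admits a set of `k` points which
is disjoint from its image. -/
theorem exists_finset_perm_disjoint (σ : Equiv.Perm ι) (hσ : ∀ i, σ i ≠ i) (k : ℕ)
    (hk : 3 * k ≤ Fintype.card ι + 2) : ∃ A : Finset ι, A.card = k ∧ ∀ a ∈ A, ∀ b ∈ A, a ≠ σ b := by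
  induction k with
  | zero => exact ⟨∅, rfl, by simp⟩
  | succ k ih =>
    obtain ⟨A, hA, hdis⟩ := ih (by omega)
    -- Greedy choice: `A` with its image and preimage covers at most `3k` points.
    obtain ⟨m, hm⟩ := exists_ne_of_card_lt (A ∪ (A.image σ ∪ A.image σ.symm)) (by
      refine (Finset.card_union_le _ _).trans_lt ?_
      have h1 := Finset.card_union_le (A.image σ) (A.image σ.symm)
      have h2 := Finset.card_image_le (s := A) (f := σ)
      have h3 := Finset.card_image_le (s := A) (f := σ.symm)
      omega)
    simp only [Finset.mem_union, Finset.mem_image, not_or, not_exists, not_and] at hm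
    refine ⟨insert m A, by rw [Finset.card_insert_of_notMem hm.1, hA], ?_⟩
    intro a ha b hb
    rw [Finset.mem_insert] at ha hb
    rcases ha with rfl | ha <;> rcases hb with rfl | hb
    · exact (hσ _).symm
    · exact fun h => hm.2.1 b hb h.symm
    · exact fun h => hm.2.2 a ha (by rw [h, Equiv.symm_apply_apply])
    · exact hdis a ha b hb

/-- The conjugate minus the identity has rank at most 4. If its permutation had no fixed point, the
block of this difference on five coordinates disjoint from their image would be minus the identity,
of rank 5. At a fixed point `m`, column `m` of `h` is an eigenvector of `diag t`. -/
theorem exists_eigen_col (hι : 13 ≤ Fintype.card ι) {h : GL ι F} {t : ι → Fˣ} {E : Finset ι}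
    (hE : E.card ≤ 4) (ht : ∀ i, i ∉ E → t i = 1)
    (hm : (h⁻¹ * diag t * h).1.IsMonomial) :
    ∃ m, ∃ c : F, ∀ k, (t k : F) * h.1 k m = c * h.1 k m := by
  set y := h⁻¹ * diag t * h with hy
  obtain ⟨σ, hσ1, hσ2⟩ := exists_perm_of_isMonomial hm
  have heq : diag t * h = h * y := by rw [hy]; group
  by_cases hfix : ∃ m, σ m = m
  · obtain ⟨m, hm⟩ := hfix
    refine ⟨m, y.1 m m, fun k => ?_⟩
    rw [← diag_mul_apply, heq, mul_entry, Finset.sum_eq_single m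
      (fun s _ hs => by rw [hσ2 s m (by rwa [hm]), mul_zero]) (by simp), mul_comm]
  · push Not at hfix
    exfalso
    -- The requirement `3 * 5 ≤ n + 2` is exactly `n ≥ 13`.
    obtain ⟨A, hA, hdis⟩ := exists_finset_perm_disjoint σ hfix 5 (by omega)
    let f : (A → F) →ₗ[F] (E → F) := (Matrix.of fun (e : E) (a : A) => h.1 e a).mulVecLin
    have hker : LinearMap.ker f ≠ ⊥ := f.ker_ne_bot_of_finrank_lt (by simp; omega)
    obtain ⟨v, hv, hv0⟩ := Submodule.exists_mem_ne_zero_of_ne_bot hker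
    have hfv : ∀ e ∈ E, ∑ a : A, h.1 e a * v a = 0 := fun e he => congrFun hv ⟨e, he⟩
    apply hv0
    ext a
    have h1 : ∀ i, ∑ a : A, (y.1 i a - if i = a then 1 else 0) * v a = 0 := by
      intro i
      simp only [hy, conj_diag_apply, add_sub_cancel_left, Finset.sum_mul]
      rw [Finset.sum_comm]
      refine Finset.sum_eq_zero fun k _ => ?_
      by_cases hk : k ∈ E
      · have := hfv k hk
        simp only [mul_assoc]
        rw [← Finset.mul_sum, ← Finset.mul_sum, this, mul_zero, mul_zero]
      · simp [ht k hk]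
    have h2 := h1 a
    have h3 : ∀ b : A, y.1 a b = 0 := fun b => hσ2 a b (hdis a a.2 b b.2)
    simp only [h3, zero_sub, neg_mul, ite_mul, one_mul, zero_mul, Finset.sum_neg_distrib,
      neg_eq_zero, Subtype.coe_inj, Finset.sum_ite_eq, Finset.mem_univ, if_true] at h2
    exact h2

/-- A diagonal `t`, nontrivial only at `z` and three further rows, is chosen so that the conjugate
has two zeros in column `k` and is therefore monomial. By `exists_eigen_col` some column of `h` is
an eigenvector of `diag t`, so it vanishes wherever `t` differs from the eigenvalue. That happens in
at least two rows. -/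
theorem isMonomial_of_zero (hq : 5 ≤ Fintype.card F) (hι : 13 ≤ Fintype.card ι)
    (hN : ∀ g : GL ι F, g.1.det = 1 → g.1.IsMonomial → g ∈ H)
    (hcol : ∀ h ∈ H, ∀ j, (∀ k, k ≠ j → h.1 k j = 0) → h.1.IsMonomial)
    {h : GL ι F} (hh : h ∈ H) {z k : ι} (hz : h.1 z k = 0) : h.1.IsMonomial := by
  classical
  by_contra hmon
  have htwo : ∀ {g : GL ι F}, g ∈ H → ∀ {i k l : ι}, k ≠ l → g.1 k i = 0 → g.1 l i = 0 →
      g.1.IsMonomial := fun hg _ _ _ hkl hk hl =>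
    isMonomial_of_two_zeros hq (by omega) hN hcol hg hkl hk hl
  obtain ⟨j₁, hj₁⟩ := exists_ne_of_card_lt {z} (by simp; omega)
  obtain ⟨j₂, hj₂⟩ := exists_ne_of_card_lt {z, j₁} (Finset.card_le_two.trans_lt (by omega))
  obtain ⟨j₃, hj₃⟩ := exists_ne_of_card_lt {z, j₁, j₂} (Finset.card_le_three.trans_lt (by omega))
  obtain ⟨r, hr⟩ := exists_ne_of_card_lt {k} (by simp; omega)
  obtain ⟨r', hr'⟩ := exists_ne_of_card_lt {k, r} (Finset.card_le_two.trans_lt (by omega))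
  simp only [Finset.mem_insert, Finset.mem_singleton, not_or] at hj₁ hj₂ hj₃ hr hr'
  set E : Finset ι := {j₁, j₂, j₃} with hE
  have hEc : E.card = 3 := Finset.card_eq_three.2
    ⟨j₁, j₂, j₃, Ne.symm hj₂.2, Ne.symm hj₃.2.1, Ne.symm hj₃.2.2, rfl⟩
  have hzE : z ∉ E := by
    simp only [hE, Finset.mem_insert, Finset.mem_singleton, not_or]
    exact ⟨Ne.symm hj₁, Ne.symm hj₂.1, Ne.symm hj₃.1⟩
  -- a solution of two homogeneous equations in three unknowns
  let f : (E → F) →ₗ[F] (Fin 2 → F) :=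
    (Matrix.of fun (s : Fin 2) (e : E) => h⁻¹.1 (![r, r'] s) e * h.1 e k).mulVecLin
  have hker : LinearMap.ker f ≠ ⊥ := f.ker_ne_bot_of_finrank_lt (by simp [hEc])
  obtain ⟨v, hv, hv0⟩ := Submodule.exists_mem_ne_zero_of_ne_bot hker
  obtain ⟨e, he⟩ := Function.ne_iff.1 hv0
  have hf : ∀ s : Fin 2, ∑ a : E, h⁻¹.1 (![r, r'] s) a * h.1 a k * v a = 0 := fun s => congrFun hv s
  set x : ι → F := fun i => if hi : i ∈ E then v ⟨i, hi⟩ else 0 with hx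
  have hxE : ∀ i, i ∉ E → x i = 0 := fun i hi => by simp [hx, hi]
  have hsum : ∀ s : Fin 2, ∑ i, h⁻¹.1 (![r, r'] s) i * h.1 i k * x i = 0 := by
    intro s
    rw [← hf s, ← Finset.sum_subset (Finset.subset_univ E)
      (fun i _ hi => by rw [hxE i hi, mul_zero]), ← Finset.sum_coe_sort E]
    refine Finset.sum_congr rfl fun a _ => ?_
    simp [hx]
  -- rescale the solution
  obtain ⟨c, hc⟩ := exists_unit_ne hq (E.image fun i => -(x i)⁻¹)
    (Finset.card_image_le.trans hEc.le)
  have hne : ∀ i, 1 + (c : F) * x i ≠ 0 := by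
    intro i h0
    by_cases hi : i ∈ E
    · apply hc
      rw [Finset.mem_image]
      refine ⟨i, hi, ?_⟩
      have hx0 : x i ≠ 0 := by rintro h1; rw [h1] at h0; simp at h0
      field_simp
      linear_combination -h0
    · rw [hxE i hi] at h0; simp at h0
  set u : ι → Fˣ := fun i => Units.mk0 _ (hne i) with hu
  -- Since `h z k = 0`, the entry of `t` at `z` does not affect column `k` of the conjugate and can
  -- be used to make the determinant 1.
  set t : ι → Fˣ := u * Pi.mulSingle z (∏ i, u i)⁻¹ with ht
  have hprod : ∏ i, t i = 1 := by simp [ht, Finset.prod_mul_distrib]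
  have htz : ∀ i, i ≠ z → (t i : F) = 1 + c * x i := fun i hi => by
    simp [ht, hu, Pi.mulSingle_eq_of_ne hi]
  have htE : ∀ i, i ∉ insert z E → t i = 1 := fun i hi => by
    rw [Finset.mem_insert, not_or] at hi
    refine Units.ext ?_
    rw [htz i hi.1, hxE i hi.2, mul_zero, add_zero, Units.val_one]
  have hyH : h⁻¹ * diag t * h ∈ H := mul_mem (mul_mem (inv_mem hh) (diag_mem hN hprod)) hh
  have hy0 : ∀ s : Fin 2, ![r, r'] s ≠ k → (h⁻¹ * diag t * h).1 (![r, r'] s) k = 0 := by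
    intro s hs
    rw [conj_diag_apply, if_neg hs, zero_add, ← mul_zero (c : F), ← hsum s, Finset.mul_sum]
    refine Finset.sum_congr rfl fun i _ => ?_
    by_cases hi : i = z
    · subst hi; rw [hz]; ring
    · rw [htz i hi]; ring
  have hymon := htwo hyH (Ne.symm hr'.2) (hy0 0 hr) (hy0 1 hr'.1)
  obtain ⟨m, d, hd⟩ := exists_eigen_col hι
    ((Finset.card_insert_le _ _).trans (by omega)) htE hymon
  have hzero : ∀ i, (t i : F) ≠ d → h.1 i m = 0 := fun i hi => by
    by_contra h0; exact hi (mul_right_cancel₀ h0 (hd i))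
  have hez : (e : ι) ≠ z := fun h => hzE (h ▸ e.2)
  have hte : (t e : F) ≠ 1 := by
    rw [htz e hez]
    have : x e = v e := by simp [hx]
    rw [this]
    simpa using he
  apply hmon
  by_cases hd1 : d = 1
  · subst hd1
    -- The entries of `t` have product 1, so exactly one of them cannot differ from 1.
    obtain ⟨i, hie, hi⟩ : ∃ i, i ≠ (e : ι) ∧ (t i : F) ≠ 1 := by
      by_contra! hcon
      rw [Finset.prod_eq_single (e : ι) (fun i _ hi => Units.ext (hcon i hi)) (by simp)] at hprod
      exact hte (by rw [hprod, Units.val_one])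
    exact htwo hh hie (hzero i hi) (hzero e hte)
  · obtain ⟨a, ha⟩ := exists_ne_of_card_lt (insert z E)
      ((Finset.card_insert_le _ _).trans_lt (by omega))
    obtain ⟨b, hb⟩ := exists_ne_of_card_lt (insert a (insert z E))
      ((Finset.card_insert_le _ _).trans_lt (by
        have := Finset.card_insert_le z E
        omega))
    rw [Finset.mem_insert, not_or] at hb
    refine htwo hh hb.1 (hzero b ?_) (hzero a ?_)
    · rw [htE b hb.2, Units.val_one]; exact Ne.symm hd1
    · rw [htE a ha, Units.val_one]; exact Ne.symm hd1

/-- A subgroup containing the monomial matrices of determinant `1`, all of whose elements that fix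
a coordinate line are monomial, is monomial. -/
theorem isMonomial_of_mem (hq : 5 ≤ Fintype.card F) (hι : 13 ≤ Fintype.card ι)
    (hN : ∀ g : GL ι F, g.1.det = 1 → g.1.IsMonomial → g ∈ H)
    (hcol : ∀ h ∈ H, ∀ j, (∀ k, k ≠ j → h.1 k j = 0) → h.1.IsMonomial)
    {h : GL ι F} (hh : h ∈ H) : h.1.IsMonomial := by
  classical
  by_contra hmon
  have hne : ∀ z k, h.1 z k ≠ 0 := fun z k hz =>
    hmon (isMonomial_of_zero hq hι hN hcol hh hz)
  have hne' : ∀ z k, h⁻¹.1 z k ≠ 0 := fun z k hz => hmon (by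
    simpa using isMonomial_inv (isMonomial_of_zero hq hι hN hcol (inv_mem hh) hz))
  -- If these products never depended on the middle index, two columns of `h` would be proportional.
  obtain ⟨r, s, i, j, hrs, hij⟩ : ∃ r s i j, r ≠ s ∧
      h⁻¹.1 r i * h.1 i s ≠ h⁻¹.1 r j * h.1 j s := by
    by_contra! hcon
    have : Nonempty ι := Fintype.card_pos_iff.1 (by omega)
    obtain ⟨r⟩ := this
    obtain ⟨a, ha⟩ := exists_ne_of_card_lt {r} (by simp; omega)
    obtain ⟨b, hb⟩ := exists_ne_of_card_lt {r, a} (Finset.card_le_two.trans_lt (by omega))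
    simp only [Finset.mem_insert, Finset.mem_singleton, not_or] at ha hb
    have hprop : ∀ i, h.1 i a * h.1 r b = h.1 r a * h.1 i b := by
      intro i
      have h1 := hcon r a i r (Ne.symm ha)
      have h2 := hcon r b i r (Ne.symm hb.1)
      refine mul_left_cancel₀ (mul_ne_zero (hne' r i) (hne' r r)) ?_
      linear_combination (h⁻¹.1 r r * h.1 r b) * h1 - (h⁻¹.1 r r * h.1 r a) * h2
    have h1 := sum_inv_mul h b b
    have h2 := sum_inv_mul h b a
    rw [if_pos rfl] at h1
    rw [if_neg hb.2] at h2
    have h3 : h.1 r a * ∑ k, h⁻¹.1 b k * h.1 k b = h.1 r b * ∑ k, h⁻¹.1 b k * h.1 k a := by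
      rw [Finset.mul_sum, Finset.mul_sum]
      refine Finset.sum_congr rfl fun k _ => ?_
      linear_combination (-h⁻¹.1 b k) * hprop k
    rw [h1, h2, mul_one, mul_zero] at h3
    exact hne r a h3
  have hij' : i ≠ j := by rintro rfl; exact hij rfl
  set ci := h⁻¹.1 r i * h.1 i s with hci
  set cj := h⁻¹.1 r j * h.1 j s with hcj
  have hci0 : ci ≠ 0 := mul_ne_zero (hne' _ _) (hne _ _)
  have hcj0 : cj ≠ 0 := mul_ne_zero (hne' _ _) (hne _ _)
  -- With `a = cj / ci` the entry `(a - 1) ci + (a⁻¹ - 1) cj` of the conjugate is zero. An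
  -- eigenvector column of `h` without zeros then forces the torus element to be scalar, contrary to
  -- `a ≠ 1`.
  set a : Fˣ := Units.mk0 cj hcj0 / Units.mk0 ci hci0 with ha
  have hyH : h⁻¹ * diag (pairTorus i j a) * h ∈ H :=
    mul_mem (mul_mem (inv_mem hh) (diag_mem hN (prod_pairTorus i j a))) hh
  have hy0 : (h⁻¹ * diag (pairTorus i j a) * h).1 r s = 0 := by
    rw [conj_pairTorus_apply hij', if_neg hrs, ← hci, ← hcj, ha]
    simp only [inv_div, Units.val_div_eq_div_val, Units.val_mk0]
    field_simp
    ring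
  obtain ⟨m, d, hd⟩ := exists_eigen_col hι (E := {i, j}) (Finset.card_le_two.trans (by omega))
    (fun l hl => by
      simp only [Finset.mem_insert, Finset.mem_singleton, not_or] at hl
      exact pairTorus_of_ne hl.1 hl.2 a) (isMonomial_of_zero hq hι hN hcol hyH hy0)
  have hall : ∀ l, (pairTorus i j a l : F) = d := fun l => mul_right_cancel₀ (hne l m) (hd l)
  obtain ⟨l, hl⟩ := exists_ne_of_card_lt {i, j} (Finset.card_le_two.trans_lt (by omega))
  simp only [Finset.mem_insert, Finset.mem_singleton, not_or] at hl
  have h1 := (hall i).trans (hall l).symm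
  rw [pairTorus_left hij', pairTorus_of_ne hl.1 hl.2, ha] at h1
  simp only [Units.val_div_eq_div_val, Units.val_mk0, Units.val_one] at h1
  exact hij ((div_eq_one_iff_eq hci0).1 h1).symm

end Matrix.GeneralLinearGroup

end MonomialMaximal

/-! ### Maximality of the monomial group -/

section Generation

set_option linter.unusedSectionVars false

variable {ι F : Type*} [Fintype ι] [DecidableEq ι] [Field F]

namespace Matrix.GeneralLinearGroup

variable {H : Subgroup (GL ι F)}

theorem conj_permGL_rowGL (σ : Equiv.Perm ι) (j k : ι) (a : F) :
    permGL F σ * rowGL j (Pi.single k a) * (permGL F σ)⁻¹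
      = rowGL (σ j) (Pi.single (σ k) a) := by
  refine ext fun r s => ?_
  rw [conj_permGL_apply]
  simp [rowGL_apply, Equiv.symm_apply_eq, Pi.single_apply]

theorem exists_perm_apply_eq {i j k l : ι} (hjk : j ≠ k) (hil : i ≠ l) :
    ∃ σ : Equiv.Perm ι, σ j = i ∧ σ k = l := by
  refine ⟨Equiv.swap (Equiv.swap j i k) l * Equiv.swap j i, ?_, ?_⟩
  · rw [Equiv.Perm.mul_apply, Equiv.swap_apply_left, Equiv.swap_apply_of_ne_of_ne _ hil]
    intro h
    rw [eq_comm, Equiv.swap_apply_eq_iff, Equiv.swap_apply_right] at h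
    exact hjk h.symm
  · rw [Equiv.Perm.mul_apply, Equiv.swap_apply_left]

theorem rowGL_mem_of_rowGL_mem (hι : 3 ≤ Fintype.card ι)
    (hN : ∀ g : GL ι F, g.1.det = 1 → g.1.IsMonomial → g ∈ H)
    {j k : ι} (hjk : j ≠ k) {a : F} (ha : a ≠ 0) (hmem : rowGL j (Pi.single k a) ∈ H)
    {i l : ι} (hil : i ≠ l) (b : F) : rowGL i (Pi.single l b) ∈ H := by
  by_cases hb : b = 0
  · subst hb; rw [Pi.single_zero, rowGL_zero]; exact one_mem H
  obtain ⟨σ, hσj, hσk⟩ := exists_perm_apply_eq hjk hil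
  obtain ⟨m, hm⟩ := exists_ne_of_card_lt {i, l} (Finset.card_le_two.trans_lt (by omega))
  simp only [Finset.mem_insert, Finset.mem_singleton, not_or] at hm
  set c : Fˣ := Units.mk0 b hb / Units.mk0 a ha with hc
  set δ : Fˣ := det (permGL F σ) with hδ
  -- The entry at `i` rescales `a` to `b`; the entry at the third index `m` restores determinant 1
  -- without touching the transvection.
  set t : ι → Fˣ := Pi.mulSingle i c * Pi.mulSingle m (δ * c)⁻¹ with ht
  have hP : diag t * permGL F σ ∈ H := by
    refine hN _ ?_ ((isMonomial_diag _).mul (isMonomial_permGL _))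
    have : (permGL F σ).1.det = (δ : F) := rfl
    rw [coe_mul, Matrix.det_mul, this, det_diag, ← Units.coe_prod, ← Units.val_mul,
      ← Units.val_one]
    congr 1
    simp only [ht, Pi.mul_apply, Finset.prod_mul_distrib, Finset.prod_pi_mulSingle', Finset.mem_univ, if_true]
    rw [_root_.mul_inv_rev δ c, mul_inv_cancel_left, inv_mul_cancel]
  have h1 := mul_mem (mul_mem hP hmem) (inv_mem hP)
  have h2 : diag t * permGL F σ * rowGL j (Pi.single k a) * (diag t * permGL F σ)⁻¹
      = rowGL i (Pi.single l b) := by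
    rw [_root_.mul_inv_rev (diag t)]
    calc _ = diag t * (permGL F σ * rowGL j (Pi.single k a) * (permGL F σ)⁻¹) * (diag t)⁻¹ := by
            group
      _ = _ := by
            rw [conj_permGL_rowGL, hσj, hσk, conj_rowGL]
            refine rowGL_congr fun s hs => ?_
            by_cases hsl : s = l
            · subst hsl
              simp [ht, Pi.mulSingle_eq_of_ne (Ne.symm hm.1), Pi.mulSingle_eq_of_ne hs,
                Pi.mulSingle_eq_of_ne (Ne.symm hm.2), hc]
              field_simp
            · simp [hsl]
  rwa [h2] at h1

theorem mem_of_forall_rowGL_mem (hN : ∀ g : GL ι F, g.1.det = 1 → g.1.IsMonomial → g ∈ H)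
    (hrow : ∀ i l, i ≠ l → ∀ b, rowGL i (Pi.single l b) ∈ H) (g : GL ι F) (hg : g.1.det = 1) :
    g ∈ H := by
  suffices ∃ h ∈ H, h.1 = g.1 by
    obtain ⟨h, hh, he⟩ := this
    rwa [← Units.ext he]
  refine Matrix.diagonal_transvection_induction (fun M => ∃ h ∈ H, h.1 = M) g.1 ?_ ?_ ?_
  · intro D hD
    rw [hg, Matrix.det_diagonal] at hD
    have hD0 : ∀ i, D i ≠ 0 := fun i hi => by
      rw [Finset.prod_eq_zero (Finset.mem_univ i) hi] at hD; exact zero_ne_one hD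
    refine ⟨diag fun i => Units.mk0 (D i) (hD0 i), hN _ ?_ (isMonomial_diag _), rfl⟩
    rw [det_diag]; exact hD
  · rintro ⟨i, l, hil, b⟩
    refine ⟨_, hrow i l hil b, ?_⟩
    ext r s
    simp only [rowGL_apply, Matrix.TransvectionStruct.toMatrix_mk, Matrix.transvection,
      Matrix.add_apply, Matrix.one_apply, Matrix.single_apply, Pi.single_apply]
    congr 1
    by_cases hr : i = r <;> by_cases hs : l = s
    · subst hr hs; simp [hil.symm]
    · simp [hs, Ne.symm hs]
    · simp [hr, Ne.symm hr]
    · simp [hr, Ne.symm hr]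
  · rintro A B ⟨h, hh, rfl⟩ ⟨h', hh', rfl⟩
    exact ⟨h * h', mul_mem hh hh', rfl⟩

/-- The monomial matrices of determinant `1` form a maximal subgroup of the special linear
group. -/
theorem mem_of_not_isMonomial [Fintype F] (hq : 5 ≤ Fintype.card F) (hι : 13 ≤ Fintype.card ι)
    (hN : ∀ g : GL ι F, g.1.det = 1 → g.1.IsMonomial → g ∈ H)
    (hdet : ∀ g ∈ H, g.1.det = 1) {h : GL ι F} (hh : h ∈ H) (hm : ¬ h.1.IsMonomial)
    (g : GL ι F) (hg : g.1.det = 1) : g ∈ H := by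
  by_contra hgH
  refine hm (isMonomial_of_mem hq hι hN (fun h hh j hj =>
    isMonomial_of_col_diag hq (by omega) hN hdet ?_ hh hj) hh)
  intro j k hjk a hmem
  by_contra ha
  exact hgH (mem_of_forall_rowGL_mem hN (fun i l hil b =>
    rowGL_mem_of_rowGL_mem (by omega) hN hjk ha hmem hil b) g hg)

end Matrix.GeneralLinearGroup

end Generation

/-! ### Line decompositions and linearly independent families -/

section Frames

variable {n : ℕ} {F : Type*} [Field F]

/-- The set of the lines spanned by a family of vectors. -/
def lineFrame (v : Fin n → Fin n → F) : Set (Submodule F (Fin n → F)) :=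
  Set.range fun i => F ∙ v i

theorem isLineDecomposition_lineFrame {v : Fin n → Fin n → F} (hv : LinearIndependent F v) :
    IsLineDecomposition (lineFrame v) := by
  refine ⟨?_, ?_, ?_⟩
  · rintro _ ⟨i, rfl⟩
    exact finrank_span_singleton (hv.ne_zero i)
  · exact hv.iSupIndep_span_singleton.sSupIndep_range
  · rw [lineFrame, sSup_range, ← Submodule.span_range_eq_iSup]
    exact hv.span_eq_top_of_card_eq_finrank' (by simp)

theorem exists_lineFrame_eq {D : Set (Submodule F (Fin n → F))} (hD : IsLineDecomposition D) :
    ∃ v : Fin n → Fin n → F, LinearIndependent F v ∧ lineFrame v = D := by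
  obtain ⟨h1, h2, h3⟩ := hD
  have hex : ∀ W : D, ∃ w : Fin n → F, w ≠ 0 ∧ F ∙ w = W := fun W => by
    obtain ⟨⟨w, hw⟩, hw0, -⟩ := finrank_eq_one_iff'.1 (h1 W W.2)
    replace hw0 : w ≠ 0 := fun h => hw0 (Subtype.ext h)
    exact ⟨w, hw0, Submodule.eq_of_le_of_finrank_eq
      ((Submodule.span_singleton_le_iff_mem _ _).2 hw)
      ((finrank_span_singleton hw0).trans (h1 W W.2).symm)⟩
  choose v hv0 hv using hex
  have hli : LinearIndependent F v :=
    ((sSupIndep_iff _).1 h2).linearIndependent _ (fun W => hv W ▸ Submodule.mem_span_singleton_self _)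
      hv0
  have hfin : Finite D := hli.finite
  have : Fintype D := Fintype.ofFinite D
  have htop : ⊤ ≤ Submodule.span F (Set.range v) := by
    rw [Submodule.span_range_eq_iSup, ← h3, sSup_eq_iSup']
    exact iSup_mono fun W => (hv W).ge
  have hcard : Fintype.card D = n := by
    rw [← Module.finrank_eq_card_basis (Module.Basis.mk hli htop), Module.finrank_fin_fun]
  obtain ⟨e⟩ : Nonempty (Fin n ≃ D) := ⟨(Fintype.equivFinOfCardEq hcard).symm⟩
  refine ⟨v ∘ e, hli.comp _ e.injective, ?_⟩
  ext W
  constructor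
  · rintro ⟨i, rfl⟩
    simp only [Function.comp_apply, hv]
    exact (e i).2
  · intro hW
    refine ⟨e.symm ⟨W, hW⟩, ?_⟩
    simp [hv]

/-- One inclusion suffices: sending each line of `w` to the equal line of `v` is an injection of a
finite index set into itself. -/
theorem lineFrame_eq_of_forall_mem {v w : Fin n → Fin n → F} (hw : LinearIndependent F w)
    (h : ∀ i, ∃ j, w i ∈ F ∙ v j) : lineFrame w = lineFrame v := by
  choose σ hσ using h
  have heq : ∀ i, F ∙ w i = F ∙ v (σ i) := fun i => by
    obtain ⟨a, ha⟩ := Submodule.mem_span_singleton.1 (hσ i)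
    have ha0 : a ≠ 0 := fun h => hw.ne_zero i (by rw [← ha, h, zero_smul])
    rw [← ha, Submodule.span_singleton_smul_eq (IsUnit.mk0 a ha0)]
  have hinj : Function.Injective σ := fun i j hij => by
    refine hw.iSupIndep_span_singleton.injective
      (fun i h => hw.ne_zero i (Submodule.span_singleton_eq_bot.1 h)) ?_
    simp only [heq, hij]
  have hbij := Finite.injective_iff_bijective.1 hinj
  ext W
  simp only [lineFrame, Set.mem_range, heq]
  exact ⟨fun ⟨i, hi⟩ => ⟨σ i, hi⟩, fun ⟨j, hj⟩ => (hbij.2 j).imp fun i hi => by rw [hi, hj]⟩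

theorem mk_smul_span_singleton (g : SL(n, F)) (v : Fin n → F) :
    (QuotientGroup.mk g : PSL(n, F)) • (F ∙ v) = F ∙ (g.1.mulVec v) := by
  rw [psl_mk_smul, LinearMap.map_span, Set.image_singleton, Matrix.toLin'_apply]

theorem mk_smul_lineFrame (g : SL(n, F)) (v : Fin n → Fin n → F) :
    (QuotientGroup.mk g : PSL(n, F)) • lineFrame v = lineFrame fun i => g.1.mulVec (v i) := by
  rw [lineFrame, Set.smul_set_range]
  simp only [mk_smul_span_singleton]
  rfl

theorem linearIndependent_mulVec (g : SL(n, F)) {v : Fin n → Fin n → F}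
    (hv : LinearIndependent F v) : LinearIndependent F fun i => g.1.mulVec (v i) :=
  hv.map' (Matrix.SpecialLinearGroup.toLin' g).toLinearMap (LinearEquiv.ker _)

theorem mk_smul_lineFrame_eq_iff (g : SL(n, F)) {v : Fin n → Fin n → F}
    (hv : LinearIndependent F v) :
    (QuotientGroup.mk g : PSL(n, F)) • lineFrame v = lineFrame v ↔
      ∀ i, ∃ j, g.1.mulVec (v i) ∈ F ∙ v j := by
  rw [mk_smul_lineFrame]
  refine ⟨fun h i => ?_, lineFrame_eq_of_forall_mem (linearIndependent_mulVec g hv)⟩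
  obtain ⟨j, hj⟩ : F ∙ (g.1.mulVec (v i)) ∈ lineFrame v := h ▸ ⟨i, rfl⟩
  exact ⟨j, (show F ∙ v j = _ from hj) ▸ Submodule.mem_span_singleton_self _⟩

theorem linearIndependent_single_one :
    LinearIndependent F fun i : Fin n => (Pi.single i 1 : Fin n → F) :=
  Pi.linearIndependent_single_one (Fin n) F

variable (n F) in
/-- The decomposition into the lines of the coordinate vectors. -/
def stdFrame : LineDecompositions n F :=
  ⟨lineFrame fun i => Pi.single i 1, isLineDecomposition_lineFrame linearIndependent_single_one⟩

theorem mk_smul_stdFrame_eq_iff (g : SL(n, F)) :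
    (QuotientGroup.mk g : PSL(n, F)) • stdFrame n F = stdFrame n F ↔ g.1.IsMonomial := by
  rw [← Subtype.coe_inj]
  refine (mk_smul_lineFrame_eq_iff g linearIndependent_single_one).trans ?_
  refine forall_congr' fun i => exists_congr fun j => ?_
  rw [Matrix.mulVec_single_one, Submodule.mem_span_singleton]
  constructor
  · rintro ⟨a, ha⟩ k hk
    have := congrFun ha k
    simpa [hk] using this.symm
  · intro h
    refine ⟨g.1 j i, ?_⟩
    ext k
    by_cases hk : k = j
    · subst hk; simp
    · simp [hk, h k hk]

theorem exists_mk_smul_stdFrame_eq [NeZero n] (D : LineDecompositions n F) :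
    ∃ g : PSL(n, F), g • stdFrame n F = D := by
  obtain ⟨v, hv, hD⟩ := exists_lineFrame_eq D.2
  set M : Matrix (Fin n) (Fin n) F := Matrix.of fun i j => v j i with hM
  have hdet : M.det ≠ 0 := by
    have h : LinearIndependent F M.col := hv
    exact (Matrix.isUnit_iff_isUnit_det _).1
      (Matrix.linearIndependent_cols_iff_isUnit.1 h) |>.ne_zero
  -- Rescaling one basis vector leaves its line unchanged and brings the determinant to 1.
  set g : SL(n, F) := ⟨M.updateCol 0 (M.det⁻¹ • M.col 0), by
    rw [Matrix.det_updateCol_smul, show M.updateCol 0 (M.col 0) = M from M.updateCol_eq_self 0,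
      inv_mul_cancel₀ hdet]⟩ with hg
  refine ⟨QuotientGroup.mk g, Subtype.ext (Eq.trans (mk_smul_lineFrame g _) ?_)⟩
  rw [← hD]
  refine lineFrame_eq_of_forall_mem (linearIndependent_mulVec g linearIndependent_single_one)
    fun i => ⟨i, ?_⟩
  rw [Matrix.mulVec_single_one, Submodule.mem_span_singleton]
  by_cases hi : i = 0
  · subst hi
    exact ⟨M.det⁻¹, by ext k; simp [hg, hM]⟩
  · exact ⟨1, by ext k; simp [hg, hM, hi]⟩

theorem isPretransitive_lineDecompositions [NeZero n] :
    MulAction.IsPretransitive PSL(n, F) (LineDecompositions n F) where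
  exists_smul_eq D D' := by
    obtain ⟨g, rfl⟩ := exists_mk_smul_stdFrame_eq D
    obtain ⟨g', rfl⟩ := exists_mk_smul_stdFrame_eq D'
    exact ⟨g' * g⁻¹, by rw [smul_smul, inv_mul_cancel_right]⟩

end Frames

/-! ### The stabilizer of the coordinate decomposition -/

section Stabilizer

variable {n : ℕ} {F : Type*} [Field F]

open Matrix Matrix.GeneralLinearGroup

theorem mk_mem_stabilizer_iff (g : SL(n, F)) :
    (QuotientGroup.mk g : PSL(n, F)) ∈ MulAction.stabilizer PSL(n, F) (stdFrame n F) ↔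
      g.1.IsMonomial := by
  rw [MulAction.mem_stabilizer_iff, mk_smul_stdFrame_eq_iff]

/-- The matrix `g` of determinant `1` as an element of the special linear group. -/
def slOfGL (g : GL (Fin n) F) (hg : g.1.det = 1) : SL(n, F) := ⟨g.1, hg⟩

theorem exists_not_isMonomial (hn : 2 ≤ n) : ∃ g : SL(n, F), ¬ g.1.IsMonomial := by
  have : NeZero n := ⟨by omega⟩
  have h01 : (⟨0, by omega⟩ : Fin n) ≠ ⟨1, by omega⟩ := by simp
  refine ⟨slOfGL (rowGL ⟨0, by omega⟩ (Pi.single ⟨1, by omega⟩ 1)) (det_rowGL _ _), fun h => ?_⟩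
  refine h01 (h.eq_of_ne_zero (j := ⟨1, by omega⟩) ?_ ?_)
  · simp [slOfGL, rowGL_apply]
  · simp [slOfGL, rowGL_apply]

theorem stabilizer_stdFrame_ne_top (hn : 2 ≤ n) :
    MulAction.stabilizer PSL(n, F) (stdFrame n F) ≠ ⊤ := fun h => by
  obtain ⟨g, hg⟩ := exists_not_isMonomial (F := F) hn
  exact hg ((mk_mem_stabilizer_iff g).1 (h ▸ Subgroup.mem_top _))

theorem nontrivial_lineDecompositions (hn : 2 ≤ n) : Nontrivial (LineDecompositions n F) := by
  obtain ⟨g, hg⟩ := exists_not_isMonomial (F := F) hn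
  exact ⟨⟨_, _, fun h => hg ((mk_smul_stdFrame_eq_iff g).1 h)⟩⟩

theorem isCoatom_stabilizer_stdFrame (hn : 13 ≤ n) [Fintype F] (hq : 5 ≤ Fintype.card F) :
    IsCoatom (MulAction.stabilizer PSL(n, F) (stdFrame n F)) := by
  refine ⟨stabilizer_stdFrame_ne_top (by omega), fun M hM => ?_⟩
  obtain ⟨hle, x, hxM, hx⟩ := SetLike.lt_iff_le_and_exists.1 hM
  obtain ⟨x, rfl⟩ := QuotientGroup.mk_surjective x
  rw [mk_mem_stabilizer_iff] at hx
  have hinj : Function.Injective (Matrix.SpecialLinearGroup.toGL : SL(n, F) →* GL (Fin n) F) :=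
    fun a b h => Subtype.ext (congrArg Units.val h)
  -- The preimage of `M` in the special linear group, embedded in the general linear group.
  set H : Subgroup (GL (Fin n) F) :=
    (M.comap (QuotientGroup.mk' (Subgroup.center SL(n, F)))).map Matrix.SpecialLinearGroup.toGL with hH
  refine (Subgroup.eq_top_iff' M).2 fun y => ?_
  obtain ⟨y, rfl⟩ := QuotientGroup.mk_surjective y
  have hy : Matrix.SpecialLinearGroup.toGL y ∈ H := by
    refine mem_of_not_isMonomial hq (by simpa) ?_ ?_
      (Subgroup.mem_map_of_mem _ (show x ∈ M.comap (QuotientGroup.mk' _) from hxM)) hx _ y.2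
    · intro g hg hgm
      exact ⟨slOfGL g hg, hle ((mk_mem_stabilizer_iff _).2 hgm), Units.ext rfl⟩
    · rintro _ ⟨g, -, rfl⟩
      exact g.2
  obtain ⟨z, hz, hzy⟩ := hy
  rw [← hinj hzy]
  exact hz

theorem isPrimitiveAction_lineDecompositions (hn : 13 ≤ n) [Fintype F]
    (hq : 5 ≤ Fintype.card F) : IsPrimitiveAction PSL(n, F) (LineDecompositions n F) := by
  have : NeZero n := ⟨by omega⟩
  have hnt := nontrivial_lineDecompositions (n := n) (F := F) (by omega)
  have := isPretransitive_lineDecompositions (n := n) (F := F)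
  exact ⟨hnt, (MulAction.isCoatom_stabilizer_iff_preprimitive _ _).1
    (isCoatom_stabilizer_stdFrame hn hq)⟩

theorem mk_eq_mk_iff (g h : SL(n, F)) :
    (QuotientGroup.mk h : PSL(n, F)) = QuotientGroup.mk g ↔
      ∃ r : F, r ^ n = 1 ∧ g.1 = r • h.1 := by
  rw [QuotientGroup.eq, Matrix.SpecialLinearGroup.mem_center_iff, Fintype.card_fin]
  refine exists_congr fun r => and_congr_right fun _ => ?_
  rw [Matrix.scalar_apply, ← Matrix.smul_one_eq_diagonal]
  constructor
  · intro h1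
    have h2 : g.1 = h.1 * (h⁻¹ * g).1 := by
      rw [← Matrix.SpecialLinearGroup.coe_mul, mul_inv_cancel_left]
    rw [h2, ← h1, Matrix.mul_smul, Matrix.mul_one]
  · intro h1
    rw [Matrix.SpecialLinearGroup.coe_mul, h1, Matrix.mul_smul, ← Matrix.SpecialLinearGroup.coe_mul,
      inv_mul_cancel, Matrix.SpecialLinearGroup.coe_one]

theorem mk_mem_splitTorus_iff (g : SL(n, F)) :
    (QuotientGroup.mk g : PSL(n, F)) ∈ splitTorus n F ↔ ∀ i j, i ≠ j → g.1 i j = 0 := by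
  constructor
  · rintro ⟨h, ⟨t, ht⟩, hhg⟩ i j hij
    obtain ⟨r, -, hr⟩ := (mk_eq_mk_iff g h).1 hhg
    have h1 : h.1 = Matrix.diagonal (t : Fin n → F) := (congrArg Units.val ht).symm
    rw [hr, h1, Matrix.smul_apply, Matrix.diagonal_apply_ne _ hij, smul_zero]
  · intro h
    have hdiag : g.1 = Matrix.diagonal g.1.diag := by
      ext i j
      by_cases hij : i = j
      · simp [hij]
      · rw [h i j hij, Matrix.diagonal_apply_ne _ hij]
    have hdet : IsUnit g.1.diag := by
      refine Pi.isUnit_iff.2 fun i => isUnit_iff_ne_zero.2 fun hi => ?_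
      have := g.2
      rw [hdiag, Matrix.det_diagonal, Finset.prod_eq_zero (Finset.mem_univ i) hi] at this
      exact zero_ne_one this
    exact ⟨g, ⟨hdet.unit, Units.ext hdiag.symm⟩, rfl⟩

theorem Matrix.GeneralLinearGroup.conj_apply_eq_zero {g t : GL (Fin n) F} (hg : g.1.IsMonomial)
    (ht : ∀ i j, i ≠ j → t.1 i j = 0) {i j : Fin n} (hij : i ≠ j) :
    (g * t * g⁻¹).1 i j = 0 := by
  obtain ⟨l, hl⟩ := isMonomial_inv hg j
  have h1 : (g * g⁻¹).1 i j = 0 := by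
    rw [mul_inv_cancel]; exact Matrix.one_apply_ne hij
  rw [mul_entry, Finset.sum_eq_single l (fun k _ hk => by rw [hl k hk, mul_zero]) (by simp)] at h1 ⊢
  rw [mul_entry, Finset.sum_eq_single l (fun k _ hk => by rw [ht k l hk, mul_zero]) (by simp),
    mul_right_comm, h1, zero_mul]

theorem stabilizer_le_normalizer_splitTorus :
    MulAction.stabilizer PSL(n, F) (stdFrame n F) ≤
      Subgroup.normalizer (splitTorus n F : Set PSL(n, F)) := by
  have key : ∀ x ∈ MulAction.stabilizer PSL(n, F) (stdFrame n F), ∀ y ∈ splitTorus n F,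
      x * y * x⁻¹ ∈ splitTorus n F := by
    intro x hx y hy
    obtain ⟨g, rfl⟩ := QuotientGroup.mk_surjective x
    obtain ⟨t, rfl⟩ := QuotientGroup.mk_surjective y
    rw [mk_mem_stabilizer_iff] at hx
    rw [mk_mem_splitTorus_iff] at hy
    exact (mk_mem_splitTorus_iff (g * t * g⁻¹)).2 fun i j hij =>
      conj_apply_eq_zero (g := Matrix.SpecialLinearGroup.toGL g) (t := Matrix.SpecialLinearGroup.toGL t)
        hx hy hij
  intro x hx
  refine Subgroup.mem_normalizer_iff.2 fun y => ⟨key x hx y, fun h => ?_⟩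
  have := key _ (inv_mem hx) _ h
  rwa [inv_inv, show x⁻¹ * (x * y * x⁻¹) * x = y by group] at this

/-- A transvection does not normalize the torus: it conjugates a diagonal matrix with distinct
entries at `i` and `j` to a non-diagonal one. The third index keeps the determinant equal to 1. -/
theorem normalizer_splitTorus_ne_top (hn : 3 ≤ n) [Fintype F] (hq : 5 ≤ Fintype.card F) :
    Subgroup.normalizer (splitTorus n F : Set PSL(n, F)) ≠ ⊤ := by
  intro htop
  have h01 : (⟨0, by omega⟩ : Fin n) ≠ ⟨1, by omega⟩ := by simp
  have h02 : (⟨0, by omega⟩ : Fin n) ≠ ⟨2, by omega⟩ := by simp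
  have h12 : (⟨1, by omega⟩ : Fin n) ≠ ⟨2, by omega⟩ := by simp
  generalize (⟨0, by omega⟩ : Fin n) = i at *
  generalize (⟨1, by omega⟩ : Fin n) = j at *
  generalize (⟨2, by omega⟩ : Fin n) = k at *
  classical
  obtain ⟨b, hb⟩ := exists_unit_ne hq {1} (by simp)
  rw [Finset.mem_singleton] at hb
  set r := slOfGL (rowGL i (Pi.single j 1)) (det_rowGL (F := F) _ _) with hr
  set t := slOfGL (diag (pairTorus i k b)) (det_diag_eq_one (prod_pairTorus _ _ _)) with ht
  have htT : (QuotientGroup.mk t : PSL(n, F)) ∈ splitTorus n F :=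
    (mk_mem_splitTorus_iff t).2 fun i j hij => 
      (diag_apply _ _ _).trans (if_neg hij)
  have hmem := (Subgroup.mem_normalizer_iff.1
    (htop ▸ Subgroup.mem_top (QuotientGroup.mk r : PSL(n, F))) _).1 htT
  have h1 := (mk_mem_splitTorus_iff (r * t * r⁻¹)).1 hmem
  set d := r * t * r⁻¹ with hd
  have h2 : d * r = r * t := by rw [hd, inv_mul_cancel_right]
  have hl : ∀ m, (d * r).1 i m = d.1 i i * r.1 i m := fun m => by
    rw [Matrix.SpecialLinearGroup.coe_mul, Matrix.mul_apply,
      Finset.sum_eq_single i (fun k _ hk => by rw [h1 i k hk.symm, zero_mul]) (by simp)]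
  have hr' : ∀ m, (r * t).1 i m = r.1 i m * pairTorus i k b m := fun m => mul_diag_apply _ _ _ _
  have e1 := hl i
  have e2 := hl j
  rw [h2, hr'] at e1 e2
  rw [pairTorus_left h02] at e1
  rw [pairTorus_of_ne h01.symm h12] at e2
  simp only [hr, slOfGL, rowGL_apply] at e1 e2
  simp [h01, h01.symm] at e1 e2
  exact hb (by rw [e1, ← e2])

theorem stabilizer_eq_normalizer_splitTorus (hn : 13 ≤ n) [Fintype F] (hq : 5 ≤ Fintype.card F) :
    MulAction.stabilizer PSL(n, F) (stdFrame n F) =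
      Subgroup.normalizer (splitTorus n F : Set PSL(n, F)) :=
  ((isCoatom_stabilizer_stdFrame hn hq).le_iff_eq (normalizer_splitTorus_ne_top (by omega) hq)).1
    stabilizer_le_normalizer_splitTorus |>.symm

theorem actionEquivalent_normalizer_splitTorus (hn : 13 ≤ n) [Fintype F]
    (hq : 5 ≤ Fintype.card F) :
    ActionEquivalent PSL(n, F) (LineDecompositions n F) (MulEquiv.refl PSL(n, F))
      (PSL(n, F) ⧸ Subgroup.normalizer (splitTorus n F : Set PSL(n, F))) := by
  have : NeZero n := ⟨by omega⟩
  have := isPretransitive_lineDecompositions (n := n) (F := F)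
  rw [← stabilizer_eq_normalizer_splitTorus hn hq]
  set f : PSL(n, F) ⧸ MulAction.stabilizer PSL(n, F) (stdFrame n F) ≃ LineDecompositions n F :=
    Equiv.ofBijective (MulAction.ofQuotientStabilizer PSL(n, F) (stdFrame n F))
      ⟨MulAction.injective_ofQuotientStabilizer _ _, fun D =>
        (exists_mk_smul_stdFrame_eq D).imp' QuotientGroup.mk fun _ h => h⟩ with hf
  refine ⟨f.symm, fun g ω => ?_⟩
  rw [Equiv.symm_apply_eq, MulEquiv.refl_apply]
  refine Eq.trans ?_ (MulAction.ofQuotientStabilizer_smul _ _ _ _).symm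
  congr 1
  exact (f.apply_symm_apply ω).symm

/-- Applying `t - 1` for two torus elements with only the coordinate `i` in common cuts a vector of
an invariant subspace down to a nonzero multiple of a coordinate vector. Monomial matrices then
carry it to all the others. -/
theorem stabilizer_stdFrame_ne_stabilizer (hn : 3 ≤ n) [Fintype F] (hq : 5 ≤ Fintype.card F)
    {W : Submodule F (Fin n → F)} (hW0 : W ≠ ⊥) (hW1 : W ≠ ⊤) :
    MulAction.stabilizer PSL(n, F) (stdFrame n F) ≠ MulAction.stabilizer PSL(n, F) W := by
  intro h
  have hinv : ∀ g : SL(n, F), g.1.IsMonomial → ∀ w ∈ W, g.1.mulVec w ∈ W := fun g hg w hw => by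
    have h1 := h ▸ (mk_mem_stabilizer_iff g).2 hg
    rw [MulAction.mem_stabilizer_iff, psl_mk_smul] at h1
    rw [← h1]
    exact Submodule.mem_map_of_mem hw
  have htorus : ∀ t : Fin n → Fˣ, ∏ i, t i = 1 → ∀ w ∈ W, (fun i => (t i - 1 : F) * w i) ∈ W := by
    intro t ht w hw
    have h1 := sub_mem (hinv (slOfGL (diag t) (det_diag_eq_one ht)) (isMonomial_diag t) w hw) hw
    convert h1 using 1
    ext i
    simp [slOfGL, GeneralLinearGroup.diag, Matrix.mulVec_diagonal, sub_mul]
  obtain ⟨w, hw, hw0⟩ := W.ne_bot_iff.1 hW0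
  obtain ⟨i, hi⟩ := Function.ne_iff.1 hw0
  classical
  obtain ⟨b, hb⟩ := exists_unit_ne hq {1} (by simp)
  rw [Finset.mem_singleton, ← ne_eq, ← sub_ne_zero] at hb
  obtain ⟨k, hk⟩ := exists_ne_of_card_lt {i} (by simp; omega)
  obtain ⟨l, hl⟩ := exists_ne_of_card_lt {i, k} (Finset.card_le_two.trans_lt (by simp; omega))
  simp only [Finset.mem_insert, Finset.mem_singleton, not_or] at hk hl
  have h2 := htorus _ (prod_pairTorus i l b) _ (htorus _ (prod_pairTorus i k b) _ hw)
  have h3 : (Pi.single i 1 : Fin n → F) ∈ W := by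
    convert W.smul_mem ((b - 1 : F) * ((b - 1) * w i))⁻¹ h2 using 1
    ext m
    by_cases hm : m = i
    · subst hm
      have : w m ≠ 0 := hi
      simp [pairTorus_left (Ne.symm hk), pairTorus_left (Ne.symm hl.1)]
      field_simp
    · by_cases hmk : m = k
      · subst hmk
        simp [pairTorus_of_ne hm (Ne.symm hl.2), hm]
      · simp [pairTorus_of_ne hm hmk, hm]
  have h4 : ∀ j, (Pi.single j 1 : Fin n → F) ∈ W := by
    intro j
    set δ : Fˣ := det (permGL F (Equiv.swap i j)) with hδ
    set t : Fin n → Fˣ := Pi.mulSingle j δ⁻¹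
    have hdet : (diag t * permGL F (Equiv.swap i j)).1.det = 1 := by
      have : (permGL F (Equiv.swap i j)).1.det = (δ : F) := rfl
      rw [coe_mul, Matrix.det_mul, this, det_diag, ← Units.coe_prod, Finset.prod_pi_mulSingle',
        if_pos (Finset.mem_univ _), ← Units.val_mul, inv_mul_cancel, Units.val_one]
    have h5 := hinv (slOfGL _ hdet) ((isMonomial_diag _).mul (isMonomial_permGL _)) _ h3
    convert W.smul_mem (δ : F) h5 using 1
    ext m
    rw [Pi.smul_apply, Matrix.mulVec_single_one]
    simp only [slOfGL, Matrix.col_apply, diag_mul_apply, permGL_apply, Equiv.swap_apply_left]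
    by_cases hm : m = j
    · subst hm; simp [t]
    · simp [hm]
  refine hW1 (eq_top_iff.2 fun x _ => ?_)
  rw [pi_eq_sum_univ' x]
  exact W.sum_mem fun j _ => W.smul_mem _ (by simpa [Pi.single_apply, eq_comm] using h4 j)

theorem not_isSubspaceSubgroup_stabilizer_stdFrame (hn : 13 ≤ n) [Fintype F]
    (hq : 5 ≤ Fintype.card F) :
    ¬ IsSubspaceSubgroup (MulAction.stabilizer PSL(n, F) (stdFrame n F)) := by
  rintro ⟨-, h⟩
  obtain ⟨W, hW0, hW1, hW⟩ := h _ (isCoatom_stabilizer_stdFrame hn hq) le_rfl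
  exact stabilizer_stdFrame_ne_stabilizer (by omega) hq hW0 hW1 hW

end Stabilizer

/-! ### `PSL(n, F)` is not an alternating group -/

section NotAlternating

theorem two_mul_five_pow_lt_factorial {k : ℕ} (hk : 11 ≤ k) : 2 * 5 ^ k < (k + 1).factorial := by
  induction k, hk using Nat.le_induction with
  | base => decide
  | succ k hk ih =>
    rw [Nat.factorial_succ, pow_succ]
    nlinarith [Nat.factorial_pos (k + 1)]

/-- Legendre's formula turns the divisibility into `m > K`, where `K` is `p - 1` times the exponent
of `p`. Then `m!` is at least `(K + 1)!`, which beats `2 * 5 ^ K`, while `q ^ (n ^ 2) ≤ 5 ^ K`. -/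
theorem pow_lt_of_dvd_factorial {p e n m : ℕ} (hp : p.Prime) (he : e ≠ 0) (hn : 13 ≤ n)
    (hdvd : (p ^ e) ^ (n * (n - 1) / 2) ∣ m.factorial) :
    2 * (p ^ e) ^ n ^ 2 < m.factorial := by
  have : Fact p.Prime := ⟨hp⟩
  set N := n * (n - 1) / 2 with hN
  have hN2 : 2 * N = n * (n - 1) := by
    rw [hN, Nat.mul_div_cancel' (Nat.even_mul_pred_self n).two_dvd]
  obtain ⟨n, rfl⟩ : ∃ k, n = k + 13 := ⟨n - 13, by omega⟩
  rw [show n + 13 - 1 = n + 12 by omega] at hN2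
  have h78 : 78 ≤ N := by nlinarith
  have hp1 : 1 ≤ p - 1 := by have := hp.two_le; omega
  set K := (p - 1) * (e * N) with hK
  have hKm : K < m := by
    have hm0 : m.factorial ≠ 0 := Nat.factorial_ne_zero m
    rw [← pow_mul, padicValNat_dvd_iff_le hm0] at hdvd
    have hne : m ≠ 0 := by
      rintro rfl
      simp at hdvd
      omega
    exact (Nat.mul_le_mul_left _ hdvd).trans_lt
      (sub_one_mul_padicValNat_factorial_lt_of_ne_zero p hne)
  have hK11 : 11 ≤ K := by
    have : N ≤ e * N := Nat.le_mul_of_pos_left _ (Nat.pos_of_ne_zero he)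
    have : e * N ≤ K := Nat.le_mul_of_pos_left _ hp1
    omega
  refine lt_of_le_of_lt ?_ ((two_mul_five_pow_lt_factorial hK11).trans_le
    (Nat.factorial_le hKm))
  refine Nat.mul_le_mul_left 2 ((Nat.pow_le_pow_iff_left (n := 6) (by norm_num)).1 ?_)
  -- Sixth powers avoid the fractional exponent 13/6. The inequality `6 n² ≤ 13 n (n - 1) / 2` holds
  -- from 13 on; then `p ≤ 2 ^ (p - 1)` and `2 ^ 13 ≤ 5 ^ 6` are used.
  calc ((p ^ e) ^ (n + 13) ^ 2) ^ 6 = p ^ (e * (6 * (n + 13) ^ 2)) := by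
        rw [← pow_mul, ← pow_mul]; ring_nf
    _ ≤ p ^ (e * (13 * N)) := Nat.pow_le_pow_right hp.pos (Nat.mul_le_mul_left _ (by nlinarith))
    _ ≤ (2 ^ (p - 1)) ^ (e * (13 * N)) := Nat.pow_le_pow_left (by
        have := (Nat.lt_two_pow_self (n := p - 1)); omega) _
    _ = (2 ^ 13) ^ K := by rw [← pow_mul, ← pow_mul, hK]; ring_nf
    _ ≤ (5 ^ 6) ^ K := Nat.pow_le_pow_left (by norm_num) _
    _ = (5 ^ K) ^ 6 := by rw [← pow_mul, ← pow_mul, mul_comm]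

variable {n : ℕ} {F : Type*} [Field F] [Fintype F]

theorem pow_dvd_card_GL :
    Fintype.card F ^ (n * (n - 1) / 2) ∣ Nat.card (GL (Fin n) F) := by
  rw [Matrix.card_GL_field, ← Finset.sum_range_id, ← Finset.prod_pow_eq_pow_sum,
    ← Fin.prod_univ_eq_prod_range]
  exact Finset.prod_dvd_prod_of_dvd _ _ fun i _ =>
    Nat.dvd_sub (pow_dvd_pow _ i.2.le) dvd_rfl

theorem card_GL_le : Nat.card (GL (Fin n) F) ≤ Fintype.card F ^ n ^ 2 := by
  rw [Matrix.card_GL_field, pow_two, pow_mul]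
  refine (Finset.prod_le_pow_card _ _ _ fun i _ => Nat.sub_le _ _).trans (by simp)

open Matrix in
-- The cofactor is the order of the centre times that of the image of the determinant. Both divide
-- `q - 1`, so the full power of the characteristic in `|GL|` already divides `|PSL|`.
theorem exists_card_GL_eq (hn : n ≠ 0) :
    ∃ a, a.Coprime (Fintype.card F) ∧ 0 < a ∧ Nat.card (GL (Fin n) F) = Nat.card PSL(n, F) * a := by
  classical
  have : NeZero n := ⟨hn⟩
  have hcop : ∀ d, d ∣ Fintype.card F - 1 → d.Coprime (Fintype.card F) := fun d hd => by
    refine Nat.Coprime.coprime_dvd_left hd ?_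
    rw [Nat.coprime_comm]
    exact (Nat.coprime_self_sub_right Fintype.card_pos).2 (Nat.coprime_one_right _)
  have hunits : Nat.card Fˣ = Fintype.card F - 1 := by
    rw [Nat.card_eq_fintype_card, Fintype.card_units]
  have h1 : Nat.card (GL (Fin n) F) =
      Nat.card SL(n, F) * Nat.card (GeneralLinearGroup.det : GL (Fin n) F →* Fˣ).range := by
    have e : SL(n, F) ≃ (GeneralLinearGroup.det : GL (Fin n) F →* Fˣ).ker :=
      { toFun := fun g => ⟨g, Units.ext g.2⟩
        invFun := fun g => ⟨g.1.1, congrArg Units.val g.2⟩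
        left_inv := fun g => rfl
        right_inv := fun g => Subtype.ext (Units.ext rfl) }
    rw [Nat.card_congr e, ← Subgroup.index_ker, Subgroup.card_mul_index]
  have h2 : Nat.card SL(n, F) = Nat.card PSL(n, F) * Nat.card (Subgroup.center SL(n, F)) :=
    Subgroup.card_eq_card_quotient_mul_card_subgroup _
  have h3 : Nat.card (Subgroup.center SL(n, F)) ∣ Fintype.card F - 1 := by
    rw [Nat.card_congr (Matrix.SpecialLinearGroup.center_equiv_rootsOfUnity (n := Fin n)
      (R := F)).toEquiv, ← hunits]
    exact Subgroup.card_subgroup_dvd_card _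
  refine ⟨_ * _, (hcop _ h3).mul_left (hcop _ (hunits ▸ Subgroup.card_subgroup_dvd_card _)), ?_,
    by rw [h1, h2, mul_assoc]⟩
  exact Nat.mul_pos Nat.card_pos Nat.card_pos

theorem isEmpty_mulEquiv_alternatingGroup (hn : 13 ≤ n) {m : ℕ} (hm : 2 ≤ m) :
    IsEmpty (PSL(n, F) ≃* alternatingGroup (Fin m)) := by
  refine ⟨fun e => ?_⟩
  have : Nontrivial (Fin m) := Fin.nontrivial_iff_two_le.2 hm
  obtain ⟨a, hcop, ha, hcard⟩ := exists_card_GL_eq (F := F) (n := n) (by omega)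
  have hA : 2 * Nat.card PSL(n, F) = m.factorial := by
    rw [Nat.card_congr e.toEquiv, two_mul_nat_card_alternatingGroup, Nat.card_perm]
    simp
  obtain ⟨p, k, hp, hk, hpk⟩ := (Fintype.isPrimePow_card_of_field (α := F))
  have hdvd : Fintype.card F ^ (n * (n - 1) / 2) ∣ m.factorial := by
    rw [← hA]
    refine Dvd.dvd.mul_left ?_ 2
    have := pow_dvd_card_GL (n := n) (F := F)
    rw [hcard] at this
    exact (Nat.Coprime.pow_left _ hcop.symm).dvd_of_dvd_mul_right this
  have hle := card_GL_le (n := n) (F := F)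
  have hle' : Nat.card PSL(n, F) ≤ Nat.card (GL (Fin n) F) := hcard ▸ Nat.le_mul_of_pos_right _ ha
  rw [← hpk] at hdvd hle
  have := pow_lt_of_dvd_factorial hp.nat_prime hk.ne' hn hdvd
  omega

end NotAlternating

/-! ### Minimal bases -/

section Bases

variable {G : Type*} [Group G] {Ω : Type*} [MulAction G Ω]

theorem exists_sublist_isMinimalBase {Λ : List Ω} (hΛ : IsBase G Λ) :
    ∃ Λ' : List Ω, Λ'.Sublist Λ ∧ IsMinimalBase G Λ' := by
  induction h : Λ.length using Nat.strong_induction_on generalizing Λ with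
  | _ l ih =>
    by_cases hmin : IsMinimalBase G Λ
    · exact ⟨Λ, List.Sublist.refl _, hmin⟩
    · obtain ⟨Λ', hsub, hne, hbase⟩ : ∃ Λ' : List Ω, Λ'.Sublist Λ ∧ Λ' ≠ Λ ∧ IsBase G Λ' := by
        by_contra! hcon
        exact hmin ⟨hΛ, hcon⟩
      have hlt : Λ'.length < l := by
        rw [← h]
        exact lt_of_le_of_ne hsub.length_le fun h => hne (hsub.eq_of_length h)
      obtain ⟨Λ'', hsub', h'⟩ := ih _ hlt hbase rfl
      exact ⟨Λ'', hsub'.trans hsub, h'⟩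

theorem IsMinimalBase.nodup {Λ : List Ω} (hΛ : IsMinimalBase G Λ) : Λ.Nodup := by
  classical
  by_contra h
  refine hΛ.2 Λ.dedup (List.dedup_sublist Λ) (fun h' => h (List.dedup_eq_self.1 h')) ?_
  have := hΛ.1
  unfold IsBase at this ⊢
  simpa only [List.mem_dedup] using this

/-- A base can be thinned to a minimal one inside it, so a lower bound for all bases within a single
family is enough. -/
theorem le_maxMinimalBaseSize [Finite Ω] {J : Type*} [Finite J] (f : J → Ω) {l : ℕ}
    (hbase : ∀ g : G, (∀ j, g • f j = f j) → g = 1)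
    (hl : ∀ S : Finset J, (∀ g : G, (∀ j ∈ S, g • f j = f j) → g = 1) → l ≤ S.card) :
    l ≤ maxMinimalBaseSize G Ω := by
  classical
  have := Fintype.ofFinite J
  have := Fintype.ofFinite Ω
  have hiff : ∀ L : List J, IsBase G (L.map f) ↔
      ∀ g : G, (∀ j ∈ L.toFinset, g • f j = f j) → g = 1 := fun L => by
    rw [IsBase, Subgroup.eq_bot_iff_forall]
    refine forall_congr' fun g => imp_congr_left ?_
    rw [mem_fixingSubgroup_iff]
    simp
  obtain ⟨Λ, hsub, hΛ⟩ := exists_sublist_isMinimalBase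
    ((hiff Finset.univ.toList).2 fun g hg => hbase g fun j => hg j (by simp))
  obtain ⟨L, hL, rfl⟩ := List.sublist_map_iff.1 hsub
  have h1 := hl _ ((hiff L).1 hΛ.1)
  rw [List.toFinset_card_of_nodup (hL.nodup (Finset.nodup_toList _))] at h1
  -- Minimal bases have no repetitions, so their lengths are bounded and the supremum is not the
  -- default value 0.
  refine h1.trans (le_csSup ⟨Fintype.card Ω, ?_⟩ ⟨_, hΛ, List.length_map _⟩)
  rintro _ ⟨Λ, hΛ, rfl⟩
  exact hΛ.nodup.length_le_card

end Bases

/-! ### Decompositions built on a simplex -/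

section SimplexFrames

variable {F : Type*} [Field F] {k r : ℕ}

theorem mk_smul_lineFrame_eq_of_forall_mem {n : ℕ} (g : SL(n, F)) {v : Fin n → Fin n → F}
    (hv : LinearIndependent F v)
    (h : ∀ W ∈ lineFrame v, (QuotientGroup.mk g : PSL(n, F)) • W ∈ lineFrame v) :
    (QuotientGroup.mk g : PSL(n, F)) • lineFrame v = lineFrame v := by
  refine (mk_smul_lineFrame_eq_iff g hv).2 fun i => ?_
  obtain ⟨j, hj⟩ := h _ ⟨i, rfl⟩
  rw [mk_smul_span_singleton] at hj
  exact ⟨j, (show F ∙ v j = _ from hj) ▸ Submodule.mem_span_singleton_self _⟩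

/-- The first `k` coordinate vectors and minus their sum. -/
def simplexVec (F : Type*) [Field F] (k r : ℕ) : Fin (k + 1) → Fin (k + r) → F :=
  Fin.snoc (fun a => Pi.single (Fin.castAdd r a) 1) (-∑ a, Pi.single (Fin.castAdd r a) 1)

/-- The coordinate vectors other than the first `k`. -/
def tailVec (F : Type*) [Field F] (k r : ℕ) (s : Fin r) : Fin (k + r) → F :=
  Pi.single (Fin.natAdd k s) 1

theorem simplexVec_castSucc (a : Fin k) :
    simplexVec F k r a.castSucc = Pi.single (Fin.castAdd r a) 1 := Fin.snoc_castSucc ..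

theorem sum_simplexVec : ∑ j, simplexVec F k r j = 0 := by
  simp [Fin.sum_univ_castSucc, simplexVec]

theorem simplexVec_natAdd (j : Fin (k + 1)) (s : Fin r) :
    simplexVec F k r j (Fin.natAdd k s) = 0 := by
  have h : ∀ a : Fin k, Fin.natAdd k s ≠ Fin.castAdd r a := fun a h => by
    have := congrArg Fin.val h
    simp at this
    omega
  refine Fin.lastCases ?_ (fun a => ?_) j
  · simp [simplexVec, Finset.sum_apply, h]
  · simp [simplexVec_castSucc, h]

theorem tailVec_natAdd (s t : Fin r) :
    tailVec F k r s (Fin.natAdd k t) = if t = s then 1 else 0 := by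
  simp [tailVec, Pi.single_apply]

theorem eq_top_of_simplexVec_mem {P : Submodule F (Fin (k + r) → F)}
    (hu : ∀ j, simplexVec F k r j ∈ P) (he : ∀ s, tailVec F k r s ∈ P) : ⊤ ≤ P := by
  intro x _
  rw [pi_eq_sum_univ' x]
  refine P.sum_mem fun i _ => P.smul_mem _ ?_
  have : (Pi.single i 1 : Fin (k + r) → F) ∈ P := by
    refine Fin.addCases (fun a => ?_) (fun s => he s) i
    rw [← simplexVec_castSucc]
    exact hu _
  simpa [Pi.single_apply, eq_comm] using this

/-- The vectors of the simplex other than the `i`-th one, and the tail vectors. -/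
def facetVec (F : Type*) [Field F] {k r : ℕ} (i : Fin (k + 1)) : Fin (k + r) → Fin (k + r) → F :=
  Fin.append (fun a => simplexVec F k r (i.succAbove a)) (tailVec F k r)

/-- The vectors of the simplex translated by the `s`-th tail vector, and the other tail vectors. -/
def coneVec (F : Type*) [Field F] {k r : ℕ} (s : Fin r) : Fin (k + r) → Fin (k + r) → F :=
  Fin.append (fun a => simplexVec F k r a.castSucc + tailVec F k r s)
    fun t => if t = s then simplexVec F k r (Fin.last k) + tailVec F k r s else tailVec F k r t

theorem linearIndependent_facetVec (i : Fin (k + 1)) :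
    LinearIndependent F (facetVec F (r := r) i) := by
  refine linearIndependent_of_top_le_span_of_card_eq_finrank ?_ (by simp)
  have he : ∀ s, tailVec F k r s ∈ Submodule.span F (Set.range (facetVec F (r := r) i)) :=
    fun s => Submodule.subset_span ⟨Fin.natAdd k s, Fin.append_right ..⟩
  have hu : ∀ a, simplexVec F k r (i.succAbove a) ∈
      Submodule.span F (Set.range (facetVec F (r := r) i)) :=
    fun a => Submodule.subset_span ⟨Fin.castAdd r a, Fin.append_left ..⟩
  refine eq_top_of_simplexVec_mem (fun j => ?_) he
  by_cases hj : j = i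
  · subst hj
    have := sum_simplexVec (F := F) (k := k) (r := r)
    rw [Fin.sum_univ_succAbove _ j, add_eq_zero_iff_eq_neg] at this
    rw [this]
    exact Submodule.neg_mem _ (Submodule.sum_mem _ fun a _ => hu a)
  · obtain ⟨a, rfl⟩ := Fin.exists_succAbove_eq hj
    exact hu a

/-- The simplex vectors sum to zero, so the translated ones sum to `k + 1` times the tail vector.
This recovers the tail vector exactly because `k + 1` is invertible. -/
theorem linearIndependent_coneVec (hk : ((k + 1 : ℕ) : F) ≠ 0) (s : Fin r) :
    LinearIndependent F (coneVec F (k := k) s) := by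
  refine linearIndependent_of_top_le_span_of_card_eq_finrank ?_ (by simp)
  set P := Submodule.span F (Set.range (coneVec F (k := k) s)) with hP
  have hu : ∀ j, simplexVec F k r j + tailVec F k r s ∈ P := by
    refine fun j => Fin.lastCases ?_ (fun a => ?_) j
    · exact Submodule.subset_span ⟨Fin.natAdd k s, by simp [coneVec]⟩
    · exact Submodule.subset_span ⟨Fin.castAdd r a, by simp [coneVec]⟩
  have hs : tailVec F k r s ∈ P := by
    have h1 := P.sum_mem fun (j : Fin (k + 1)) (_ : j ∈ Finset.univ) => hu j
    rw [Finset.sum_add_distrib, sum_simplexVec, zero_add, Finset.sum_const, Finset.card_univ,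
      Fintype.card_fin, ← Nat.cast_smul_eq_nsmul F] at h1
    exact (Submodule.smul_mem_iff _ hk).1 h1
  refine eq_top_of_simplexVec_mem (fun j => ?_) fun t => ?_
  · exact (Submodule.add_mem_iff_left P hs).1 (hu j)
  · by_cases ht : t = s
    · rwa [ht]
    · exact Submodule.subset_span ⟨Fin.natAdd k t, by simp [coneVec, ht]⟩

theorem mem_lineFrame_facetVec_iff {i : Fin (k + 1)} {W : Submodule F (Fin (k + r) → F)} :
    W ∈ lineFrame (facetVec F i) ↔
      (∃ j ≠ i, W = F ∙ simplexVec F k r j) ∨ ∃ s, W = F ∙ tailVec F k r s := by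
  constructor
  · rintro ⟨m, rfl⟩
    refine Fin.addCases (fun a => Or.inl ⟨i.succAbove a, Fin.succAbove_ne i a, ?_⟩)
      (fun s => Or.inr ⟨s, ?_⟩) m
    · simp [facetVec]
    · simp [facetVec]
  · rintro (⟨j, hj, rfl⟩ | ⟨s, rfl⟩)
    · obtain ⟨a, rfl⟩ := Fin.exists_succAbove_eq hj
      exact ⟨Fin.castAdd r a, by simp [facetVec]⟩
    · exact ⟨Fin.natAdd k s, by simp [facetVec]⟩

theorem mem_lineFrame_coneVec_iff {s : Fin r} {W : Submodule F (Fin (k + r) → F)} :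
    W ∈ lineFrame (coneVec F s) ↔
      (∃ j, W = F ∙ (simplexVec F k r j + tailVec F k r s)) ∨
        ∃ t ≠ s, W = F ∙ tailVec F k r t := by
  constructor
  · rintro ⟨m, rfl⟩
    refine Fin.addCases (fun a => Or.inl ⟨a.castSucc, ?_⟩) (fun t => ?_) m
    · simp [coneVec]
    · by_cases ht : t = s
      · exact Or.inl ⟨Fin.last k, by simp [coneVec, ht]⟩
      · exact Or.inr ⟨t, ht, by simp [coneVec, ht]⟩
  · rintro (⟨j, rfl⟩ | ⟨t, ht, rfl⟩)
    · refine Fin.lastCases ⟨Fin.natAdd k s, ?_⟩ (fun a => ⟨Fin.castAdd r a, ?_⟩) j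
      · simp [coneVec]
      · simp [coneVec]
    · exact ⟨Fin.natAdd k t, by simp [coneVec, ht]⟩

/-- The line decomposition given by `facetVec`. -/
def facetFrame (F : Type*) [Field F] {k : ℕ} (r : ℕ) (i : Fin (k + 1)) :
    LineDecompositions (k + r) F :=
  ⟨lineFrame (facetVec F i), isLineDecomposition_lineFrame (linearIndependent_facetVec i)⟩

/-- The line decomposition given by `coneVec`. -/
def coneFrame {k r : ℕ} (hk : ((k + 1 : ℕ) : F) ≠ 0) (s : Fin r) :
    LineDecompositions (k + r) F :=
  ⟨lineFrame (coneVec F s), isLineDecomposition_lineFrame (linearIndependent_coneVec hk s)⟩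

end SimplexFrames

/-! ### Elements that fix the simplex decompositions -/

section FixedFrames

variable {F : Type*} [Field F] {k r : ℕ}

theorem tailVec_ne_zero (s : Fin r) : tailVec F k r s ≠ 0 := fun h => by
  have := congrFun h (Fin.natAdd k s)
  simp [tailVec_natAdd] at this

theorem simplexVec_span_injective (hk : 2 ≤ k) :
    Function.Injective fun j => F ∙ simplexVec F k r j := by
  intro j l h
  by_contra hjl
  obtain ⟨m, hm⟩ : ∃ m, m ∉ ({j, l} : Finset (Fin (k + 1))) := by
    by_contra! hcon
    have h1 := Finset.card_le_two (a := j) (b := l)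
    rw [Finset.eq_univ_iff_forall.2 hcon, Finset.card_univ, Fintype.card_fin] at h1
    omega
  simp only [Finset.mem_insert, Finset.mem_singleton, not_or] at hm
  obtain ⟨a, rfl⟩ := Fin.exists_succAbove_eq (Ne.symm hm.1)
  obtain ⟨b, rfl⟩ := Fin.exists_succAbove_eq (Ne.symm hm.2)
  have hli := linearIndependent_facetVec (F := F) (r := r) m
  have := hli.iSupIndep_span_singleton.injective
    (fun i h => hli.ne_zero i (Submodule.span_singleton_eq_bot.1 h))
    (a₁ := Fin.castAdd r a) (a₂ := Fin.castAdd r b) (by simpa [facetVec] using h)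
  exact hjl (by rw [Fin.castAdd_injective k r this])

theorem simplexVec_ne_zero (hk : 1 ≤ k) (j : Fin (k + 1)) : simplexVec F k r j ≠ 0 := by
  have : Nontrivial (Fin (k + 1)) := Fin.nontrivial_iff_two_le.2 (by omega)
  obtain ⟨m, hm⟩ := exists_ne j
  obtain ⟨a, rfl⟩ := Fin.exists_succAbove_eq hm.symm
  simpa [facetVec] using (linearIndependent_facetVec (F := F) (r := r) m).ne_zero (Fin.castAdd r a)

theorem span_tailVec_ne_span_simplexVec (s : Fin r) (j : Fin (k + 1)) :
    F ∙ tailVec F k r s ≠ F ∙ simplexVec F k r j := fun h => by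
  obtain ⟨c, hc⟩ := Submodule.mem_span_singleton.1 (h ▸ Submodule.mem_span_singleton_self _)
  have := congrFun hc (Fin.natAdd k s)
  simp [tailVec_natAdd, simplexVec_natAdd] at this

theorem span_tailVec_injective : Function.Injective fun s => F ∙ tailVec F k r s := by
  intro s t h
  obtain ⟨c, hc⟩ := Submodule.mem_span_singleton.1
    (show tailVec F k r s ∈ F ∙ tailVec F k r t from
      (show F ∙ tailVec F k r s = F ∙ tailVec F k r t from h) ▸ Submodule.mem_span_singleton_self _)
  have := congrFun hc (Fin.natAdd k s)
  by_contra hst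
  simp [tailVec_natAdd, hst] at this

theorem span_tailVec_notMem_coneVec (hk : 1 ≤ k) (s : Fin r) :
    F ∙ tailVec F k r s ∉ lineFrame (coneVec F (k := k) s) := by
  rw [mem_lineFrame_coneVec_iff]
  rintro (⟨j, h⟩ | ⟨t, ht, h⟩)
  · obtain ⟨c, hc⟩ := Submodule.mem_span_singleton.1
      (h ▸ Submodule.mem_span_singleton_self (R := F) (tailVec F k r s))
    have h1 := congrFun hc (Fin.natAdd k s)
    simp [tailVec_natAdd, simplexVec_natAdd] at h1
    rw [h1, one_smul, add_eq_right] at hc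
    exact simplexVec_ne_zero hk j hc
  · exact ht (span_tailVec_injective h).symm

theorem smul_mem_iff_of_smul_eq {G Ω : Type*} [Group G] [MulAction G Ω] {g : G} {D : Set Ω}
    (h : g • D = D) {W : Ω} : g • W ∈ D ↔ W ∈ D := by
  conv_lhs => rw [← h]
  exact Set.smul_mem_smul_set_iff

/-- The line of the `j`-th simplex vector lies in every facet frame but the `j`-th, and no other
line of these frames has this property. -/
theorem smul_span_simplexVec_eq (hk : 2 ≤ k) {g : PSL(k + r, F)}
    (hg : ∀ i : Fin (k + 1), g • facetFrame F r i = facetFrame F r i) (j : Fin (k + 1)) :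
    g • (F ∙ simplexVec F k r j) = F ∙ simplexVec F k r j := by
  have hg' : ∀ i : Fin (k + 1), g • lineFrame (facetVec F (r := r) i) = lineFrame (facetVec F i) :=
    fun i => congrArg Subtype.val (hg i)
  have : Nontrivial (Fin (k + 1)) := Fin.nontrivial_iff_two_le.2 (by omega)
  obtain ⟨i, hij⟩ := exists_ne j
  have h1 := (smul_mem_iff_of_smul_eq (hg' i)).2
    (mem_lineFrame_facetVec_iff.2 (Or.inl ⟨j, hij.symm, rfl⟩))
  have h2 : g • (F ∙ simplexVec F k r j) ∉ lineFrame (facetVec F j) := by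
    rw [smul_mem_iff_of_smul_eq (hg' j), mem_lineFrame_facetVec_iff]
    rintro (⟨l, hl, h⟩ | ⟨s, h⟩)
    · exact hl (simplexVec_span_injective hk h).symm
    · exact span_tailVec_ne_span_simplexVec _ _ h.symm
  rw [mem_lineFrame_facetVec_iff] at h1 h2
  push Not at h2
  obtain ⟨l, -, h⟩ | ⟨s, h⟩ := h1
  · by_cases hlj : l = j
    · rw [h, hlj]
    · exact absurd h (h2.1 l hlj)
  · exact absurd h (h2.2 s)

theorem exists_smul_span_tailVec_eq (hk : 2 ≤ k) {g : PSL(k + r, F)}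
    (hg : ∀ i : Fin (k + 1), g • facetFrame F r i = facetFrame F r i) (s : Fin r) :
    ∃ t, g • (F ∙ tailVec F k r s) = F ∙ tailVec F k r t := by
  have h1 := (smul_mem_iff_of_smul_eq (congrArg Subtype.val (hg 0) :
      g • lineFrame (facetVec F 0) = lineFrame (facetVec F 0))).2
    (mem_lineFrame_facetVec_iff.2 (Or.inr ⟨s, rfl⟩))
  obtain ⟨l, -, h⟩ | ⟨t, h⟩ := mem_lineFrame_facetVec_iff.1 h1
  · rw [← smul_span_simplexVec_eq hk hg l] at h
    exact absurd (smul_left_cancel _ h) (span_tailVec_ne_span_simplexVec _ _)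
  · exact ⟨t, h⟩

theorem smul_span_tailVec_eq (hk : 2 ≤ k) {g : PSL(k + r, F)}
    (hg : ∀ i : Fin (k + 1), g • facetFrame F r i = facetFrame F r i)
    (hk1 : ((k + 1 : ℕ) : F) ≠ 0) {s : Fin r} (hs : g • coneFrame hk1 s = coneFrame hk1 s) :
    g • (F ∙ tailVec F k r s) = F ∙ tailVec F k r s := by
  obtain ⟨t, ht⟩ := exists_smul_span_tailVec_eq hk hg s
  by_cases hts : t = s
  · rw [ht, hts]
  · refine absurd ((smul_mem_iff_of_smul_eq (congrArg Subtype.val hs :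
      g • lineFrame (coneVec F s) = lineFrame (coneVec F s))).1 ?_)
      (span_tailVec_notMem_coneVec (by omega) s)
    rw [ht]
    exact mem_lineFrame_coneVec_iff.2 (Or.inr ⟨t, hts, rfl⟩)

theorem smul_span_tailVec_eq_of_forall_ne (hk : 2 ≤ k) {g : PSL(k + r, F)}
    (hg : ∀ i : Fin (k + 1), g • facetFrame F r i = facetFrame F r i) {z : Fin r}
    (hz : ∀ s ≠ z, g • (F ∙ tailVec F k r s) = F ∙ tailVec F k r s) :
    g • (F ∙ tailVec F k r z) = F ∙ tailVec F k r z := by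
  obtain ⟨t, ht⟩ := exists_smul_span_tailVec_eq hk hg z
  by_cases htz : t = z
  · rw [ht, htz]
  · rw [← hz t htz] at ht
    exact absurd (span_tailVec_injective (smul_left_cancel _ ht)).symm htz

theorem exists_mulVec_eq_smul {n : ℕ} {g : SL(n, F)} {v : Fin n → F}
    (hv : (QuotientGroup.mk g : PSL(n, F)) • (F ∙ v) = F ∙ v) : ∃ c : F, g.1.mulVec v = c • v := by
  rw [mk_smul_span_singleton] at hv
  obtain ⟨c, hc⟩ := Submodule.mem_span_singleton.1 (hv ▸ Submodule.mem_span_singleton_self _)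
  exact ⟨c, hc.symm⟩

theorem mulVec_ne_zero {n : ℕ} (g : SL(n, F)) {v : Fin n → F} (hv : v ≠ 0) :
    g.1.mulVec v ≠ 0 := fun h => hv <| by
  have h1 : (g⁻¹).1.mulVec (g.1.mulVec v) = v := by
    rw [Matrix.mulVec_mulVec]
    have : (g⁻¹).1 * g.1 = 1 := congrArg Subtype.val (inv_mul_cancel g)
    rw [this, Matrix.one_mulVec]
  rw [← h1, h, Matrix.mulVec_zero]

/-- Up to a scalar, the only linear relation among the simplex vectors is that their sum is zero, so
their eigenvalues coincide. -/
theorem exists_mulVec_simplexVec_eq_smul (hk : 2 ≤ k) {g : SL(k + r, F)}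
    (hg : ∀ i : Fin (k + 1),
      (QuotientGroup.mk g : PSL(k + r, F)) • facetFrame F r i = facetFrame F r i) :
    ∃ c : F, ∀ j, g.1.mulVec (simplexVec F k r j) = c • simplexVec F k r j := by
  choose c hc using fun j => exists_mulVec_eq_smul (smul_span_simplexVec_eq hk hg j)
  have hsum : ∑ j, c j • simplexVec F k r j = 0 := by
    simp only [← hc]
    rw [← Matrix.mulVec_sum, sum_simplexVec, Matrix.mulVec_zero]
  refine ⟨c (Fin.last k), fun j => ?_⟩
  refine Fin.lastCases (hc _) (fun a => ?_) j
  have h1 := congrFun hsum (Fin.castAdd r a)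
  rw [Fin.sum_univ_castSucc] at h1
  simp only [simplexVec_castSucc] at h1
  simp [simplexVec, Finset.sum_apply, Pi.single_apply] at h1
  rw [hc, add_neg_eq_zero.1 h1]

/-- The image `c u + d e` of a cone vector `u + e` must again span a line of the cone frame. Its
component along `e` rules out the tail lines, and comparison with a cone vector gives `d = c`. -/
theorem eq_of_smul_coneFrame_eq (hk : 2 ≤ k) (hk1 : ((k + 1 : ℕ) : F) ≠ 0) {g : SL(k + r, F)}
    {c d : F} (hc : ∀ j, g.1.mulVec (simplexVec F k r j) = c • simplexVec F k r j)
    {s : Fin r} (hd : g.1.mulVec (tailVec F k r s) = d • tailVec F k r s)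
    (hs : (QuotientGroup.mk g : PSL(k + r, F)) • coneFrame hk1 s = coneFrame hk1 s) : d = c := by
  have hc0 : c ≠ 0 := fun h => mulVec_ne_zero g (simplexVec_ne_zero (by omega) 0)
    (by rw [hc 0, h, zero_smul])
  have hd0 : d ≠ 0 := fun h => mulVec_ne_zero g (tailVec_ne_zero s) (by rw [hd, h, zero_smul])
  have h1 := (smul_mem_iff_of_smul_eq (congrArg Subtype.val hs :
      (QuotientGroup.mk g : PSL(k + r, F)) • lineFrame (coneVec F s) = lineFrame (coneVec F s))).2
    (mem_lineFrame_coneVec_iff.2 (Or.inl ⟨0, rfl⟩))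
  rw [mk_smul_span_singleton, Matrix.mulVec_add, hc, hd] at h1
  obtain ⟨l, h⟩ | ⟨t, ht, h⟩ := mem_lineFrame_coneVec_iff.1 h1
  · obtain ⟨a, ha⟩ := Submodule.mem_span_singleton.1
      (h ▸ Submodule.mem_span_singleton_self (R := F) _)
    have h2 := congrFun ha (Fin.natAdd k s)
    simp [tailVec_natAdd, simplexVec_natAdd] at h2
    rw [h2, smul_add, add_left_inj] at ha
    by_cases hl : l = 0
    · rw [hl] at ha
      exact smul_left_injective F (simplexVec_ne_zero (by omega) 0) ha
    · refine absurd (simplexVec_span_injective (F := F) (r := r) hk ?_) hl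
      change F ∙ simplexVec F k r l = F ∙ simplexVec F k r 0
      rw [← Submodule.span_singleton_smul_eq (IsUnit.mk0 d hd0), ha,
        Submodule.span_singleton_smul_eq (IsUnit.mk0 c hc0)]
  · obtain ⟨a, ha⟩ := Submodule.mem_span_singleton.1
      (h ▸ Submodule.mem_span_singleton_self (R := F) _)
    have h2 := congrFun ha (Fin.natAdd k s)
    simp [tailVec_natAdd, simplexVec_natAdd, ht.symm] at h2
    exact absurd h2.symm hd0

/-- All tail vectors except possibly `z` have the eigenvalue `c` of the simplex. At `z` either the
cone gives this too, or the determinant `c ^ n * (d / c) = 1` with `c ^ n = 1` does. -/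
theorem eq_one_of_smul_eq (hk : 2 ≤ k) (hk1 : ((k + 1 : ℕ) : F) ≠ 0) {g : PSL(k + r, F)}
    {R : Set (Fin r)} {z : Fin r} (hR : ∀ s ≠ z, s ∈ R)
    (hz : z ∈ R ∨ ∀ b : Fˣ, b ^ (k + r) = 1)
    (hg : ∀ i : Fin (k + 1), g • facetFrame F r i = facetFrame F r i)
    (hgR : ∀ s ∈ R, g • coneFrame hk1 s = coneFrame hk1 s) : g = 1 := by
  obtain ⟨g, rfl⟩ := QuotientGroup.mk_surjective g
  obtain ⟨c, hc⟩ := exists_mulVec_simplexVec_eq_smul hk hg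
  have hline := fun s (hs : s ≠ z) => smul_span_tailVec_eq hk hg hk1 (hgR s (hR s hs))
  have htail : ∀ s ≠ z, g.1.mulVec (tailVec F k r s) = c • tailVec F k r s := fun s hs => by
    obtain ⟨d, hd⟩ := exists_mulVec_eq_smul (hline s hs)
    rw [hd, eq_of_smul_coneFrame_eq hk hk1 hc hd (hgR s (hR s hs))]
  obtain ⟨d, hd⟩ := exists_mulVec_eq_smul (smul_span_tailVec_eq_of_forall_ne hk hg hline)
  have hc0 : c ≠ 0 := fun h => mulVec_ne_zero g (simplexVec_ne_zero (by omega) 0)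
    (by rw [hc 0, h, zero_smul])
  have hcol : ∀ i, g.1.col i =
      (c * if i = Fin.natAdd k z then d / c else 1) • (Pi.single i 1 : Fin (k + r) → F) := by
    intro i
    rw [← Matrix.mulVec_single_one]
    refine Fin.addCases (fun a => ?_) (fun s => ?_) i
    · have hne : Fin.castAdd r a ≠ Fin.natAdd k z := fun h => by
        have := congrArg Fin.val h
        simp at this
        omega
      rw [if_neg hne, mul_one, ← simplexVec_castSucc, hc]
    · by_cases hs : s = z
      · rw [hs, if_pos rfl, mul_div_cancel₀ _ hc0]
        exact hd
      · rw [if_neg (by simpa using hs), mul_one]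
        exact htail s hs
  have hgdiag : g.1 = Matrix.diagonal fun i => c * if i = Fin.natAdd k z then d / c else 1 := by
    ext i j
    have := congrFun (hcol j) i
    rw [Matrix.col_apply] at this
    rw [this, Matrix.diagonal_apply]
    by_cases hij : i = j
    · simp [hij]
    · simp [hij]
  have hdet : c ^ (k + r) * (d / c) = 1 := by
    have := g.2
    rw [hgdiag, Matrix.det_diagonal, Finset.prod_mul_distrib, Finset.prod_ite_eq'] at this
    simpa using this
  have hdc : d / c = 1 := by
    rcases hz with hz | hz
    · rw [eq_of_smul_coneFrame_eq hk hk1 hc hd (hgR z hz), div_self hc0]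
    · have := congrArg Units.val (hz (Units.mk0 c hc0))
      rw [Units.val_pow_eq_pow_val, Units.val_mk0, Units.val_one] at this
      rwa [this, one_mul] at hdet
  rw [hdc, mul_one] at hdet
  refine Eq.symm ((mk_eq_mk_iff g 1).2 ⟨c, hdet, ?_⟩)
  rw [hgdiag, hdc, Matrix.SpecialLinearGroup.coe_one, Matrix.smul_one_eq_diagonal]
  simp

end FixedFrames

/-! ### Matrices that permute a simplex -/

section SimplexMatrix

variable {F : Type*} [Field F] {k r : ℕ}

/-- The matrix that permutes the simplex vectors by `σ`, up to the scalar `y`, and multiplies the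
tail vectors by the scalars `t`. -/
def simplexMatrix (σ : Equiv.Perm (Fin (k + 1))) (y : F) (t : Fin r → F) :
    Matrix (Fin (k + r)) (Fin (k + r)) F :=
  (Matrix.of (Fin.append (fun a => y • simplexVec F k r (σ a.castSucc))
    fun s => t s • tailVec F k r s)).transpose

theorem simplexMatrix_mulVec_tailVec (σ : Equiv.Perm (Fin (k + 1))) (y : F) (t : Fin r → F)
    (s : Fin r) : (simplexMatrix σ y t).mulVec (tailVec F k r s) = t s • tailVec F k r s := by
  ext i
  rw [tailVec, Matrix.mulVec_single_one]
  simp [simplexMatrix, tailVec]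

theorem simplexMatrix_mulVec_simplexVec (σ : Equiv.Perm (Fin (k + 1))) (y : F) (t : Fin r → F)
    (j : Fin (k + 1)) :
    (simplexMatrix σ y t).mulVec (simplexVec F k r j) = y • simplexVec F k r (σ j) := by
  have hcast : ∀ a : Fin k, (simplexMatrix σ y t).mulVec (simplexVec F k r a.castSucc) =
      y • simplexVec F k r (σ a.castSucc) := fun a => by
    ext i
    rw [simplexVec_castSucc, Matrix.mulVec_single_one]
    simp [simplexMatrix]
  refine Fin.lastCases ?_ hcast j
  have h1 := sum_simplexVec (F := F) (k := k) (r := r)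
  rw [Fin.sum_univ_castSucc, add_eq_zero_iff_neg_eq] at h1
  have h2 := (Equiv.sum_comp σ (simplexVec F k r)).trans sum_simplexVec
  rw [Fin.sum_univ_castSucc, add_eq_zero_iff_neg_eq] at h2
  rw [← h1, ← h2, Matrix.mulVec_neg, Matrix.mulVec_sum]
  simp only [hcast]
  rw [← Finset.smul_sum, smul_neg]

theorem simplexMatrix_mul (σ τ : Equiv.Perm (Fin (k + 1))) (y y' : F) (t t' : Fin r → F) :
    simplexMatrix σ y t * simplexMatrix τ y' t' = simplexMatrix (σ * τ) (y * y') (t * t') := by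
  refine Matrix.ext_of_mulVec_single fun i => ?_
  rw [← Matrix.mulVec_mulVec]
  refine Fin.addCases (fun a => ?_) (fun s => ?_) i
  · rw [← simplexVec_castSucc]
    simp only [simplexMatrix_mulVec_simplexVec, Matrix.mulVec_smul, smul_smul]
    rw [mul_comm y', Equiv.Perm.mul_apply]
  · change (simplexMatrix σ y t).mulVec ((simplexMatrix τ y' t').mulVec (tailVec F k r s)) =
      (simplexMatrix (σ * τ) (y * y') (t * t')).mulVec (tailVec F k r s)
    simp only [simplexMatrix_mulVec_tailVec, Matrix.mulVec_smul, smul_smul]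
    rw [mul_comm (t' s), Pi.mul_apply]

theorem det_simplexMatrix_one (y : F) (t : Fin r → F) :
    (simplexMatrix (1 : Equiv.Perm (Fin (k + 1))) y t).det = y ^ k * ∏ s, t s := by
  have : simplexMatrix (1 : Equiv.Perm (Fin (k + 1))) y t =
      Matrix.diagonal (Fin.append (fun _ : Fin k => y) t) := by
    refine Matrix.ext_of_mulVec_single fun i => ?_
    rw [Matrix.diagonal_mulVec_single]
    refine Fin.addCases (fun a => ?_) (fun s => ?_) i
    · rw [← simplexVec_castSucc, simplexMatrix_mulVec_simplexVec]
      simp [simplexVec_castSucc, ← Pi.single_smul]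
    · rw [Fin.append_right]
      refine (simplexMatrix_mulVec_tailVec _ _ _ _).trans ?_
      simp [tailVec, ← Pi.single_smul]
  rw [this, Matrix.det_diagonal, Fin.prod_univ_add]
  simp

theorem det_simplexMatrix_mul_self {σ : Equiv.Perm (Fin (k + 1))} (hσ : σ * σ = 1) :
    (simplexMatrix (r := r) σ (1 : F) 1).det * (simplexMatrix (r := r) σ (1 : F) 1).det = 1 := by
  rw [← Matrix.det_mul, simplexMatrix_mul, hσ, det_simplexMatrix_one]
  simp

theorem det_simplexMatrix_one_right (σ : Equiv.Perm (Fin (k + 1))) (t : Fin r → F) :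
    (simplexMatrix σ (1 : F) t).det = (simplexMatrix (r := r) σ (1 : F) 1).det * ∏ s, t s := by
  have h := simplexMatrix_mul σ 1 (1 : F) 1 1 t
  rw [mul_one, mul_one, one_mul] at h
  rw [← h, Matrix.det_mul, det_simplexMatrix_one, one_pow, one_mul]

theorem det_simplexMatrix_mul_sq {σ τ : Equiv.Perm (Fin (k + 1))} (hσ : σ * σ = 1)
    (hτ : τ * τ = 1) : (simplexMatrix (r := r) (σ * τ * (σ * τ)) (1 : F) 1).det = 1 := by
  have h := simplexMatrix_mul (r := r) σ τ (1 : F) 1 1 1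
  have h' := simplexMatrix_mul (r := r) (σ * τ) (σ * τ) (1 : F) 1 1 1
  rw [mul_one, mul_one] at h h'
  rw [← h', ← h, Matrix.det_mul, Matrix.det_mul, mul_mul_mul_comm, det_simplexMatrix_mul_self hσ,
    det_simplexMatrix_mul_self hτ, one_mul]

/-- If the pointwise stabilizer of some facet and cone decompositions is trivial, then a simplex
matrix that fixes them is scalar. -/
theorem eq_one_of_det_simplexMatrix (hk : 2 ≤ k) (hk1 : ((k + 1 : ℕ) : F) ≠ 0)
    {A : Set (Fin (k + 1))} {B : Set (Fin r)}
    (hAB : ∀ g : PSL(k + r, F), (∀ i ∈ A, g • facetFrame F r i = facetFrame F r i) →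
      (∀ s ∈ B, g • coneFrame hk1 s = coneFrame hk1 s) → g = 1)
    {σ : Equiv.Perm (Fin (k + 1))} {y : F} {t : Fin r → F} (hdet : (simplexMatrix σ y t).det = 1)
    (hσ : ∀ i ∈ A, σ i = i) (ht : ∀ s ∈ B, t s = y) : σ = 1 ∧ ∀ s, t s = y := by
  set g : SL(k + r, F) := ⟨simplexMatrix σ y t, hdet⟩ with hg
  have hgu : ∀ j, g.1.mulVec (simplexVec F k r j) = y • simplexVec F k r (σ j) :=
    simplexMatrix_mulVec_simplexVec σ y t
  have hge : ∀ s, g.1.mulVec (tailVec F k r s) = t s • tailVec F k r s :=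
    simplexMatrix_mulVec_tailVec σ y t
  have hy : y ≠ 0 := fun h => mulVec_ne_zero g (simplexVec_ne_zero (by omega) 0)
    (by rw [hgu 0, h, zero_smul])
  have ht0 : ∀ s, t s ≠ 0 := fun s h => mulVec_ne_zero g (tailVec_ne_zero s)
    (by rw [hge, h, zero_smul])
  have hlineu : ∀ j, (QuotientGroup.mk g : PSL(k + r, F)) • (F ∙ simplexVec F k r j) =
      F ∙ simplexVec F k r (σ j) := fun j => by
    rw [mk_smul_span_singleton, hgu, Submodule.span_singleton_smul_eq (IsUnit.mk0 y hy)]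
  have hlinee : ∀ s, (QuotientGroup.mk g : PSL(k + r, F)) • (F ∙ tailVec F k r s) =
      F ∙ tailVec F k r s := fun s => by
    rw [mk_smul_span_singleton, hge, Submodule.span_singleton_smul_eq (IsUnit.mk0 _ (ht0 s))]
  have h1 : (QuotientGroup.mk g : PSL(k + r, F)) = 1 := by
    refine hAB _ (fun i hi => Subtype.ext ?_) fun s hs => Subtype.ext ?_
    · refine mk_smul_lineFrame_eq_of_forall_mem g (linearIndependent_facetVec i) fun W hW => ?_
      rw [mem_lineFrame_facetVec_iff] at hW ⊢
      obtain ⟨j, hj, rfl⟩ | ⟨s, rfl⟩ := hW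
      · exact Or.inl ⟨σ j, fun h => hj (σ.injective (h.trans (hσ i hi).symm)), hlineu j⟩
      · exact Or.inr ⟨s, hlinee s⟩
    · refine mk_smul_lineFrame_eq_of_forall_mem g (linearIndependent_coneVec hk1 s) fun W hW => ?_
      rw [mem_lineFrame_coneVec_iff] at hW ⊢
      obtain ⟨j, rfl⟩ | ⟨t, hts, rfl⟩ := hW
      · refine Or.inl ⟨σ j, ?_⟩
        rw [mk_smul_span_singleton, Matrix.mulVec_add, hgu, hge, ht s hs, ← smul_add,
          Submodule.span_singleton_smul_eq (IsUnit.mk0 y hy)]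
      · exact Or.inr ⟨t, hts, hlinee t⟩
  obtain ⟨c, -, hc⟩ := (mk_eq_mk_iff g 1).1 h1.symm
  have hgc : ∀ v, g.1.mulVec v = c • v := fun v => by
    rw [hc, Matrix.SpecialLinearGroup.coe_one, Matrix.smul_mulVec, Matrix.one_mulVec]
  have hσ1 : σ = 1 := by
    ext1 j
    refine simplexVec_span_injective (F := F) (r := r) hk ?_
    change F ∙ simplexVec F k r (σ j) = F ∙ simplexVec F k r j
    rw [← hlineu j, h1, one_smul]
  refine ⟨hσ1, fun s => ?_⟩
  have h2 : c = t s := smul_left_injective F (tailVec_ne_zero (k := k) s)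
    ((hgc _).symm.trans (hge s))
  have h3 : c = y := smul_left_injective F (simplexVec_ne_zero (r := r) (by omega) 0)
    ((hgc _).symm.trans ((hgu 0).trans (by rw [hσ1, Equiv.Perm.one_apply])))
  rw [← h2, h3]

end SimplexMatrix

/-! ### The lower bound for the maximum size of a minimal base -/

section LowerBound

variable {F : Type*} [Field F] {k r : ℕ}

theorem finite_lineDecompositions (n : ℕ) [Finite F] : Finite (LineDecompositions n F) := by
  have : Finite (Submodule F (Fin n → F)) := Finite.of_injective _ SetLike.coe_injective
  infer_instance

/-- The facet decompositions and a family of cone decompositions. -/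
def simplexFrames (hk1 : ((k + 1 : ℕ) : F) ≠ 0) (R : Set (Fin r)) :
    R ⊕ Fin (k + 1) → LineDecompositions (k + r) F :=
  Sum.elim (fun s => coneFrame hk1 s.1) (facetFrame F r)

/-- By `htorus` no cone can be spared, and by `hperm` at most `m` facets can. Every base inside the
family thus has at least `|R| + (k + 1) - m` members. -/
theorem le_maxMinimalBaseSize_of_simplexFrames [Finite F] (hk : 2 ≤ k)
    (hk1 : ((k + 1 : ℕ) : F) ≠ 0) {R : Set (Fin r)} {z : Fin r} (hR : ∀ s ≠ z, s ∈ R)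
    (hz : z ∈ R ∨ ∀ b : Fˣ, b ^ (k + r) = 1) {l m : ℕ} (hl : l + m ≤ Nat.card R + (k + 1))
    (htorus : ∀ s ∈ R, ∃ (y : F) (t : Fin r → F), y ^ k * ∏ i, t i = 1 ∧
      (∀ i ∈ R, i ≠ s → t i = y) ∧ t s ≠ y)
    (hperm : ∀ A : Finset (Fin (k + 1)), m < A.card → ∃ (σ : Equiv.Perm (Fin (k + 1)))
      (t : Fin r → F), (simplexMatrix σ 1 t).det = 1 ∧ (∀ s ∈ R, t s = 1) ∧
      (∀ i ∉ A, σ i = i) ∧ σ ≠ 1) :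
    l ≤ maxMinimalBaseSize PSL(k + r, F) (LineDecompositions (k + r) F) := by
  classical
  have := finite_lineDecompositions (F := F) (k + r)
  refine le_maxMinimalBaseSize (simplexFrames hk1 R) (fun g hg => ?_) fun S hS => ?_
  · exact eq_one_of_smul_eq hk hk1 hR hz (fun i => hg (Sum.inr i)) fun s hs => hg (Sum.inl ⟨s, hs⟩)
  · have hAB : ∀ g : PSL(k + r, F),
        (∀ i ∈ {i | Sum.inr i ∈ S}, g • facetFrame F r i = facetFrame F r i) →
        (∀ s ∈ {s | ∃ h : s ∈ R, Sum.inl ⟨s, h⟩ ∈ S}, g • coneFrame hk1 s = coneFrame hk1 s) →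
        g = 1 := fun g h1 h2 => hS g fun j hj => by
      rcases j with ⟨s, hs⟩ | i
      · exact h2 s ⟨hs, hj⟩
      · exact h1 i hj
    have hleft : S.toLeft = Finset.univ := by
      refine Finset.eq_univ_iff_forall.2 fun ⟨s, hs⟩ => Finset.mem_toLeft.2 ?_
      by_contra hcon
      obtain ⟨y, t, hdet, ht, hts⟩ := htorus s hs
      refine hts ((eq_one_of_det_simplexMatrix hk hk1 hAB (σ := 1)
        ((det_simplexMatrix_one y t).trans hdet) (fun _ _ => rfl) ?_).2 s)
      rintro i ⟨hi, hiS⟩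
      exact ht i hi fun h => hcon (by subst h; exact hiS)
    have hright : S.toRightᶜ.card ≤ m := by
      by_contra hcon
      obtain ⟨σ, t, hdet, ht, hσ, hσ1⟩ := hperm _ (not_le.1 hcon)
      refine hσ1 (eq_one_of_det_simplexMatrix hk hk1 hAB hdet (fun i hi => hσ i ?_) ?_).1
      · simpa using hi
      · rintro s ⟨hs, -⟩
        exact ht s hs
    rw [Finset.card_compl, Fintype.card_fin] at hright
    have h1 := Finset.card_toLeft_add_card_toRight (u := S)
    rw [hleft, Finset.card_univ, ← Nat.card_eq_fintype_card] at h1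
    omega

/-- All scalar matrices have determinant 1, so the cone at `z` is superfluous. Leaving it out frees
the tail vector `z` to absorb determinants, both of torus elements and of transpositions; the count
is `(r - 1) + (k + 1) - 1`. -/
theorem le_maxMinimalBaseSize_of_forall_pow_eq_one [Finite F] (hk : 2 ≤ k) (hr : r ≠ 0)
    (hk1 : ((k + 1 : ℕ) : F) ≠ 0) (h : ∀ b : Fˣ, b ^ (k + r) = 1) {b : Fˣ} (hb : b ≠ 1) :
    k + r - 1 ≤ maxMinimalBaseSize PSL(k + r, F) (LineDecompositions (k + r) F) := by
  classical
  set z : Fin r := ⟨0, Nat.pos_of_ne_zero hr⟩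
  refine le_maxMinimalBaseSize_of_simplexFrames (R := {z}ᶜ) (z := z) (m := 1) hk hk1
    (fun s hs => hs) (Or.inr h) ?_ (fun s hs => ?_) fun A hA => ?_
  · rw [Nat.card_coe_set_eq, Set.ncard_compl]
    simp
    omega
  · refine ⟨1, fun i => (Matrix.GeneralLinearGroup.pairTorus s z b i : F), ?_, ?_, ?_⟩
    · rw [← Units.coe_prod, Matrix.GeneralLinearGroup.prod_pairTorus, one_pow, Units.val_one,
        one_mul]
    · intro i hi his
      beta_reduce
      rw [Matrix.GeneralLinearGroup.pairTorus_of_ne his hi, Units.val_one]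
    · beta_reduce
      rw [Matrix.GeneralLinearGroup.pairTorus_left hs]
      simpa using hb
  · obtain ⟨i, hi, l, hl, hil⟩ := Finset.one_lt_card.1 hA
    set δ := (simplexMatrix (r := r) (Equiv.swap i l) (1 : F) 1).det with hδ
    refine ⟨Equiv.swap i l, Pi.mulSingle z δ, ?_, ?_, ?_, ?_⟩
    · rw [det_simplexMatrix_one_right, Finset.prod_pi_mulSingle', if_pos (Finset.mem_univ _)]
      exact det_simplexMatrix_mul_self (Equiv.swap_mul_self i l)
    · exact fun s hs => Pi.mulSingle_eq_of_ne hs _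
    · exact fun m hm => Equiv.swap_apply_of_ne_of_ne (fun h => hm (h ▸ hi)) fun h => hm (h ▸ hl)
    · exact fun h => hil (Equiv.swap_eq_one_iff.1 h)

/-- The scalar `b` with its determinant corrected at `s` alone is not scalar, so the cone at `s` is
needed. With all cones present no tail vector is free to absorb a sign, so 3-cycles replace
transpositions; the count is `r + (k + 1) - 2`. -/
theorem le_maxMinimalBaseSize_of_pow_ne_one [Finite F] (hk : 2 ≤ k) (hr : r ≠ 0)
    (hk1 : ((k + 1 : ℕ) : F) ≠ 0) {b : Fˣ} (hb : b ^ (k + r) ≠ 1) :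
    k + r - 1 ≤ maxMinimalBaseSize PSL(k + r, F) (LineDecompositions (k + r) F) := by
  classical
  refine le_maxMinimalBaseSize_of_simplexFrames (R := Set.univ)
    (z := ⟨0, Nat.pos_of_ne_zero hr⟩) (m := 2) hk hk1
    (fun s _ => Set.mem_univ s) (Or.inl (Set.mem_univ _)) ?_ (fun s _ => ?_) fun A hA => ?_
  · simp
    omega
  · refine ⟨b, fun i => (b * Pi.mulSingle (M := fun _ => Fˣ) s (b ^ (k + r))⁻¹ i : Fˣ), ?_, ?_, ?_⟩
    · rw [← Units.coe_prod, ← Units.val_pow_eq_pow_val, ← Units.val_mul, Finset.prod_mul_distrib,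
        Finset.prod_pi_mulSingle', if_pos (Finset.mem_univ _), Finset.prod_const, Finset.card_univ,
        Fintype.card_fin, ← mul_assoc, ← pow_add, mul_inv_cancel, Units.val_one]
    · intro i _ his
      beta_reduce
      rw [Pi.mulSingle_eq_of_ne his, mul_one]
    · beta_reduce
      rw [Pi.mulSingle_eq_same]
      simpa [Units.ext_iff] using hb
  · obtain ⟨i, j, l, hi, hj, hl, hij, hil, hjl⟩ := Finset.two_lt_card_iff.1 hA
    -- A 3-cycle written as the square of a product of two transpositions, so that its determinant
    -- is visibly 1.
    refine ⟨Equiv.swap i j * Equiv.swap j l * (Equiv.swap i j * Equiv.swap j l), 1, ?_, ?_, ?_, ?_⟩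
    · exact det_simplexMatrix_mul_sq (Equiv.swap_mul_self _ _) (Equiv.swap_mul_self _ _)
    · simp
    · intro m hm
      have hmi : m ≠ i := fun h => hm (h ▸ hi)
      have hmj : m ≠ j := fun h => hm (h ▸ hj)
      have hml : m ≠ l := fun h => hm (h ▸ hl)
      simp [Equiv.swap_apply_of_ne_of_ne, hmi, hmj, hml]
    · intro h
      have := congrArg (fun σ : Equiv.Perm (Fin (k + 1)) => σ i) h
      simp [Equiv.swap_apply_of_ne_of_ne, hij, hil, hil.symm, hjl.symm] at this

theorem sub_one_le_maxMinimalBaseSize {n : ℕ} (hn : 4 ≤ n) [Fintype F]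
    (hq : 3 ≤ Fintype.card F) :
    n - 1 ≤ maxMinimalBaseSize PSL(n, F) (LineDecompositions n F) := by
  classical
  -- Take `k = 2` unless the characteristic is 3, when `k = 3` gives `k + 1 = 1` in the field.
  obtain ⟨k, hk2, hk3, hk⟩ : ∃ k, 2 ≤ k ∧ k ≤ 3 ∧ ((k + 1 : ℕ) : F) ≠ 0 := by
    by_cases h3 : (3 : F) = 0
    · refine ⟨3, by norm_num, le_rfl, ?_⟩
      have : ((3 + 1 : ℕ) : F) = 1 := by
        rw [Nat.cast_succ, Nat.cast_ofNat, h3, zero_add]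
      rw [this]
      exact one_ne_zero
    · exact ⟨2, le_rfl, by norm_num, by norm_num; exact h3⟩
  obtain ⟨r, rfl⟩ := Nat.exists_eq_add_of_le (show k ≤ n by omega)
  by_cases h : ∀ b : Fˣ, b ^ (k + r) = 1
  · have : Nontrivial Fˣ := Fintype.one_lt_card_iff_nontrivial.1 (by
      rw [Fintype.card_units]; omega)
    obtain ⟨b, hb⟩ := exists_ne (1 : Fˣ)
    exact le_maxMinimalBaseSize_of_forall_pow_eq_one hk2 (by omega) hk h hb
  · push Not at h
    obtain ⟨b, hb⟩ := h
    exact le_maxMinimalBaseSize_of_pow_ne_one hk2 (by omega) hk hb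

end LowerBound

theorem mainTheorem6 (n : ℕ) (hn : 13 ≤ n) (F : Type*) [Field F] [Fintype F]
    (hq : 5 ≤ Fintype.card F) :
    IsPrimitiveAction PSL(n, F) (LineDecompositions n F) ∧
    ¬ IsStandardAction n F (LineDecompositions n F) ∧
    ActionEquivalent PSL(n, F) (LineDecompositions n F) (MulEquiv.refl PSL(n, F))
      (PSL(n, F) ⧸ Subgroup.normalizer (splitTorus n F : Set PSL(n, F))) ∧
    n - 1 ≤ maxMinimalBaseSize PSL(n, F) (LineDecompositions n F) := by
  refine ⟨isPrimitiveAction_lineDecompositions hn hq, ?_,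
    actionEquivalent_normalizer_splitTorus hn hq, ?_⟩
  · rintro ⟨-, -, h | ⟨m, e, hm, -⟩⟩
    · exact not_isSubspaceSubgroup_stabilizer_stdFrame hn hq (h _)
    · exact (isEmpty_mulEquiv_alternatingGroup hn (by omega)).false e
  · exact sub_one_le_maxMinimalBaseSize (by omega) (by omega)
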